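/- **Setting.** Let $d,J,K,T\ge 1$ be integers and $\mathcal C$ a countable context set. In each round $t=1,\dots,T$ the learner sees a context $c(t)\in\mathcal C$ and the costs $W^{(k)}(c(t),j)$ ($k\in[K]$, $j\in[J]$), takes an action $A(t)\in[J]$ (put $X_j(t)=\mathbf 1\{A(t)=j\}$) and receives the reward $R(c(t),A(t))$, where $R(c(t),j)=r(c(t),j)+\eta(t)$, $r(c,j)=\langle\theta_*,\phi(c,j)\rangle$, $\phi(c,j)\in\mathbb R^d$ is a known feature vector and $\theta_*\in\mathbb R^d$ is unknown. Let $\mathcal F_t$ be the history generated by $c(s),A(s),R(c(s),A(s)),W^{(k)}(c(s),A(s))$ for $s\le t$, $k\in[K]$. **Assumptions.** (1) In each round, the context and the costs are drawn afresh, with the same joint law in every round and independently of $\mathcal F_{t-1}$; $\mathbb P(c(t)=c)=p_c$, and the costs of context $c$ have means $w^{(k)}(c,j)=\mathbb E[W^{(k)}(c,j)]$ and satisfy $|W^{(k)}(c,j)|\le 1$ almost surely. (2) For all $c,j$: $r(c,j)\in[0,1]$ and $\|\phi(c,j)\|\le1$; moreover $\|\theta_*\|\le m$, where $m$ is known; $\eta(t)$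 is zero-mean and $1$-sub-Gaussian conditionally on $\mathcal F_{t-1}$, $c(t)$ and $A(t)$. (3) (Slater) Consider the linear program $$\max_{x}\ \sum_{c,j}p_c\,r(c,j)\,x_{c,j}\quad\text{s.t.}\quad \sum_j x_{c,j}=1,\ x_{c,j}\ge0\ \ \forall c,j,\qquad \sum_{c,j}p_c\,w^{(k)}(c,j)\,x_{c,j}\le0\ \ \forall k .$$ For the known constant $\delta\in(0,1]$ it has a feasible point with $\sum_{c,j}p_cw^{(k)}(c,j)x_{c,j}\le-\delta$ for all $k$. Let $\mathrm{OPT}$ denote its optimal value. **Algorithm (pessimistic-optimistic).** Put $V_t=\delta K^{1/4}\sqrt{2t/3}$, $\epsilon_t=K^{3/4}\sqrt{6/t}$, $Q^{(k)}(1)=0$, $\Sigma_0=I$ and $\hat\theta_0=0$. In round $t$ let $$\mathcal B_t=\Big\{\theta:\|\theta-\hat\theta_{t-1}\|_{\Sigma_{t-1}}\le m+\sqrt{2\log T+d\log\big(1+\tfrac{t-1}{d}\big)}\Big\},\qquad \|v\|_{\Sigma}=\sqrt{v^\dagger\Sigma v},$$ and $\hat r(c(t),j)=\min\{1,\max_{\theta\in\mathcal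 B_t}\langle\theta,\phi(c(t),j)\rangle\}$; take an action $A(t)$ that maximizes $\hat r(c(t),j)-\frac1{V_t}\sum_kW^{(k)}(c(t),j)Q^{(k)}(t)$ over $j$, ties being broken arbitrarily; then update $$Q^{(k)}(t+1)=\Big[Q^{(k)}(t)+\sum_jW^{(k)}(c(t),j)X_j(t)+\epsilon_t\Big]^+,$$ $$\Sigma_t=\Sigma_{t-1}+\phi(c(t),A(t))\phi(c(t),A(t))^\dagger,\qquad \hat\theta_t=\Sigma_t^{-1}\sum_{s\le t}\phi(c(s),A(s))R(c(s),A(s)).$$ **Theorem.** For every $\tau\in\{1,\dots,T\}$, the regret $\mathcal R(\tau)=\tau\,\mathrm{OPT}-\mathbb E\big[\sum_{t=1}^\tau\sum_jR(c(t),j)X_j(t)\big]$ and the constraint violation $\mathcal V(\tau)=\sum_k\big(\mathbb E\big[\sum_{t=1}^\tau\sum_jW^{(k)}(c(t),j)X_j(t)\big]\big)^+$ of the algorithm satisfy $$\mathcal R(\tau)\le\frac{60K^3}{\delta^3}+\frac{4\sqrt6\,K^{0.75}\sqrt\tau}{\delta}+2+\sqrt{8d\tau\beta_\tau\log\frac{d+\tau}{d}},\qquad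 \sqrt{\beta_\tau}=m+\sqrt{2\log T+d\log(1+\tau/d)},$$ $$\mathcal V(\tau)\le K^{1.5}\big(C_{K,\delta}-\sqrt\tau\big)^+,\qquad C_{K,\delta}=\frac{48K^2}{\delta}\log\frac{16}{\delta}+\frac{24K^{1.5}}{\delta^2}+\frac{30K^{1.5}}{\delta}+8K .$$ In particular $\mathcal V(\tau)=0$ as soon as $\tau\ge C_{K,\delta}^2$, a threshold that does not depend on $T$. -/

import Mathlib

open MeasureTheory ProbabilityTheory

namespace ConstrainedBandit

noncomputable section

/-- Unknown environment of a stochastic linear bandit with a context set `C`, feature dimension `d`,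
action set `Fin J` and `K` types of costs. -/
structure Model (C : Type*) (d J K : ℕ) where
  /-- the law of a context; `p x` is the probability that context `x` is drawn in a round -/
  p : PMF C
  /-- the feature map -/
  φ : C → Fin J → EuclideanSpace ℝ (Fin d)
  /-- the true reward parameter -/
  θ : EuclideanSpace ℝ (Fin d)
  /-- `ν x` is the (joint) law of the random costs `(W⁽ᵏ⁾(x, j))` over `k` and `j`, for context `x` -/
  ν : C → ProbabilityMeasure (Fin K → Fin J → ℝ)

/-- The random quantities of the interaction. Rounds are numbered `1, 2, …`; index `0` is unused. -/
structure Interaction (Ω C : Type*) (J K : ℕ) where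
  /-- context `c(t)` -/
  c : ℕ → Ω → C
  /-- `W t ω k j` is the cost `W⁽ᵏ⁾(c(t), j)` of round `t` -/
  W : ℕ → Ω → Fin K → Fin J → ℝ
  /-- action `A(t)` -/
  A : ℕ → Ω → Fin J
  /-- reward noise `η(t)` -/
  η : ℕ → Ω → ℝ

/-! ### The model: means, baseline problem, assumptions -/

section ModelDefs

variable {C : Type*} {d J K : ℕ} (M : Model C d J K)

/-- Mean reward `r(c, j) = ⟨θ, φ(c, j)⟩`. -/
def Model.r (x : C) (j : Fin J) : ℝ := inner ℝ M.θ (M.φ x j)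

/-- Mean cost `w⁽ᵏ⁾(c, j) = E[W⁽ᵏ⁾(c, j)]`. -/
def Model.w (k : Fin K) (x : C) (j : Fin J) : ℝ :=
  ∫ N, N k j ∂(M.ν x : Measure (Fin K → Fin J → ℝ))

/-- `∑_{c,j} p_c r(c,j) x_{c,j}`. -/
def Model.value (x : C → Fin J → ℝ) : ℝ :=
  ∑' a, ∑ j, (M.p a).toReal * M.r a j * x a j

/-- `∑_{c,j} p_c w⁽ᵏ⁾(c,j) x_{c,j}`. -/
def Model.cost (k : Fin K) (x : C → Fin J → ℝ) : ℝ :=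
  ∑' a, ∑ j, (M.p a).toReal * M.w k a j * x a j

/-- Feasible points of the baseline linear program. -/
def Model.Feasible (x : C → Fin J → ℝ) : Prop :=
  (∀ a, ∑ j, x a j = 1) ∧ (∀ a j, 0 ≤ x a j) ∧ ∀ k, M.cost k x ≤ 0

/-- Optimal value of the baseline linear program. -/
def Model.optValue : ℝ := sSup (M.value '' {x | M.Feasible x})

/-- Slater's condition with constant `δ`. -/
def Model.Slater (δ : ℝ) : Prop :=
  ∃ x, M.Feasible x ∧ ∀ k, M.cost k x ≤ -δ

end ModelDefs

section InteractionDefs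

variable {Ω C : Type*} {d J K : ℕ}

/-- Action indicator `X_j(t)`. -/
def Interaction.X (I : Interaction Ω C J K) (t : ℕ) (ω : Ω) (j : Fin J) : ℝ :=
  if I.A t ω = j then 1 else 0

/-- Reward `R(c(t), j) = r(c(t), j) + η(t)` in round `t` for action `j`. -/
def Interaction.R (I : Interaction Ω C J K) (M : Model C d J K) (t : ℕ) (ω : Ω) (j : Fin J) : ℝ :=
  M.r (I.c t ω) j + I.η t ω

/-- The reward `R(c(t), A(t))` that is received in round `t`. -/
def Interaction.obs (I : Interaction Ω C J K) (M : Model C d J K) (t : ℕ) (ω : Ω) : ℝ :=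
  I.R M t ω (I.A t ω)

/-- The history `F_t`, generated by `c(s)`, `A(s)`, `R(c(s), A(s))` and the
`W⁽ᵏ⁾(c(s), A(s))` for `1 ≤ s ≤ t`. -/
@[reducible] def Interaction.history [MeasurableSpace C] (I : Interaction Ω C J K) (M : Model C d J K) (t : ℕ) :
    MeasurableSpace Ω :=
  ⨆ s ∈ Finset.Icc 1 t, MeasurableSpace.comap
    (fun ω => (I.c s ω, I.A s ω, I.obs M s ω, fun k : Fin K => I.W s ω k (I.A s ω))) inferInstance

/-- What the noise of round `t` is conditioned on: `F_{t-1}`, and the action `A(t)` taken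
on the context `c(t)`. -/
@[reducible] def Interaction.preReward [MeasurableSpace C] (I : Interaction Ω C J K) (M : Model C d J K)
    (t : ℕ) : MeasurableSpace Ω :=
  I.history M (t - 1) ⊔ MeasurableSpace.comap (fun ω => (I.c t ω, I.A t ω)) inferInstance

/-- `Y` has zero mean and is `1`-sub-Gaussian conditionally on `G`. (No regularity of the
underlying probability space is required.) -/
def CondSubGaussian (G : MeasurableSpace Ω) [MeasurableSpace Ω] (Y : Ω → ℝ)
    (μ : Measure Ω) : Prop :=
  Integrable Y μ ∧ μ[Y|G] =ᵐ[μ] 0 ∧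
    ∀ l : ℝ, Integrable (fun ω => Real.exp (l * Y ω)) μ ∧
      ∀ᵐ ω ∂μ, (μ[fun ω => Real.exp (l * Y ω)|G]) ω ≤ Real.exp (l ^ 2 / 2)

/-- The random quantities of rounds `1, …, T` are generated by the environment `M`: each round's
context and costs are drawn afresh, independently of the history, with `c(t)` distributed as `p`
and, given `c(t) = x`, the costs distributed as `ν x`. -/
structure Interaction.GeneratedBy [MeasurableSpace Ω] [MeasurableSpace C]
    (I : Interaction Ω C J K) (M : Model C d J K) (T : ℕ) (μ : Measure Ω) : Prop where
  measurable_c : ∀ t ∈ Finset.Icc 1 T, Measurable (I.c t)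
  measurable_W : ∀ t ∈ Finset.Icc 1 T, Measurable (I.W t)
  measurable_A : ∀ t ∈ Finset.Icc 1 T, Measurable (I.A t)
  measurable_η : ∀ t ∈ Finset.Icc 1 T, Measurable (I.η t)
  /-- `P(c(t) = x, W(t) ∈ S) = p x * ν x S` for all contexts `x` and measurable `S` -/
  law : ∀ t ∈ Finset.Icc 1 T, ∀ x : C,
    (μ.restrict (I.c t ⁻¹' {x})).map (I.W t) = M.p x • (M.ν x : Measure (Fin K → Fin J → ℝ))
  indep : ∀ t ∈ Finset.Icc 1 T, Indep (I.history M (t - 1))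
    (MeasurableSpace.comap (fun ω => (I.c t ω, I.W t ω)) inferInstance) μ

/-- Assumption on the rewards. -/
structure RewardAssumption [MeasurableSpace Ω] [MeasurableSpace C]
    (I : Interaction Ω C J K) (M : Model C d J K) (m : ℝ) (T : ℕ) (μ : Measure Ω) : Prop where
  r_mem : ∀ x j, M.r x j ∈ Set.Icc (0 : ℝ) 1
  norm_φ : ∀ x j, ‖M.φ x j‖ ≤ 1
  norm_θ : ‖M.θ‖ ≤ m
  noise : ∀ t ∈ Finset.Icc 1 T, CondSubGaussian (I.preReward M t) (I.η t) μ

/-- Assumption on the costs: they are bounded by `1`. -/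
def CostAssumption (M : Model C d J K) : Prop :=
  ∀ x, ∀ᵐ N ∂(M.ν x : Measure (Fin K → Fin J → ℝ)), ∀ k j, |N k j| ≤ 1

/-- (Pseudo-)regret `𝓡(τ)`. -/
def Interaction.regret [MeasurableSpace Ω] (I : Interaction Ω C J K) (M : Model C d J K)
    (μ : Measure Ω) (τ : ℕ) : ℝ :=
  τ * M.optValue - ∫ ω, ∑ t ∈ Finset.Icc 1 τ, ∑ j, I.R M t ω j * I.X t ω j ∂μ

/-- Constraint violation `𝓥(τ)`. -/
def Interaction.violation [MeasurableSpace Ω] (I : Interaction Ω C J K)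
    (μ : Measure Ω) (τ : ℕ) : ℝ :=
  ∑ k, max (∫ ω, ∑ t ∈ Finset.Icc 1 τ, ∑ j, I.W t ω k j * I.X t ω j ∂μ) 0

end InteractionDefs

/-! ### The algorithm, as a function of what the learner observes

Below `φ` is the feature map and `c`, `A`, `R`, `W` are the sequences of contexts, actions, received
rewards and costs along one sample path. -/

section Algorithm

open Matrix

variable {C : Type*} {d J K : ℕ}

/-- `V_t = δ K^{1/4} √(2t/3)`. -/
def V (K : ℕ) (δ : ℝ) (t : ℕ) : ℝ := δ * (K : ℝ) ^ (1 / 4 : ℝ) * √(2 * t / 3)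

/-- `ε_t = K^{3/4} √(6/t)`. -/
def eps (K : ℕ) (t : ℕ) : ℝ := (K : ℝ) ^ (3 / 4 : ℝ) * √(6 / t)

/-- `m + √(2 log T + d log (1 + s/d))`. -/
def sqrtBeta (m : ℝ) (d T s : ℕ) : ℝ :=
  m + √(2 * Real.log T + d * Real.log (1 + s / d))

/-- Weighted norm `‖v‖_S = √(vᵀ S v)`. -/
def wnorm (S : Matrix (Fin d) (Fin d) ℝ) (v : EuclideanSpace ℝ (Fin d)) : ℝ :=
  √(v.ofLp ⬝ᵥ (S *ᵥ v.ofLp))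

/-- `Σ_t = I + ∑_{s ≤ t} φ(c(s), A(s)) φ(c(s), A(s))ᵀ`. -/
def gram (φ : C → Fin J → EuclideanSpace ℝ (Fin d)) (c : ℕ → C) (A : ℕ → Fin J) (t : ℕ) :
    Matrix (Fin d) (Fin d) ℝ :=
  1 + ∑ s ∈ Finset.Icc 1 t, vecMulVec (φ (c s) (A s)).ofLp (φ (c s) (A s)).ofLp

/-- Least-squares estimate `Σ_t⁻¹ ∑_{s ≤ t} φ(c(s), A(s)) R(c(s), A(s))`. -/
def thetaHat (φ : C → Fin J → EuclideanSpace ℝ (Fin d)) (c : ℕ → C) (A : ℕ → Fin J) (R : ℕ → ℝ)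
    (t : ℕ) : EuclideanSpace ℝ (Fin d) :=
  WithLp.toLp 2 ((gram φ c A t)⁻¹ *ᵥ ∑ s ∈ Finset.Icc 1 t, R s • (φ (c s) (A s)).ofLp)

/-- Confidence set `𝓑_t` of round `t ≥ 1`, built from the data of rounds `1, …, t - 1`. -/
def confSet (φ : C → Fin J → EuclideanSpace ℝ (Fin d)) (m : ℝ) (T : ℕ) (c : ℕ → C)
    (A : ℕ → Fin J) (R : ℕ → ℝ) (t : ℕ) : Set (EuclideanSpace ℝ (Fin d)) :=
  {θ | wnorm (gram φ c A (t - 1)) (θ - thetaHat φ c A R (t - 1)) ≤ sqrtBeta m d T (t - 1)}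

/-- Optimistic reward estimate of action `j` in round `t`:
`min {1, max_{θ ∈ 𝓑_t} ⟨θ, φ(c(t), j)⟩}`. -/
def rHat (φ : C → Fin J → EuclideanSpace ℝ (Fin d)) (m : ℝ) (T : ℕ) (c : ℕ → C)
    (A : ℕ → Fin J) (R : ℕ → ℝ) (t : ℕ) (j : Fin J) : ℝ :=
  min 1 (sSup ((fun θ => inner ℝ θ (φ (c t) j)) '' confSet φ m T c A R t))

/-- Dual variables: `Q⁽ᵏ⁾(1) = 0` and
`Q⁽ᵏ⁾(t+1) = [Q⁽ᵏ⁾(t) + ∑_j W⁽ᵏ⁾(c(t), j) X_j(t) + ε_t]⁺`. The value at `0` is unused. -/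
def Q (W : ℕ → Fin K → Fin J → ℝ) (A : ℕ → Fin J) : ℕ → Fin K → ℝ
  | 0, _ => 0
  | 1, _ => 0
  | t + 2, k =>
      max (Q W A (t + 1) k + ∑ j, W (t + 1) k j * (if A (t + 1) = j then 1 else 0)
        + eps K (t + 1)) 0

/-- Pseudo-action-value of action `j` in round `t`. -/
def pseudoValue (φ : C → Fin J → EuclideanSpace ℝ (Fin d)) (m δ : ℝ) (T : ℕ) (c : ℕ → C)
    (W : ℕ → Fin K → Fin J → ℝ) (A : ℕ → Fin J) (R : ℕ → ℝ) (t : ℕ) (j : Fin J) : ℝ :=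
  rHat φ m T c A R t j - 1 / V K δ t * ∑ k, W t k j * Q W A t k

/-- The actions of rounds `1, …, T` are those of the pessimistic-optimistic algorithm: in each
round an action of largest pseudo-action-value is taken, ties being broken arbitrarily. -/
def Interaction.FollowsAlgorithm {Ω : Type*} (I : Interaction Ω C J K) (M : Model C d J K)
    (m δ : ℝ) (T : ℕ) : Prop :=
  ∀ t ∈ Finset.Icc 1 T, ∀ ω, ∀ j,
    pseudoValue M.φ m δ T (fun s => I.c s ω) (fun s => I.W s ω) (fun s => I.A s ω)
        (fun s => I.obs M s ω) t j ≤
      pseudoValue M.φ m δ T (fun s => I.c s ω) (fun s => I.W s ω) (fun s => I.A s ω)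
        (fun s => I.obs M s ω) t (I.A t ω)

/-- `48 K²/δ · log (16/δ) + 24 K^{3/2}/δ² + 30 K^{3/2}/δ + 8 K`. -/
def violationConst (K : ℕ) (δ : ℝ) : ℝ :=
  48 * (K : ℝ) ^ 2 / δ * Real.log (16 / δ) + 24 * (K : ℝ) ^ (3 / 2 : ℝ) / δ ^ 2
    + 30 * (K : ℝ) ^ (3 / 2 : ℝ) / δ + 8 * K

end Algorithm

end

end ConstrainedBandit

/-! Two ingredients carry both bounds: a self-normalized noise estimate and a drift analysis of the
dual variables `Q`.

Noise. Let z be the norm of the noise sum in Σ_t⁻¹ and b the noise part of the confidence radius.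
The Gaussian mixture exp(z²/2)/√det Σ_t (`mixture`) is a nonnegative supermartingale started at 1,
because its one-step ratio is an average of exp(lη - l²/2) over a Gaussian l with parameters known
before η is revealed (`lintegral_mul_mixtureRatio_le`). The determinant bound and the choice of b
give exp((z² - b²)/2) ≤ `mixture`/T. This is used in two ways. For regret, the loss of optimism (z -
b)⁺ and the indicator of z > b together are at most 2·`mixture`/T (`noise_excess_le`), so they cost
2/T per round in expectation. For the violation, Ville's inequality makes `mixture` ≤ T in all
rounds outside an event of probability at most 1/T (`measure_compl_tame_le`).

Regret. The action taken has at least the pseudo-action-value of any mixed action. As Q(t) is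
determined by the history and the context and costs of round t are independent of it, expectations
of Q times the cost of a mixed action factor (`integral_mul_mixed_cost`). The increase of ‖Q‖²
contains ε_t ∑ Q. To cancel it, the round is compared with weight 1 - θ against a feasible point and
with weight θ = min(1, ε_t/δ) against the Slater point; this costs at most θ in reward and gains θδ
∑ Q/V_t (`IsRun.value_le`). What remains, (ε_t - δ)⁺ ∑ Q, lives only in early rounds, where the
crude bound on Q suffices. Summation by parts removes the ‖Q‖² terms, the elliptical potential lemma
bounds the widths, and elementary sums give the constants (`regret_terms_le`).

Violation. Q(τ+1) dominates the costs paid plus ∑ ε_t, so the expected cost is at most E Q(τ+1) - ∑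
ε_t. While `mixture` ≤ T and once ε_t ≤ δ/2, the Slater point gives ‖Q‖ a drift of at most -δ/4
above a level of order V_t/δ. As the increments of ‖Q‖ are bounded, exp(r‖Q‖) contracts in mean for
small r (`IsRun.integral_lyapunov_succ_le`), whence E Q(τ+1) is at most that level plus a constant
(`IsRun.integral_queue_le`). Both the level and ∑ ε_t grow like √τ, and V_t and ε_t are tuned so
that the latter wins by at least √K·√τ (`violation_terms_le`). -/

namespace ConstrainedBandit

noncomputable section

/-! ### Quadratic forms of positive definite matrices and rank-one updates -/

section LinearAlgebra

open Matrix

variable {n : Type*} [Fintype n]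

theorem dotProduct_mulVec_comm_of_isHermitian {B : Matrix n n ℝ} (hB : B.IsHermitian)
    (x y : n → ℝ) : x ⬝ᵥ (B *ᵥ y) = y ⬝ᵥ (B *ᵥ x) := by
  have h : Bᵀ = B := by simpa [Matrix.IsHermitian, conjTranspose_eq_transpose_of_trivial] using hB
  calc x ⬝ᵥ (B *ᵥ y) = (x ᵥ* B) ⬝ᵥ y := dotProduct_mulVec x B y
    _ = (B *ᵥ x) ⬝ᵥ y := by rw [← mulVec_transpose, h]
    _ = _ := dotProduct_comm _ _

/-- Cauchy–Schwarz for a semidefinite form: the quadratic polynomial t ↦ (x + ty)ᵀB(x + ty) is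
nonnegative, so its discriminant is not positive. -/
theorem sq_dotProduct_mulVec_le {B : Matrix n n ℝ} (hB : B.PosSemidef) (x y : n → ℝ) :
    (x ⬝ᵥ (B *ᵥ y)) ^ 2 ≤ (x ⬝ᵥ (B *ᵥ x)) * (y ⬝ᵥ (B *ᵥ y)) := by
  have h : ∀ t : ℝ, 0 ≤ (y ⬝ᵥ (B *ᵥ y)) * (t * t) + (2 * (x ⬝ᵥ (B *ᵥ y))) * t
      + x ⬝ᵥ (B *ᵥ x) := by
    intro t
    have := hB.dotProduct_mulVec_nonneg (x + t • y)
    simp only [star_trivial, mulVec_add, mulVec_smul, dotProduct_add, add_dotProduct,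
      smul_dotProduct, dotProduct_smul, smul_eq_mul,
      dotProduct_mulVec_comm_of_isHermitian hB.isHermitian y x] at this
    linarith
  have := discrim_le_zero h
  rw [discrim] at this
  nlinarith

theorem posDef_add_vecMulVec {S : Matrix n n ℝ} (hS : S.PosDef) (v : n → ℝ) :
    (S + vecMulVec v v).PosDef :=
  hS.add_posSemidef (by simpa using posSemidef_vecMulVec_self_star v)

variable [DecidableEq n]

/-- The quadratic form `xᵀ S⁻¹ x`. -/
def invQuad (S : Matrix n n ℝ) (x : n → ℝ) : ℝ := x ⬝ᵥ (S⁻¹ *ᵥ x)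

theorem invQuad_nonneg {S : Matrix n n ℝ} (hS : S.PosDef) (x : n → ℝ) : 0 ≤ invQuad S x := by
  simpa [invQuad] using hS.inv.posSemidef.dotProduct_mulVec_nonneg x

theorem mulVec_inv_mulVec {S : Matrix n n ℝ} (hS : S.PosDef) (x : n → ℝ) :
    S *ᵥ (S⁻¹ *ᵥ x) = x := by
  rw [mulVec_mulVec, mul_nonsing_inv _ ((isUnit_iff_isUnit_det _).1 hS.isUnit), one_mulVec]

theorem inv_mulVec_eq {S : Matrix n n ℝ} (hS : S.PosDef) {x y : n → ℝ} (h : S *ᵥ y = x) :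
    S⁻¹ *ᵥ x = y := by
  rw [← h, mulVec_mulVec, nonsing_inv_mul _ ((isUnit_iff_isUnit_det _).1 hS.isUnit), one_mulVec]

/-- Duality of the norms of S and S⁻¹: Cauchy–Schwarz for S applied to u and S⁻¹v. -/
theorem abs_dotProduct_le {S : Matrix n n ℝ} (hS : S.PosDef) (u v : n → ℝ) :
    |u ⬝ᵥ v| ≤ √(u ⬝ᵥ (S *ᵥ u)) * √(invQuad S v) := by
  have h := sq_dotProduct_mulVec_le hS.posSemidef u (S⁻¹ *ᵥ v)
  rw [mulVec_inv_mulVec hS, dotProduct_comm (S⁻¹ *ᵥ v) v] at h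
  rw [← Real.sqrt_mul (by simpa using hS.posSemidef.dotProduct_mulVec_nonneg u)]
  exact Real.abs_le_sqrt h

theorem sqrt_invQuad_sub_le {S : Matrix n n ℝ} (hS : S.PosDef) (x y : n → ℝ) :
    √(invQuad S (x - y)) ≤ √(invQuad S x) + √(invQuad S y) := by
  have hx := invQuad_nonneg hS x
  have hy := invQuad_nonneg hS y
  have hcs := sq_dotProduct_mulVec_le hS.inv.posSemidef x y
  have hc : -(x ⬝ᵥ (S⁻¹ *ᵥ y)) ≤ √(invQuad S x) * √(invQuad S y) := by
    rw [← Real.sqrt_mul hx]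
    exact (neg_le_abs _).trans (Real.abs_le_sqrt hcs)
  apply Real.sqrt_le_iff.2
  refine ⟨by positivity, ?_⟩
  have e : invQuad S (x - y) = invQuad S x + invQuad S y - 2 * (x ⬝ᵥ (S⁻¹ *ᵥ y)) := by
    simp only [invQuad, mulVec_sub, dotProduct_sub, sub_dotProduct,
      dotProduct_mulVec_comm_of_isHermitian hS.inv.isHermitian y x]
    ring
  rw [e, add_sq, Real.sq_sqrt hx, Real.sq_sqrt hy]
  linarith

/-- With y = S⁻¹x, S ≥ 1 gives y·y ≤ x·y; add 0 ≤ |x - y|². -/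
theorem invQuad_le_dotProduct_self {S : Matrix n n ℝ} (hS : S.PosDef)
    (h1 : (S - 1).PosSemidef) (x : n → ℝ) : invQuad S x ≤ x ⬝ᵥ x := by
  set y := S⁻¹ *ᵥ x with hy
  have hSy : S *ᵥ y = x := mulVec_inv_mulVec hS x
  have h2 := h1.dotProduct_mulVec_nonneg y
  simp only [star_trivial, sub_mulVec, one_mulVec, dotProduct_sub, hSy] at h2
  have h3 : 0 ≤ (x - y) ⬝ᵥ (x - y) := by simpa using dotProduct_self_star_nonneg (x - y)
  simp only [dotProduct_sub, sub_dotProduct] at h3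
  have h4 := dotProduct_comm x y
  change x ⬝ᵥ y ≤ _
  linarith

/-- The Sherman–Morrison formula for the change of `xᵀ S⁻¹ x` when `x` and `S` are updated
together. -/
theorem invQuad_add_vecMulVec {S : Matrix n n ℝ} (hS : S.PosDef) (v x : n → ℝ) (η : ℝ) :
    invQuad (S + vecMulVec v v) (x + η • v) =
      invQuad S x + (2 * η * (x ⬝ᵥ (S⁻¹ *ᵥ v)) + η ^ 2 * invQuad S v - (x ⬝ᵥ (S⁻¹ *ᵥ v)) ^ 2)
        / (1 + invQuad S v) := by
  have hv := invQuad_nonneg hS v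
  have hne : 1 + invQuad S v ≠ 0 := by positivity
  have hsym := dotProduct_mulVec_comm_of_isHermitian hS.inv.isHermitian v x
  set u := x ⬝ᵥ (S⁻¹ *ᵥ v) with hu
  set a := invQuad S v with ha
  have ha' : v ⬝ᵥ (S⁻¹ *ᵥ v) = a := rfl
  -- The inverse of the updated matrix is never computed: the solution of the linear system is
  -- guessed and checked by multiplication.
  have key : (S + vecMulVec v v)⁻¹ *ᵥ (x + η • v) =
      S⁻¹ *ᵥ x + ((η - u) / (1 + a)) • (S⁻¹ *ᵥ v) := by
    apply inv_mulVec_eq (posDef_add_vecMulVec hS v)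
    rw [add_mulVec, mulVec_add, mulVec_smul, mulVec_inv_mulVec hS, mulVec_inv_mulVec hS,
      vecMulVec_mulVec, dotProduct_add, dotProduct_smul, ha', hsym]
    ext i
    simp
    field_simp
    ring
  have hx : x ⬝ᵥ (S⁻¹ *ᵥ x) = invQuad S x := rfl
  rw [invQuad, key, dotProduct_add, add_dotProduct, dotProduct_smul, add_dotProduct,
    smul_dotProduct, smul_dotProduct, ha', ← hu, hsym, hx]
  simp only [smul_eq_mul]
  field_simp
  ring

theorem det_add_vecMulVec {S : Matrix n n ℝ} (hS : S.PosDef) (v : n → ℝ) :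
    (S + vecMulVec v v).det = S.det * (1 + invQuad S v) := by
  have h := det_add_replicateCol_mul_replicateRow (ι := Unit)
    ((isUnit_iff_isUnit_det _).1 hS.isUnit) v v
  rw [vecMulVec_eq Unit]
  rw [h, invQuad]
  congr 1
  simp [det_unique, mul_apply, dotProduct, mulVec, Finset.sum_mul, Finset.mul_sum]
  rw [Finset.sum_comm]
  refine Finset.sum_congr rfl fun i _ => Finset.sum_congr rfl fun j _ => by ring

/-- The inequality of arithmetic and geometric means for the eigenvalues. -/
theorem det_le_trace_div_pow {S : Matrix n n ℝ} (hS : S.PosSemidef) [Nonempty n] :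
    S.det ≤ (S.trace / Fintype.card n) ^ Fintype.card n := by
  have h0 := hS.eigenvalues_nonneg
  have hc : (0 : ℝ) < Fintype.card n := by exact_mod_cast Fintype.card_pos
  have hg := Real.geom_mean_le_arith_mean Finset.univ (fun _ => 1) hS.isHermitian.eigenvalues
    (by simp) (by simpa using hc) (fun i _ => h0 i)
  simp only [Real.rpow_one, Finset.sum_const, Finset.card_univ, nsmul_eq_mul, mul_one,
    one_mul] at hg
  have hd : S.det = ∏ i, hS.isHermitian.eigenvalues i := by
    simpa using hS.isHermitian.det_eq_prod_eigenvalues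
  have ht : S.trace = ∑ i, hS.isHermitian.eigenvalues i := by
    simpa using hS.isHermitian.trace_eq_sum_eigenvalues
  have hp : 0 ≤ ∏ i, hS.isHermitian.eigenvalues i := Finset.prod_nonneg fun i _ => h0 i
  rw [hd, ht]
  calc _ = ((∏ i, hS.isHermitian.eigenvalues i) ^ ((Fintype.card n : ℝ)⁻¹)) ^ Fintype.card n := by
        rw [← Real.rpow_natCast, ← Real.rpow_mul hp, inv_mul_cancel₀ hc.ne', Real.rpow_one]
    _ ≤ _ := pow_le_pow_left₀ (by positivity) hg _

end LinearAlgebra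

/-! ### The matrices Σ_t: determinant bound and elliptical potential -/

section Gram

open Matrix

variable {C : Type*} {d J : ℕ} (φ : C → Fin J → EuclideanSpace ℝ (Fin d)) (c : ℕ → C)
  (A : ℕ → Fin J)

theorem gram_zero : gram φ c A 0 = 1 := by simp [gram]

theorem gram_succ (t : ℕ) : gram φ c A (t + 1) = gram φ c A t
    + vecMulVec (φ (c (t + 1)) (A (t + 1))).ofLp (φ (c (t + 1)) (A (t + 1))).ofLp := by
  rw [gram, gram, Finset.sum_Icc_succ_top (by omega), add_assoc]

theorem posSemidef_gram_sub_one (t : ℕ) : (gram φ c A t - 1).PosSemidef := by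
  rw [gram, add_sub_cancel_left]
  exact posSemidef_sum _ fun s _ => by
    simpa using posSemidef_vecMulVec_self_star (φ (c s) (A s)).ofLp

theorem posDef_gram (t : ℕ) : (gram φ c A t).PosDef := by
  have := (PosDef.one (n := Fin d) (R := ℝ)).add_posSemidef (posSemidef_gram_sub_one φ c A t)
  simpa using this

theorem trace_gram (t : ℕ) :
    (gram φ c A t).trace = d + ∑ s ∈ Finset.Icc 1 t, ‖φ (c s) (A s)‖ ^ 2 := by
  rw [gram, trace_add, trace_one, trace_sum, Fintype.card_fin]
  congr 1
  refine Finset.sum_congr rfl fun s _ => ?_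
  rw [EuclideanSpace.real_norm_sq_eq]
  simp [trace, vecMulVec_apply, sq]

theorem dotProduct_self_eq_norm_sq (v : EuclideanSpace ℝ (Fin d)) :
    v.ofLp ⬝ᵥ v.ofLp = ‖v‖ ^ 2 := by
  rw [EuclideanSpace.real_norm_sq_eq]
  simp [dotProduct, sq]

variable {φ}

theorem det_gram_le (hφ : ∀ x j, ‖φ x j‖ ≤ 1) (hd : 0 < d) (t : ℕ) :
    (gram φ c A t).det ≤ (1 + t / d : ℝ) ^ d := by
  have : Nonempty (Fin d) := ⟨⟨0, hd⟩⟩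
  have hd' : (0 : ℝ) < d := by exact_mod_cast hd
  have h := det_le_trace_div_pow (posDef_gram φ c A t).posSemidef
  rw [Fintype.card_fin, trace_gram] at h
  refine h.trans (pow_le_pow_left₀ (by positivity) ?_ _)
  rw [div_le_iff₀ hd', add_mul, div_mul_cancel₀ _ hd'.ne', one_mul]
  gcongr
  calc ∑ s ∈ Finset.Icc 1 t, ‖φ (c s) (A s)‖ ^ 2 ≤ ∑ s ∈ Finset.Icc 1 t, (1 : ℝ) :=
        Finset.sum_le_sum fun s _ => pow_le_one₀ (norm_nonneg _) (hφ _ _)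
    _ = t := by simp

/-- The squared width `‖φ(c(t), A(t))‖²` in the norm of `Σ_{t-1}⁻¹`. -/
def width (φ : C → Fin J → EuclideanSpace ℝ (Fin d)) (c : ℕ → C) (A : ℕ → Fin J) (t : ℕ) : ℝ :=
  invQuad (gram φ c A (t - 1)) (φ (c t) (A t)).ofLp

theorem width_nonneg (t : ℕ) : 0 ≤ width φ c A t := invQuad_nonneg (posDef_gram φ c A _) _

theorem det_gram_succ (t : ℕ) :
    (gram φ c A (t + 1)).det = (gram φ c A t).det * (1 + width φ c A (t + 1)) := by
  rw [gram_succ, det_add_vecMulVec (posDef_gram φ c A t), width, Nat.add_sub_cancel]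

theorem det_gram_pos (t : ℕ) : 0 < (gram φ c A t).det := (posDef_gram φ c A t).det_pos

theorem invQuad_gram_le_one (hφ : ∀ x j, ‖φ x j‖ ≤ 1) (t : ℕ) (x : C) (j : Fin J) :
    invQuad (gram φ c A t) (φ x j).ofLp ≤ 1 := by
  refine (invQuad_le_dotProduct_self (posDef_gram φ c A t) (posSemidef_gram_sub_one φ c A t)
    _).trans ?_
  rw [dotProduct_self_eq_norm_sq]
  exact pow_le_one₀ (norm_nonneg _) (hφ _ _)

/-- The elliptical potential lemma. -/
theorem sum_width_le (hφ : ∀ x j, ‖φ x j‖ ≤ 1) (t : ℕ) :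
    ∑ s ∈ Finset.Icc 1 t, width φ c A s ≤ 2 * Real.log (gram φ c A t).det := by
  induction t with
  | zero => simp [gram_zero]
  | succ t ih =>
    rw [Finset.sum_Icc_succ_top (by omega), det_gram_succ]
    have h0 := width_nonneg (φ := φ) c A (t + 1)
    have h1 : width φ c A (t + 1) ≤ 1 := invQuad_gram_le_one c A hφ _ _ _
    rw [Real.log_mul (det_gram_pos c A t).ne' (by positivity)]
    -- For 0 ≤ a ≤ 1, log(1 + a) ≥ 2a/(a + 2) ≥ a/2. The bound a ≤ 1 comes from Σ ≥ I and the unit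
    -- bound on the features.
    have h2 : width φ c A (t + 1) ≤ 2 * Real.log (1 + width φ c A (t + 1)) := by
      have := Real.le_log_one_add_of_nonneg h0
      have h3 : width φ c A (t + 1) / 2 ≤
          2 * width φ c A (t + 1) / (width φ c A (t + 1) + 2) := by
        rw [div_le_div_iff₀ (by norm_num) (by positivity)]
        nlinarith
      linarith
    linarith

/-- Cauchy–Schwarz over the rounds, then the potential lemma and the determinant bound. -/
theorem sum_sqrt_width_le (hφ : ∀ x j, ‖φ x j‖ ≤ 1) (hd : 0 < d) (t : ℕ) :
    ∑ s ∈ Finset.Icc 1 t, √(width φ c A s) ≤ √(t * (2 * d * Real.log (1 + t / d))) := by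
  apply Real.le_sqrt_of_sq_le
  have h := Finset.sum_mul_sq_le_sq_mul_sq (Finset.Icc 1 t) (fun _ => (1 : ℝ))
    (fun s => √(width φ c A s))
  simp only [one_mul, one_pow, Finset.sum_const, Nat.card_Icc, nsmul_eq_mul, mul_one,
    Real.sq_sqrt (width_nonneg c A _), Nat.add_sub_cancel] at h
  refine h.trans (mul_le_mul_of_nonneg_left ?_ (by positivity))
  refine (sum_width_le c A hφ t).trans ?_
  have := Real.log_le_log (det_gram_pos c A t) (det_gram_le c A hφ hd t)
  rw [Real.log_pow] at this
  linarith

end Gram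

/-! ### Confidence ellipsoids, optimism and the mixture process -/

section Optimism

open Matrix

variable {C : Type*} {d J : ℕ}

/-- `∑_{s ≤ t} η(s) φ(c(s), A(s))`. -/
def noiseSum (φ : C → Fin J → EuclideanSpace ℝ (Fin d)) (c : ℕ → C) (A : ℕ → Fin J) (η : ℕ → ℝ)
    (t : ℕ) : Fin d → ℝ :=
  ∑ s ∈ Finset.Icc 1 t, η s • (φ (c s) (A s)).ofLp

/-- The self-normalized noise `‖∑_{s ≤ t} η(s) φ(c(s), A(s))‖` in the norm of `Σ_t⁻¹`. -/
def selfNorm (φ : C → Fin J → EuclideanSpace ℝ (Fin d)) (c : ℕ → C) (A : ℕ → Fin J) (η : ℕ → ℝ)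
    (t : ℕ) : ℝ :=
  √(invQuad (gram φ c A t) (noiseSum φ c A η t))

/-- The width of the confidence ellipsoid due to the noise. -/
def noiseRadius (d T s : ℕ) : ℝ := √(2 * Real.log T + d * Real.log (1 + s / d))

theorem sqrtBeta_eq (m : ℝ) (d T s : ℕ) : sqrtBeta m d T s = m + noiseRadius d T s := rfl

theorem noiseRadius_nonneg (d T s : ℕ) : 0 ≤ noiseRadius d T s := Real.sqrt_nonneg _

theorem sqrtBeta_mono (m : ℝ) (d T : ℕ) {s s' : ℕ} (h : s ≤ s') :
    sqrtBeta m d T s ≤ sqrtBeta m d T s' := by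
  unfold sqrtBeta
  have : (s : ℝ) ≤ s' := by exact_mod_cast h
  gcongr

theorem wnorm_sub_comm (S : Matrix (Fin d) (Fin d) ℝ) (u v : EuclideanSpace ℝ (Fin d)) :
    wnorm S (u - v) = wnorm S (v - u) := by
  have : u - v = -(v - u) := by abel
  rw [this, wnorm, wnorm]
  simp only [WithLp.ofLp_neg, mulVec_neg, dotProduct_neg, neg_dotProduct, neg_neg]

theorem wnorm_smul_of_nonneg (S : Matrix (Fin d) (Fin d) ℝ) {a : ℝ} (ha : 0 ≤ a)
    (v : EuclideanSpace ℝ (Fin d)) : wnorm S (a • v) = a * wnorm S v := by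
  rw [wnorm, wnorm]
  simp only [WithLp.ofLp_smul, mulVec_smul, dotProduct_smul, smul_dotProduct, smul_eq_mul]
  rw [← mul_assoc, Real.sqrt_mul (mul_nonneg ha ha), Real.sqrt_mul_self ha]

theorem real_inner_eq_dotProduct (u v : EuclideanSpace ℝ (Fin d)) :
    inner ℝ u v = u.ofLp ⬝ᵥ v.ofLp := by
  rw [EuclideanSpace.inner_eq_star_dotProduct, star_trivial, dotProduct_comm]

theorem abs_inner_le_wnorm {S : Matrix (Fin d) (Fin d) ℝ} (hS : S.PosDef)
    (u v : EuclideanSpace ℝ (Fin d)) :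
    |inner ℝ u v| ≤ wnorm S u * √(invQuad S v.ofLp) := by
  rw [real_inner_eq_dotProduct]
  exact abs_dotProduct_le hS _ _

variable {φ : C → Fin J → EuclideanSpace ℝ (Fin d)} {θ : EuclideanSpace ℝ (Fin d)}
  {c : ℕ → C} {A : ℕ → Fin J} {R η : ℕ → ℝ}

theorem gram_mulVec_eq (θ : EuclideanSpace ℝ (Fin d)) (t : ℕ) :
    gram φ c A t *ᵥ θ.ofLp = θ.ofLp
      + ∑ s ∈ Finset.Icc 1 t, (inner ℝ θ (φ (c s) (A s)) : ℝ) • (φ (c s) (A s)).ofLp := by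
  rw [gram, add_mulVec, one_mulVec, sum_mulVec]
  congr 1
  refine Finset.sum_congr rfl fun s _ => ?_
  rw [vecMulVec_mulVec, real_inner_eq_dotProduct, dotProduct_comm]
  ext i
  simp [mul_comm]

theorem thetaHat_sub_eq (t : ℕ) (hR : ∀ s ∈ Finset.Icc 1 t,
    R s = inner ℝ θ (φ (c s) (A s)) + η s) :
    (thetaHat φ c A R t - θ).ofLp = (gram φ c A t)⁻¹ *ᵥ (noiseSum φ c A η t - θ.ofLp) := by
  have hG := posDef_gram φ c A t
  have h1 : ∑ s ∈ Finset.Icc 1 t, R s • (φ (c s) (A s)).ofLp =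
      noiseSum φ c A η t - θ.ofLp + gram φ c A t *ᵥ θ.ofLp := by
    rw [gram_mulVec_eq, noiseSum, ← add_assoc, sub_add_cancel, ← Finset.sum_add_distrib]
    refine Finset.sum_congr rfl fun s hs => ?_
    rw [hR s hs, add_smul, add_comm]
  rw [WithLp.ofLp_sub, thetaHat, h1, mulVec_add, inv_mulVec_eq hG rfl, add_sub_cancel_right]

/-- The estimation error is Σ⁻¹(noise sum - θ), where -θ is the bias of the ridge term I. This is
why the radius is m plus a noise part. -/
theorem wnorm_thetaHat_sub_le (t : ℕ) (hR : ∀ s ∈ Finset.Icc 1 t,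
    R s = inner ℝ θ (φ (c s) (A s)) + η s) :
    wnorm (gram φ c A t) (thetaHat φ c A R t - θ) ≤ selfNorm φ c A η t + ‖θ‖ := by
  have hG := posDef_gram φ c A t
  rw [wnorm, thetaHat_sub_eq t hR, mulVec_inv_mulVec hG, dotProduct_comm]
  refine (sqrt_invQuad_sub_le hG _ _).trans ?_
  rw [selfNorm]
  gcongr
  rw [Real.sqrt_le_left (norm_nonneg _), ← dotProduct_self_eq_norm_sq]
  exact invQuad_le_dotProduct_self hG (posSemidef_gram_sub_one φ c A t) _

variable {m : ℝ} {T : ℕ}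

theorem inner_le_of_mem_confSet {t : ℕ} {θ' : EuclideanSpace ℝ (Fin d)}
    (h : θ' ∈ confSet φ m T c A R t) (v : EuclideanSpace ℝ (Fin d)) :
    inner ℝ θ' v ≤ inner ℝ (thetaHat φ c A R (t - 1)) v
      + sqrtBeta m d T (t - 1) * √(invQuad (gram φ c A (t - 1)) v.ofLp) := by
  have h1 := abs_inner_le_wnorm (posDef_gram φ c A (t - 1)) (θ' - thetaHat φ c A R (t - 1)) v
  have h2 := mul_le_mul_of_nonneg_right h (Real.sqrt_nonneg (invQuad (gram φ c A (t - 1)) v.ofLp))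
  have h3 := (le_abs_self _).trans (h1.trans h2)
  rw [inner_sub_left] at h3
  linarith

theorem bddAbove_confSet_inner (t : ℕ) (v : EuclideanSpace ℝ (Fin d)) :
    BddAbove ((fun θ' => (inner ℝ θ' v : ℝ)) '' confSet φ m T c A R t) := by
  refine ⟨inner ℝ (thetaHat φ c A R (t - 1)) v
    + sqrtBeta m d T (t - 1) * √(invQuad (gram φ c A (t - 1)) v.ofLp), ?_⟩
  rintro _ ⟨θ', h, rfl⟩
  exact inner_le_of_mem_confSet h v

theorem thetaHat_mem_confSet (hm : 0 ≤ m) (t : ℕ) :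
    thetaHat φ c A R (t - 1) ∈ confSet φ m T c A R t := by
  have : 0 ≤ sqrtBeta m d T (t - 1) := add_nonneg hm (Real.sqrt_nonneg _)
  simpa [confSet, wnorm] using this

/-- Optimism, up to the amount by which the noise exceeds the confidence radius. -/
theorem inner_sub_le_rHat (hφ : ∀ x j, ‖φ x j‖ ≤ 1) (hθ : ‖θ‖ ≤ m) {t : ℕ}
    (hR : ∀ s ∈ Finset.Icc 1 (t - 1), R s = inner ℝ θ (φ (c s) (A s)) + η s) (j : Fin J)
    (hr : inner ℝ θ (φ (c t) j) ≤ (1 : ℝ)) :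
    inner ℝ θ (φ (c t) j) - max (selfNorm φ c A η (t - 1) - noiseRadius d T (t - 1)) 0
      ≤ rHat φ m T c A R t j := by
  set G := gram φ c A (t - 1) with hG
  set th := thetaHat φ c A R (t - 1) with hth
  set b := sqrtBeta m d T (t - 1) with hb
  have hm : 0 ≤ m := (norm_nonneg _).trans hθ
  have hb0 : 0 ≤ b := add_nonneg hm (Real.sqrt_nonneg _)
  set D := wnorm G (θ - th) with hD
  have hDle : D ≤ selfNorm φ c A η (t - 1) + m := by
    rw [hD, wnorm_sub_comm]
    exact (wnorm_thetaHat_sub_le _ hR).trans (by gcongr)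
  have hmax := le_max_right (selfNorm φ c A η (t - 1) - noiseRadius d T (t - 1)) 0
  refine le_min (by linarith) ?_
  have hex : ∃ θ' ∈ confSet φ m T c A R t, inner ℝ θ (φ (c t) j) - max (D - b) 0
      ≤ (inner ℝ θ' (φ (c t) j) : ℝ) := by
    by_cases hc : D ≤ b
    · exact ⟨θ, hc, by linarith [le_max_right (D - b) 0]⟩
    · push Not at hc
      have hDpos : 0 < D := hb0.trans_lt hc
      have hw : D - b = (1 - b / D) * D := by field_simp
      have h01 : 0 ≤ 1 - b / D := by
        rw [sub_nonneg, div_le_one hDpos]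
        exact hc.le
      -- When θ lies outside the ellipsoid, the segment from the centre to θ is cut at the boundary.
      -- The predicted reward changes by at most (1 - b/D)·D = D - b, since the features have
      -- Σ⁻¹-norm at most 1.
      refine ⟨th + (b / D) • (θ - th), ?_, ?_⟩
      · change wnorm G _ ≤ b
        rw [add_sub_cancel_left, wnorm_smul_of_nonneg _ (by positivity), ← hD,
          div_mul_cancel₀ _ hDpos.ne']
      · have h1 := abs_inner_le_wnorm (posDef_gram φ c A (t - 1)) (θ - th) (φ (c t) j)
        have h2 : √(invQuad (gram φ c A (t - 1)) (φ (c t) j).ofLp) ≤ 1 :=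
          Real.sqrt_le_one.2 (invQuad_gram_le_one c A hφ _ _ _)
        have h3 : inner ℝ (θ - th) (φ (c t) j) ≤ D :=
          (le_abs_self _).trans (h1.trans (mul_le_of_le_one_right (Real.sqrt_nonneg _) h2))
        have h4 := mul_le_mul_of_nonneg_left h3 h01
        have h5 : inner ℝ (th + (b / D) • (θ - th)) (φ (c t) j) =
            inner ℝ θ (φ (c t) j) - (1 - b / D) * inner ℝ (θ - th) (φ (c t) j) := by
          rw [inner_add_left, inner_smul_left, inner_sub_left]
          simp
          ring
        rw [h5, max_eq_left (by linarith)]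
        linarith
  obtain ⟨θ', hmem, hle⟩ := hex
  have h6 := le_csSup (bddAbove_confSet_inner (m := m) (T := T) (φ := φ) (c := c) (A := A)
    (R := R) t (φ (c t) j)) ⟨θ', hmem, rfl⟩
  refine le_trans ?_ (hle.trans h6)
  have h7 : max (D - b) 0 ≤
      max (selfNorm φ c A η (t - 1) - noiseRadius d T (t - 1)) 0 := by
    apply max_le_max_right
    rw [hb, sqrtBeta_eq]
    linarith
  linarith

theorem rHat_le_one (t : ℕ) (j : Fin J) : rHat φ m T c A R t j ≤ 1 := min_le_left _ _

/-- If the noise stays within its radius, both θ and the maximizer are within the radius of the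
centre, hence the factor 2. Otherwise the truncation at 1 and r ≥ 0 are enough, at the price of the
indicator. -/
theorem rHat_le_inner_add (hθ : ‖θ‖ ≤ m) {t : ℕ}
    (hR : ∀ s ∈ Finset.Icc 1 (t - 1), R s = inner ℝ θ (φ (c s) (A s)) + η s)
    (hr : (0 : ℝ) ≤ inner ℝ θ (φ (c t) (A t))) :
    rHat φ m T c A R t (A t) ≤ inner ℝ θ (φ (c t) (A t))
      + 2 * sqrtBeta m d T (t - 1) * √(width φ c A t)
      + if noiseRadius d T (t - 1) < selfNorm φ c A η (t - 1) then 1 else 0 := by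
  have hm : 0 ≤ m := (norm_nonneg _).trans hθ
  have hb0 : 0 ≤ sqrtBeta m d T (t - 1) := add_nonneg hm (Real.sqrt_nonneg _)
  split_ifs with hbad
  · have := rHat_le_one (φ := φ) (m := m) (T := T) (c := c) (A := A) (R := R) t (A t)
    have h2 : 0 ≤ 2 * sqrtBeta m d T (t - 1) * √(width φ c A t) := by positivity
    linarith
  · push Not at hbad
    refine (min_le_right _ _).trans (csSup_le ⟨_, ⟨_, thetaHat_mem_confSet hm t, rfl⟩⟩ ?_)
    rintro _ ⟨θ', h, rfl⟩
    have h1 := inner_le_of_mem_confSet h (φ (c t) (A t))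
    have h2 := abs_inner_le_wnorm (posDef_gram φ c A (t - 1))
      (thetaHat φ c A R (t - 1) - θ) (φ (c t) (A t))
    have h3 : wnorm (gram φ c A (t - 1)) (thetaHat φ c A R (t - 1) - θ)
        ≤ sqrtBeta m d T (t - 1) := by
      refine (wnorm_thetaHat_sub_le _ hR).trans ?_
      rw [sqrtBeta_eq]
      linarith
    have h4 := (le_abs_self _).trans (h2.trans (mul_le_mul_of_nonneg_right h3
      (Real.sqrt_nonneg _)))
    rw [inner_sub_left] at h4
    unfold width
    simp only at *
    linarith

/-- The exponential supermartingale of the method of mixtures. -/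
def mixture (φ : C → Fin J → EuclideanSpace ℝ (Fin d)) (c : ℕ → C) (A : ℕ → Fin J) (η : ℕ → ℝ)
    (t : ℕ) : ℝ :=
  Real.exp (invQuad (gram φ c A t) (noiseSum φ c A η t) / 2) / √(gram φ c A t).det

theorem mixture_pos (φ : C → Fin J → EuclideanSpace ℝ (Fin d)) (c : ℕ → C) (A : ℕ → Fin J)
    (η : ℕ → ℝ) (t : ℕ) : 0 < mixture φ c A η t :=
  div_pos (Real.exp_pos _) (Real.sqrt_pos.2 (det_gram_pos c A t))

/-- The radius is made for this: exp(radius²/2) = T(1 + t/d)^{d/2}, and the second factor dominates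
√det Σ_t. -/
theorem exp_selfNorm_sub_le (hφ : ∀ x j, ‖φ x j‖ ≤ 1) (hd : 0 < d) (hT : 0 < T) (t : ℕ) :
    Real.exp ((selfNorm φ c A η t ^ 2 - noiseRadius d T t ^ 2) / 2) ≤ mixture φ c A η t / T := by
  have hT' : (1 : ℝ) ≤ T := by exact_mod_cast hT
  have hd' : (0 : ℝ) < d := by exact_mod_cast hd
  have hlog : 0 ≤ Real.log (1 + t / d) :=
    Real.log_nonneg (by linarith [show (0 : ℝ) ≤ t / d by positivity])
  rw [selfNorm, Real.sq_sqrt (invQuad_nonneg (posDef_gram φ c A t) _), noiseRadius,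
    Real.sq_sqrt (add_nonneg (mul_nonneg zero_le_two (Real.log_nonneg hT')) (by positivity)),
    sub_div, Real.exp_sub, mixture, div_div]
  refine div_le_div_of_nonneg_left (Real.exp_pos _).le
    (mul_pos (Real.sqrt_pos.2 (det_gram_pos c A t)) (by linarith)) ?_
  have h1 : (2 * Real.log T + d * Real.log (1 + t / d)) / 2 =
      Real.log T + d * Real.log (1 + t / d) / 2 := by ring
  rw [h1, Real.exp_add, Real.exp_log (by linarith), mul_comm]
  gcongr
  rw [Real.sqrt_le_left (Real.exp_pos _).le, ← Real.exp_nat_mul]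
  refine (det_gram_le c A hφ hd t).trans (le_of_eq ?_)
  have h0 : (0 : ℝ) < 1 + t / d := by positivity
  rw [← Real.exp_log (pow_pos h0 d), Real.log_pow]
  congr 1
  push_cast
  ring

/-- Both failures of the confidence set are absorbed by the mixture, whose mean is at most 1. The
regret analysis thus needs no good event. -/
theorem noise_excess_le (hφ : ∀ x j, ‖φ x j‖ ≤ 1) (hd : 0 < d) (hT : 0 < T) (t : ℕ) :
    max (selfNorm φ c A η t - noiseRadius d T t) 0
      + (if noiseRadius d T t < selfNorm φ c A η t then 1 else 0)
      ≤ 2 * (mixture φ c A η t / T) := by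
  have h := exp_selfNorm_sub_le (c := c) (A := A) (η := η) hφ hd hT t
  have hb := noiseRadius_nonneg d T t
  set z := selfNorm φ c A η t
  set b := noiseRadius d T t
  split_ifs with hzb
  · rw [max_eq_left (by linarith)]
    have h1 := Real.add_one_le_exp ((z ^ 2 - b ^ 2) / 2)
    -- With x = z - b ≥ 0: 2exp((z² - b²)/2) ≥ 2 + z² - b² ≥ 2 + x² ≥ x + 1.
    nlinarith [sq_nonneg (z - b - 1), mul_nonneg hb (sub_nonneg.2 hzb.le)]
  · rw [max_eq_right (by linarith)]
    have := Real.exp_pos ((z ^ 2 - b ^ 2) / 2)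
    linarith

theorem selfNorm_le_of_mixture_le (hφ : ∀ x j, ‖φ x j‖ ≤ 1) (hd : 0 < d) (hT : 0 < T) (t : ℕ)
    (h : mixture φ c A η t ≤ T) : selfNorm φ c A η t ≤ noiseRadius d T t := by
  have h1 := exp_selfNorm_sub_le (c := c) (A := A) (η := η) hφ hd hT t
  have h2 : mixture φ c A η t / T ≤ 1 := by
    rw [div_le_one (by exact_mod_cast hT)]
    exact h
  have h3 := Real.exp_le_one_iff.1 (h1.trans h2)
  exact le_of_sq_le_sq (by linarith) (noiseRadius_nonneg _ _ _)

theorem noiseSum_succ (t : ℕ) : noiseSum φ c A η (t + 1) =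
    noiseSum φ c A η t + η (t + 1) • (φ (c (t + 1)) (A (t + 1))).ofLp := by
  rw [noiseSum, noiseSum, Finset.sum_Icc_succ_top (by omega)]

theorem mixture_zero : mixture φ c A η 0 = 1 := by
  simp [mixture, gram_zero, noiseSum, invQuad]

/-- The inner product of the noise sum and the new feature vector that governs the growth of
`mixture`. -/
def drift (φ : C → Fin J → EuclideanSpace ℝ (Fin d)) (c : ℕ → C) (A : ℕ → Fin J) (η : ℕ → ℝ)
    (t : ℕ) : ℝ :=
  noiseSum φ c A η (t - 1) ⬝ᵥ ((gram φ c A (t - 1))⁻¹ *ᵥ (φ (c t) (A t)).ofLp)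

/-- Under the standard Gaussian prior behind the mixture, the mixing vector has posterior
N(Σ_t⁻¹S_t, Σ_t⁻¹), S_t being the noise sum. Its product with the next feature is N(`drift`,
`width`), and the ratio here is the mean of exp(lη - l²/2) under that law of l. -/
theorem mixture_succ (t : ℕ) : mixture φ c A η (t + 1) = mixture φ c A η t *
    (Real.exp ((2 * η (t + 1) * drift φ c A η (t + 1)
        + η (t + 1) ^ 2 * width φ c A (t + 1) - drift φ c A η (t + 1) ^ 2)
      / (2 * (1 + width φ c A (t + 1)))) / √(1 + width φ c A (t + 1))) := by
  rw [mixture, mixture, noiseSum_succ, det_gram_succ, gram_succ,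
    invQuad_add_vecMulVec (posDef_gram φ c A t), Real.sqrt_mul (det_gram_pos c A t).le,
    div_mul_div_comm, ← Real.exp_add]
  congr 2
  rw [add_div, div_div]
  simp only [drift, width, Nat.add_sub_cancel]
  congr 2
  ring

theorem drift_eq_zero_of_width_eq_zero {t : ℕ} (h : width φ c A t = 0) :
    drift φ c A η t = 0 := by
  have := sq_dotProduct_mulVec_le (posDef_gram φ c A (t - 1)).inv.posSemidef
    (noiseSum φ c A η (t - 1)) (φ (c t) (A t)).ofLp
  change drift φ c A η t ^ 2 ≤ _ * width φ c A t at this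
  rw [h, mul_zero] at this
  exact pow_eq_zero_iff two_ne_zero |>.1 (le_antisymm this (sq_nonneg _))

end Optimism

/-! ### Measurability of determinants and inverses -/

section MatrixMeasurability

open Matrix

variable {α : Type*} {mα : MeasurableSpace α} {n : Type*} [Fintype n] [DecidableEq n]

theorem measurable_det {B : α → Matrix n n ℝ} (hB : ∀ i j, Measurable fun x => B x i j) :
    Measurable fun x => (B x).det := by
  simp only [det_apply]
  refine Finset.measurable_sum _ fun σ _ => ?_
  exact (Finset.measurable_prod _ fun i _ => hB _ _).const_smul _

theorem measurable_inv_entry {B : α → Matrix n n ℝ} (hB : ∀ i j, Measurable fun x => B x i j)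
    (i j : n) : Measurable fun x => (B x)⁻¹ i j := by
  simp only [inv_def, Matrix.smul_apply, Ring.inverse_eq_inv', smul_eq_mul, adjugate_apply]
  refine (measurable_det hB).inv.mul (measurable_det fun i' j' => ?_)
  by_cases h : i' = j
  · subst h
    simp
  · simp only [updateRow_ne h]
    exact hB i' j'

theorem measurable_dotProduct_inv_mulVec {B : α → Matrix n n ℝ} {u v : α → n → ℝ}
    (hB : ∀ i j, Measurable fun x => B x i j) (hu : ∀ i, Measurable fun x => u x i)
    (hv : ∀ i, Measurable fun x => v x i) :
    Measurable fun x => u x ⬝ᵥ ((B x)⁻¹ *ᵥ v x) := by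
  simp only [dotProduct, mulVec]
  exact Finset.measurable_sum _ fun i _ => (hu i).mul <|
    Finset.measurable_sum _ fun j _ => (measurable_inv_entry hB i j).mul (hv j)

end MatrixMeasurability

/-! ### The supermartingale step by one-dimensional Gaussian mixing -/

section GaussianMixture

open scoped ENNReal NNReal

variable {Ω : Type*} {G mΩ : MeasurableSpace Ω} {μ : Measure Ω}

/-- The conditional bound is an inequality between two measures on G. Integrating H against them
needs only measurability, so H may be unbounded and non-integrable. -/
theorem lintegral_mul_exp_le [IsFiniteMeasure μ] (hG : G ≤ mΩ) {Y : Ω → ℝ} {l : ℝ}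
    (hint : Integrable (fun ω => Real.exp (l * Y ω)) μ)
    (hle : ∀ᵐ ω ∂μ, (μ[fun ω => Real.exp (l * Y ω)|G]) ω ≤ Real.exp (l ^ 2 / 2))
    {H : Ω → ℝ≥0∞} (hH : Measurable[G] H) :
    ∫⁻ ω, H ω * ENNReal.ofReal (Real.exp (l * Y ω)) ∂μ
      ≤ ∫⁻ ω, H ω * ENNReal.ofReal (Real.exp (l ^ 2 / 2)) ∂μ := by
  have hY : AEMeasurable (fun ω => ENNReal.ofReal (Real.exp (l * Y ω))) μ :=
    hint.aemeasurable.ennreal_ofReal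
  have hcmp : (μ.withDensity fun ω => ENNReal.ofReal (Real.exp (l * Y ω))).trim hG
      ≤ (ENNReal.ofReal (Real.exp (l ^ 2 / 2)) • μ).trim hG := by
    refine Measure.le_iff.2 fun s hs => ?_
    rw [trim_measurableSet_eq hG hs, trim_measurableSet_eq hG hs, withDensity_apply _ (hG s hs),
      ← ofReal_integral_eq_lintegral_ofReal hint.integrableOn
        (Filter.Eventually.of_forall fun ω => (Real.exp_pos _).le),
      ← setIntegral_condExp hG hint hs]
    have h1 : ∫ ω in s, (μ[fun ω => Real.exp (l * Y ω)|G]) ω ∂μ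
        ≤ ∫ _ in s, Real.exp (l ^ 2 / 2) ∂μ :=
      integral_mono_ae integrable_condExp.integrableOn (integrable_const _)
        (ae_restrict_of_ae hle)
    refine (ENNReal.ofReal_le_ofReal h1).trans (le_of_eq ?_)
    rw [setIntegral_const, smul_eq_mul, mul_comm, ENNReal.ofReal_mul (Real.exp_pos _).le,
      Measure.real, ENNReal.ofReal_toReal (measure_ne_top _ _), Measure.smul_apply, smul_eq_mul]
  have hH' : Measurable H := hH.mono hG le_rfl
  calc ∫⁻ ω, H ω * ENNReal.ofReal (Real.exp (l * Y ω)) ∂μ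
      = ∫⁻ ω, H ω ∂(μ.withDensity fun ω => ENNReal.ofReal (Real.exp (l * Y ω))) := by
        rw [lintegral_withDensity_eq_lintegral_mul₀ hY hH'.aemeasurable]
        simp [mul_comm]
    _ = ∫⁻ ω, H ω ∂(μ.withDensity fun ω => ENNReal.ofReal (Real.exp (l * Y ω))).trim hG :=
        (lintegral_trim hG hH).symm
    _ ≤ ∫⁻ ω, H ω ∂(ENNReal.ofReal (Real.exp (l ^ 2 / 2)) • μ).trim hG :=
        lintegral_mono' hcmp le_rfl
    _ = ∫⁻ ω, H ω ∂(ENNReal.ofReal (Real.exp (l ^ 2 / 2)) • μ) := lintegral_trim hG hH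
    _ = _ := by
        rw [lintegral_smul_measure, smul_eq_mul, mul_comm,
          lintegral_mul_const _ hH']

/-- Completing the square in l, i.e. a Gaussian posterior update; the factor free of l is the
one-step ratio of the mixture. -/
theorem exp_mul_gaussianPDFReal {a : ℝ} (ha : 0 < a) (u y l : ℝ) :
    Real.exp (l * y) * Real.exp (-(l ^ 2 / 2)) * gaussianPDFReal u a.toNNReal l =
      (Real.exp ((2 * y * u + y ^ 2 * a - u ^ 2) / (2 * (1 + a))) / √(1 + a))
        * gaussianPDFReal ((u + a * y) / (1 + a)) (a / (1 + a)).toNNReal l := by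
  have h1 : (0 : ℝ) < 1 + a := by linarith
  rw [gaussianPDFReal, gaussianPDFReal, Real.coe_toNNReal _ ha.le,
    Real.coe_toNNReal _ (by positivity)]
  have h2 : √(2 * Real.pi * a) = √(1 + a) * √(2 * Real.pi * (a / (1 + a))) := by
    rw [← Real.sqrt_mul h1.le]
    congr 1
    field_simp
  rw [h2, mul_inv]
  have h3 : Real.exp (l * y) * Real.exp (-(l ^ 2 / 2)) * Real.exp (-(l - u) ^ 2 / (2 * a)) =
      Real.exp ((2 * y * u + y ^ 2 * a - u ^ 2) / (2 * (1 + a)))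
        * Real.exp (-(l - (u + a * y) / (1 + a)) ^ 2 / (2 * (a / (1 + a)))) := by
    rw [← Real.exp_add, ← Real.exp_add, ← Real.exp_add]
    congr 1
    field_simp
    ring
  calc _ = (Real.exp (l * y) * Real.exp (-(l ^ 2 / 2)) * Real.exp (-(l - u) ^ 2 / (2 * a)))
        * ((√(1 + a))⁻¹ * (√(2 * Real.pi * (a / (1 + a))))⁻¹) := by ring
    _ = _ := by rw [h3]; ring

theorem lintegral_exp_mul_gaussianPDF {a : ℝ} (ha : 0 < a) (u y : ℝ) :
    ∫⁻ l, ENNReal.ofReal (Real.exp (l * y)) * (ENNReal.ofReal (Real.exp (-(l ^ 2 / 2)))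
        * gaussianPDF u a.toNNReal l) =
      ENNReal.ofReal (Real.exp ((2 * y * u + y ^ 2 * a - u ^ 2) / (2 * (1 + a))) / √(1 + a)) := by
  have h1 : (0 : ℝ) < 1 + a := by linarith
  have hne : (a / (1 + a)).toNNReal ≠ 0 := by
    simpa using div_pos ha h1
  have h : ∀ l, ENNReal.ofReal (Real.exp (l * y)) * (ENNReal.ofReal (Real.exp (-(l ^ 2 / 2)))
        * gaussianPDF u a.toNNReal l) =
      ENNReal.ofReal (Real.exp ((2 * y * u + y ^ 2 * a - u ^ 2) / (2 * (1 + a))) / √(1 + a))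
        * gaussianPDF ((u + a * y) / (1 + a)) (a / (1 + a)).toNNReal l := by
    intro l
    rw [gaussianPDF, gaussianPDF, ← ENNReal.ofReal_mul (by positivity),
      ← ENNReal.ofReal_mul (by positivity), ← ENNReal.ofReal_mul (by positivity), ← mul_assoc,
      exp_mul_gaussianPDFReal ha]
  simp only [h]
  rw [lintegral_const_mul _ (measurable_gaussianPDF _ _), lintegral_gaussianPDF_eq_one _ hne,
    mul_one]

/-- The ratio is written as a Gaussian integral over l. By Tonelli the expectation is taken first
for fixed l, where exp(lY - l²/2) has conditional mean at most 1; the density then integrates to 1.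
-/
theorem lintegral_mul_mixtureRatio_le_of_pos [IsFiniteMeasure μ] (hG : G ≤ mΩ) {Y : Ω → ℝ}
    (hY : Measurable Y)
    (hsub : ∀ l : ℝ, Integrable (fun ω => Real.exp (l * Y ω)) μ ∧
      ∀ᵐ ω ∂μ, (μ[fun ω => Real.exp (l * Y ω)|G]) ω ≤ Real.exp (l ^ 2 / 2))
    {H : Ω → ℝ≥0∞} (hH : Measurable[G] H) {u a : Ω → ℝ} (hu : Measurable[G] u)
    (ha : Measurable[G] a) (h0 : ∀ ω, 0 < a ω ∨ H ω = 0) :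
    ∫⁻ ω, H ω * ENNReal.ofReal (Real.exp ((2 * Y ω * u ω + Y ω ^ 2 * a ω - u ω ^ 2)
        / (2 * (1 + a ω))) / √(1 + a ω)) ∂μ ≤ ∫⁻ ω, H ω ∂μ := by
  have hH' : Measurable H := hH.mono hG le_rfl
  have hu' : Measurable u := hu.mono hG le_rfl
  have ha' : Measurable a := ha.mono hG le_rfl
  have hpdf : Measurable fun p : Ω × ℝ => gaussianPDF (u p.1) (a p.1).toNNReal p.2 := by
    unfold gaussianPDF gaussianPDFReal
    fun_prop
  have hpdf1 : ∀ l : ℝ, Measurable[G] fun ω => gaussianPDF (u ω) (a ω).toNNReal l := by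
    intro l
    unfold gaussianPDF gaussianPDFReal
    fun_prop
  have hpdf2 : ∀ ω, Measurable fun l : ℝ => gaussianPDF (u ω) (a ω).toNNReal l :=
    fun ω => measurable_gaussianPDF _ _
  calc ∫⁻ ω, H ω * ENNReal.ofReal (Real.exp ((2 * Y ω * u ω + Y ω ^ 2 * a ω - u ω ^ 2)
        / (2 * (1 + a ω))) / √(1 + a ω)) ∂μ
      = ∫⁻ ω, (∫⁻ l : ℝ, H ω * (ENNReal.ofReal (Real.exp (l * Y ω))
          * (ENNReal.ofReal (Real.exp (-(l ^ 2 / 2)))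
            * gaussianPDF (u ω) (a ω).toNNReal l))) ∂μ := by
        refine lintegral_congr fun ω => ?_
        rcases h0 ω with h | h
        · rw [lintegral_const_mul _ (by fun_prop), lintegral_exp_mul_gaussianPDF h]
        · simp [h]
    _ = ∫⁻ l, ∫⁻ ω, H ω * (ENNReal.ofReal (Real.exp (l * Y ω))
          * (ENNReal.ofReal (Real.exp (-(l ^ 2 / 2))) * gaussianPDF (u ω) (a ω).toNNReal l)) ∂μ := by
        refine lintegral_lintegral_swap (Measurable.aemeasurable ?_)
        exact (hH'.comp measurable_fst).mul (by fun_prop)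
    _ ≤ ∫⁻ l, ∫⁻ ω, H ω * gaussianPDF (u ω) (a ω).toNNReal l ∂μ := by
        refine lintegral_mono fun l => ?_
        have hm : Measurable[G] fun ω => H ω * (ENNReal.ofReal (Real.exp (-(l ^ 2 / 2)))
            * gaussianPDF (u ω) (a ω).toNNReal l) :=
          hH.mul ((hpdf1 l).const_mul _)
        have h := lintegral_mul_exp_le hG (hsub l).1 (hsub l).2 hm
        refine le_trans (le_of_eq ?_) (h.trans (le_of_eq ?_))
        · refine lintegral_congr fun ω => ?_
          ring
        · refine lintegral_congr fun ω => ?_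
          rw [mul_assoc, mul_right_comm, ← ENNReal.ofReal_mul (Real.exp_pos _).le, ← Real.exp_add]
          simp
    _ = ∫⁻ ω, (∫⁻ l : ℝ, H ω * gaussianPDF (u ω) (a ω).toNNReal l) ∂μ := by
        refine (lintegral_lintegral_swap (Measurable.aemeasurable ?_)).symm
        exact (hH'.comp measurable_fst).mul hpdf
    _ = ∫⁻ ω, H ω ∂μ := by
        refine lintegral_congr fun ω => ?_
        rcases h0 ω with h | h
        · rw [lintegral_const_mul _ (hpdf2 ω), lintegral_gaussianPDF_eq_one _ (by simpa using h),
            mul_one]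
        · simp [h]

/-- Where a = 0 the Gaussian has no density, but there u = 0 as well and the ratio is 1. That part
is split off. -/
theorem lintegral_mul_mixtureRatio_le [IsFiniteMeasure μ] (hG : G ≤ mΩ) {Y : Ω → ℝ}
    (hY : Measurable Y)
    (hsub : ∀ l : ℝ, Integrable (fun ω => Real.exp (l * Y ω)) μ ∧
      ∀ᵐ ω ∂μ, (μ[fun ω => Real.exp (l * Y ω)|G]) ω ≤ Real.exp (l ^ 2 / 2))
    {H : Ω → ℝ≥0∞} (hH : Measurable[G] H) {u a : Ω → ℝ} (hu : Measurable[G] u)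
    (ha : Measurable[G] a) (h0 : ∀ ω, 0 ≤ a ω) (hua : ∀ ω, a ω = 0 → u ω = 0) :
    ∫⁻ ω, H ω * ENNReal.ofReal (Real.exp ((2 * Y ω * u ω + Y ω ^ 2 * a ω - u ω ^ 2)
        / (2 * (1 + a ω))) / √(1 + a ω)) ∂μ ≤ ∫⁻ ω, H ω ∂μ := by
  have hs : MeasurableSet[G] {ω | 0 < a ω} := measurableSet_lt measurable_const ha
  have hH1 : Measurable[G] ({ω | 0 < a ω}.indicator H) := hH.indicator hs
  rw [← lintegral_add_compl _ (hG _ hs), ← lintegral_add_compl H (hG _ hs)]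
  refine add_le_add ?_ (le_of_eq ?_)
  · rw [← lintegral_indicator (hG _ hs), ← lintegral_indicator (hG _ hs)]
    refine le_trans (le_of_eq ?_) (lintegral_mul_mixtureRatio_le_of_pos hG hY hsub hH1 hu ha ?_)
    · refine lintegral_congr fun ω => ?_
      by_cases h : 0 < a ω <;> simp [Set.indicator, h]
    · intro ω
      by_cases h : 0 < a ω <;> simp [Set.indicator, h]
  · refine setLIntegral_congr_fun (hG _ hs).compl fun ω hω => ?_
    have h : a ω = 0 := le_antisymm (not_lt.1 hω) (h0 ω)
    simp [h, hua ω h]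

end GaussianMixture

/-! ### Adaptedness, the mixture supermartingale and Ville's inequality -/

section HistoryMeasurability

open Matrix
open scoped ENNReal

variable {Ω C : Type*} {mΩ : MeasurableSpace Ω} {μ : Measure Ω} [Countable C] [MeasurableSpace C]
  [MeasurableSingletonClass C] {d J K T : ℕ} {M : Model C d J K} {I : Interaction Ω C J K}

theorem Interaction.GeneratedBy.measurable_obs (hgen : I.GeneratedBy M T μ) {t : ℕ}
    (ht : t ∈ Finset.Icc 1 T) : Measurable (I.obs M t) := by
  have h : Measurable fun p : C × Fin J => M.r p.1 p.2 := measurable_of_countable _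
  exact (h.comp ((hgen.measurable_c t ht).prodMk (hgen.measurable_A t ht))).add
    (hgen.measurable_η t ht)

omit [MeasurableSingletonClass C] [Countable C] in
theorem Interaction.GeneratedBy.measurable_cost (hgen : I.GeneratedBy M T μ) {t : ℕ}
    (ht : t ∈ Finset.Icc 1 T) (k : Fin K) : Measurable fun ω => I.W t ω k (I.A t ω) := by
  have h : Measurable fun p : Fin J × (Fin K → Fin J → ℝ) => p.2 k p.1 :=
    measurable_from_prod_countable_right fun j =>
      (measurable_pi_apply j).comp (measurable_pi_apply k)
  exact h.comp ((hgen.measurable_A t ht).prodMk (hgen.measurable_W t ht))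

theorem Interaction.GeneratedBy.history_le (hgen : I.GeneratedBy M T μ) {t : ℕ} (ht : t ≤ T) :
    I.history M t ≤ mΩ := by
  refine iSup₂_le fun s hs => ?_
  have hs' : s ∈ Finset.Icc 1 T := by
    simp only [Finset.mem_Icc] at hs ⊢
    omega
  refine Measurable.comap_le ?_
  exact (hgen.measurable_c s hs').prodMk ((hgen.measurable_A s hs').prodMk
    ((hgen.measurable_obs hs').prodMk
      (measurable_pi_lambda _ fun k => hgen.measurable_cost hs' k)))

theorem Interaction.GeneratedBy.preReward_le (hgen : I.GeneratedBy M T μ) {t : ℕ}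
    (ht : t ∈ Finset.Icc 1 T) : I.preReward M t ≤ mΩ := by
  have h := Finset.mem_Icc.1 ht
  exact sup_le (hgen.history_le (by omega))
    (Measurable.comap_le ((hgen.measurable_c t ht).prodMk (hgen.measurable_A t ht)))

omit [MeasurableSingletonClass C] [Countable C] in
theorem Interaction.history_mono (I : Interaction Ω C J K) (M : Model C d J K) :
    Monotone (I.history M) := by
  intro s t hst
  exact biSup_mono fun u hu => Finset.Icc_subset_Icc_right hst hu

omit [MeasurableSingletonClass C] [Countable C] in
theorem Interaction.measurable_record (I : Interaction Ω C J K) (M : Model C d J K) {s t : ℕ}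
    (hs : s ∈ Finset.Icc 1 t) : Measurable[I.history M t]
      (fun ω => (I.c s ω, I.A s ω, I.obs M s ω, fun k : Fin K => I.W s ω k (I.A s ω))) :=
  measurable_iff_comap_le.2 (le_iSup₂_of_le s hs le_rfl)

omit [MeasurableSingletonClass C] [Countable C] in
theorem Interaction.measurable_c_history (I : Interaction Ω C J K) (M : Model C d J K) {s t : ℕ}
    (hs : s ∈ Finset.Icc 1 t) : Measurable[I.history M t] (I.c s) :=
  measurable_fst.comp (I.measurable_record M hs)

omit [MeasurableSingletonClass C] [Countable C] in
theorem Interaction.measurable_A_history (I : Interaction Ω C J K) (M : Model C d J K) {s t : ℕ}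
    (hs : s ∈ Finset.Icc 1 t) : Measurable[I.history M t] (I.A s) :=
  (measurable_fst.comp measurable_snd).comp (I.measurable_record M hs)

omit [MeasurableSingletonClass C] [Countable C] in
theorem Interaction.measurable_obs_history (I : Interaction Ω C J K) (M : Model C d J K) {s t : ℕ}
    (hs : s ∈ Finset.Icc 1 t) : Measurable[I.history M t] (I.obs M s) :=
  ((measurable_fst.comp measurable_snd).comp measurable_snd).comp (I.measurable_record M hs)

omit [MeasurableSingletonClass C] [Countable C] in
theorem Interaction.measurable_cost_history (I : Interaction Ω C J K) (M : Model C d J K)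
    {s t : ℕ} (hs : s ∈ Finset.Icc 1 t) (k : Fin K) :
    Measurable[I.history M t] (fun ω => I.W s ω k (I.A s ω)) :=
  (measurable_pi_apply k).comp
    (((measurable_snd.comp measurable_snd).comp measurable_snd).comp (I.measurable_record M hs))

theorem Interaction.measurable_comp_history {β : Type*} [MeasurableSpace β]
    (I : Interaction Ω C J K) (M : Model C d J K) {s t : ℕ}
    (hs : s ∈ Finset.Icc 1 t) (f : C → Fin J → β) :
    Measurable[I.history M t] (fun ω => f (I.c s ω) (I.A s ω)) := by
  have h : Measurable fun p : C × Fin J => f p.1 p.2 := measurable_of_countable _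
  exact h.comp ((I.measurable_c_history M hs).prodMk (I.measurable_A_history M hs))

theorem Interaction.measurable_η_history (I : Interaction Ω C J K) (M : Model C d J K) {s t : ℕ}
    (hs : s ∈ Finset.Icc 1 t) : Measurable[I.history M t] (I.η s) := by
  have h : I.η s = fun ω => I.obs M s ω - M.r (I.c s ω) (I.A s ω) := by
    funext ω
    simp [Interaction.obs, Interaction.R]
  rw [h]
  exact (I.measurable_obs_history M hs).sub (I.measurable_comp_history M hs M.r)

theorem Interaction.measurable_noiseSum (I : Interaction Ω C J K) (M : Model C d J K) (t : ℕ)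
    (i : Fin d) : Measurable[I.history M t] fun ω =>
      noiseSum M.φ (fun s => I.c s ω) (fun s => I.A s ω) (fun s => I.η s ω) t i := by
  simp only [noiseSum, Finset.sum_apply, Pi.smul_apply, smul_eq_mul]
  exact Finset.measurable_sum _ fun s hs => (I.measurable_η_history M hs).mul
    (I.measurable_comp_history M hs fun x j => (M.φ x j).ofLp i)

theorem Interaction.measurable_gram (I : Interaction Ω C J K) (M : Model C d J K) (t : ℕ)
    (i j : Fin d) : Measurable[I.history M t] fun ω =>
      gram M.φ (fun s => I.c s ω) (fun s => I.A s ω) t i j := by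
  simp only [gram, Matrix.add_apply, Matrix.sum_apply, vecMulVec_apply]
  refine measurable_const.add ?_
  exact Finset.measurable_sum _ fun s hs => I.measurable_comp_history M hs
    fun x a => (M.φ x a).ofLp i * (M.φ x a).ofLp j

/-- `mixture` along the sample paths of the interaction. -/
def Interaction.mix (I : Interaction Ω C J K) (M : Model C d J K) (t : ℕ) (ω : Ω) : ℝ :=
  mixture M.φ (fun s => I.c s ω) (fun s => I.A s ω) (fun s => I.η s ω) t

omit [Countable C] [MeasurableSpace C] [MeasurableSingletonClass C] mΩ in
theorem Interaction.mix_pos (I : Interaction Ω C J K) (M : Model C d J K) (t : ℕ) (ω : Ω) :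
    0 < I.mix M t ω := mixture_pos _ _ _ _ _

theorem Interaction.measurable_mix (I : Interaction Ω C J K) (M : Model C d J K) (t : ℕ) :
    Measurable[I.history M t] (I.mix M t) := by
  unfold Interaction.mix mixture invQuad
  refine Measurable.div ?_ ?_
  · exact ((measurable_dotProduct_inv_mulVec (I.measurable_gram M t) (I.measurable_noiseSum M t)
      (I.measurable_noiseSum M t)).div_const 2).exp
  · exact (measurable_det (I.measurable_gram M t)).sqrt

theorem Interaction.measurable_preReward_comp {β : Type*} [MeasurableSpace β]
    (I : Interaction Ω C J K) (M : Model C d J K) (t : ℕ) (f : C → Fin J → β) :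
    Measurable[I.preReward M t] (fun ω => f (I.c t ω) (I.A t ω)) := by
  have h : Measurable fun p : C × Fin J => f p.1 p.2 := measurable_of_countable _
  exact h.comp (measurable_iff_comap_le.2 le_sup_right)

theorem Interaction.measurable_width (I : Interaction Ω C J K) (M : Model C d J K) (t : ℕ) :
    Measurable[I.preReward M t] fun ω => width M.φ (fun s => I.c s ω) (fun s => I.A s ω) t :=
  measurable_dotProduct_inv_mulVec
    (fun i j => (I.measurable_gram M (t - 1) i j).mono le_sup_left le_rfl)
    (fun i => I.measurable_preReward_comp M t fun x a => (M.φ x a).ofLp i)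
    (fun i => I.measurable_preReward_comp M t fun x a => (M.φ x a).ofLp i)

theorem Interaction.measurable_drift (I : Interaction Ω C J K) (M : Model C d J K) (t : ℕ) :
    Measurable[I.preReward M t] fun ω =>
      drift M.φ (fun s => I.c s ω) (fun s => I.A s ω) (fun s => I.η s ω) t :=
  measurable_dotProduct_inv_mulVec
    (fun i j => (I.measurable_gram M (t - 1) i j).mono le_sup_left le_rfl)
    (fun i => (I.measurable_noiseSum M (t - 1) i).mono le_sup_left le_rfl)
    (fun i => I.measurable_preReward_comp M t fun x a => (M.φ x a).ofLp i)

/-- The supermartingale property tested against past weights H: H = 1 yields mean at most 1, the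
indicator of a past event yields Ville's inequality. -/
theorem lintegral_mul_mix_succ_le [IsFiniteMeasure μ] (hgen : I.GeneratedBy M T μ) {t : ℕ}
    (ht : t + 1 ∈ Finset.Icc 1 T)
    (hnoise : CondSubGaussian (I.preReward M (t + 1)) (I.η (t + 1)) μ)
    {H : Ω → ℝ≥0∞} (hH : Measurable[I.history M t] H) :
    ∫⁻ ω, H ω * ENNReal.ofReal (I.mix M (t + 1) ω) ∂μ
      ≤ ∫⁻ ω, H ω * ENNReal.ofReal (I.mix M t ω) ∂μ := by
  have hH' : Measurable[I.preReward M (t + 1)] fun ω => H ω * ENNReal.ofReal (I.mix M t ω) :=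
    (hH.mul (I.measurable_mix M t).ennreal_ofReal).mono le_sup_left le_rfl
  have h := lintegral_mul_mixtureRatio_le (hgen.preReward_le ht) (hgen.measurable_η _ ht)
    hnoise.2.2 hH' (I.measurable_drift M (t + 1)) (I.measurable_width M (t + 1))
    (fun ω => width_nonneg _ _ _) (fun ω h => drift_eq_zero_of_width_eq_zero h)
  refine le_trans (le_of_eq (lintegral_congr fun ω => ?_)) h
  rw [mul_assoc, ← ENNReal.ofReal_mul (I.mix_pos M t ω).le]
  congr 2
  exact mixture_succ t

theorem lintegral_mix_le_one [IsProbabilityMeasure μ] (hgen : I.GeneratedBy M T μ)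
    (hnoise : ∀ t ∈ Finset.Icc 1 T, CondSubGaussian (I.preReward M t) (I.η t) μ) {t : ℕ}
    (ht : t ≤ T) : ∫⁻ ω, ENNReal.ofReal (I.mix M t ω) ∂μ ≤ 1 := by
  induction t with
  | zero => simp [Interaction.mix, mixture_zero]
  | succ t ih =>
    have hmem : t + 1 ∈ Finset.Icc 1 T := Finset.mem_Icc.2 ⟨by omega, ht⟩
    have h := lintegral_mul_mix_succ_le hgen hmem (hnoise _ hmem) (H := fun _ => 1)
      measurable_const
    simp only [one_mul] at h
    exact h.trans (ih (by omega))

theorem integrable_mix [IsProbabilityMeasure μ] (hgen : I.GeneratedBy M T μ)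
    (hnoise : ∀ t ∈ Finset.Icc 1 T, CondSubGaussian (I.preReward M t) (I.η t) μ) {t : ℕ}
    (ht : t ≤ T) : Integrable (I.mix M t) μ := by
  refine ⟨((I.measurable_mix M t).mono (hgen.history_le ht) le_rfl).aestronglyMeasurable, ?_⟩
  rw [hasFiniteIntegral_iff_ofReal (Filter.Eventually.of_forall fun ω => (I.mix_pos M t ω).le)]
  exact (lintegral_mix_le_one hgen hnoise ht).trans_lt ENNReal.one_lt_top

theorem integral_mix_le_one [IsProbabilityMeasure μ] (hgen : I.GeneratedBy M T μ)
    (hnoise : ∀ t ∈ Finset.Icc 1 T, CondSubGaussian (I.preReward M t) (I.η t) μ) {t : ℕ}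
    (ht : t ≤ T) : ∫ ω, I.mix M t ω ∂μ ≤ 1 := by
  rw [integral_eq_lintegral_of_nonneg_ae
    (Filter.Eventually.of_forall fun ω => (I.mix_pos M t ω).le)
    (integrable_mix hgen hnoise ht).aestronglyMeasurable]
  exact ENNReal.toReal_le_of_le_ofReal zero_le_one
    (by simpa using lintegral_mix_le_one hgen hnoise ht)

/-- The event that `mix` has stayed below `b` up to time `t`. -/
def Interaction.tame (I : Interaction Ω C J K) (M : Model C d J K) (b : ℝ) (t : ℕ) : Set Ω :=
  {ω | ∀ s ≤ t, I.mix M s ω ≤ b}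

theorem Interaction.measurableSet_tame (I : Interaction Ω C J K) (M : Model C d J K) (b : ℝ)
    (t : ℕ) : MeasurableSet[I.history M t] (I.tame M b t) := by
  have : I.tame M b t = ⋂ s ∈ Finset.range (t + 1), {ω | I.mix M s ω ≤ b} := by
    ext ω
    simp [Interaction.tame]
  rw [this]
  refine Finset.measurableSet_biInter _ fun s hs => ?_
  have hst : s ≤ t := by simpa [Nat.lt_succ_iff] using hs
  exact measurableSet_le ((I.measurable_mix M s).mono (I.history_mono M hst) le_rfl)
    measurable_const

omit [Countable C] [MeasurableSpace C] [MeasurableSingletonClass C] mΩ in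
theorem Interaction.tame_succ_subset (I : Interaction Ω C J K) (M : Model C d J K) (b : ℝ)
    (t : ℕ) : I.tame M b (t + 1) ⊆ I.tame M b t := fun _ h s hs => h s (by omega)

/-- Ville's inequality for `mix`. -/
theorem measure_compl_tame_le [IsProbabilityMeasure μ] (hgen : I.GeneratedBy M T μ)
    (hnoise : ∀ t ∈ Finset.Icc 1 T, CondSubGaussian (I.preReward M t) (I.η t) μ) {b : ℝ}
    (hb : 1 ≤ b) {t : ℕ} (ht : t ≤ T) :
    ENNReal.ofReal b * μ (I.tame M b t)ᶜ ≤ 1 := by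
  -- The induction carries the stopped process: its mass where `mix` has stayed below b, plus b
  -- times the probability of having exceeded b.
  suffices h : ∫⁻ ω in I.tame M b t, ENNReal.ofReal (I.mix M t ω) ∂μ
      + ENNReal.ofReal b * μ (I.tame M b t)ᶜ ≤ 1 from le_add_self.trans h
  induction t with
  | zero =>
    have : I.tame M b 0 = Set.univ := by
      ext ω
      simp [Interaction.tame, Interaction.mix, mixture_zero, hb]
    simp [this, Interaction.mix, mixture_zero]
  | succ t ih =>
    have hmem : t + 1 ∈ Finset.Icc 1 T := Finset.mem_Icc.2 ⟨by omega, ht⟩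
    refine le_trans ?_ (ih (by omega))
    have hs := I.measurableSet_tame M b t
    have hs1 := hgen.history_le (by omega) _ hs
    have hs2 := hgen.history_le ht _ (I.measurableSet_tame M b (t + 1))
    have hsub := I.tame_succ_subset M b t
    have hone : Measurable[I.history M t] fun _ : Ω => (1 : ℝ≥0∞) := measurable_const
    have h1 := lintegral_mul_mix_succ_le hgen hmem (hnoise _ hmem) (hone.indicator hs)
    have h2 : ∀ s, ∫⁻ ω, (I.tame M b t).indicator (fun _ => 1) ω * ENNReal.ofReal (I.mix M s ω) ∂μ =
        ∫⁻ ω in I.tame M b t, ENNReal.ofReal (I.mix M s ω) ∂μ := by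
      intro s
      rw [← lintegral_indicator hs1]
      refine lintegral_congr fun ω => ?_
      by_cases h : ω ∈ I.tame M b t <;> simp [h]
    rw [h2, h2] at h1
    have h3 : ∫⁻ ω in I.tame M b t, ENNReal.ofReal (I.mix M (t + 1) ω) ∂μ =
        ∫⁻ ω in I.tame M b (t + 1), ENNReal.ofReal (I.mix M (t + 1) ω) ∂μ
        + ∫⁻ ω in I.tame M b t \ I.tame M b (t + 1), ENNReal.ofReal (I.mix M (t + 1) ω) ∂μ := by
      have := lintegral_inter_add_sdiff (μ := μ)
        (fun ω => ENNReal.ofReal (I.mix M (t + 1) ω)) (I.tame M b t) hs2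
      rw [Set.inter_eq_right.2 hsub] at this
      exact this.symm
    have h4 : ENNReal.ofReal b * μ (I.tame M b t \ I.tame M b (t + 1)) ≤
        ∫⁻ ω in I.tame M b t \ I.tame M b (t + 1), ENNReal.ofReal (I.mix M (t + 1) ω) ∂μ := by
      rw [← setLIntegral_const]
      refine setLIntegral_mono' (hs1.diff hs2) fun ω hω => ENNReal.ofReal_le_ofReal ?_
      by_contra hlt
      push Not at hlt
      refine hω.2 fun s hs => ?_
      rcases Nat.lt_or_ge t s with h | h
      · have : s = t + 1 := by omega
        rw [this]
        exact hlt.le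
      · exact hω.1 s h
    have h5 : μ (I.tame M b (t + 1))ᶜ =
        μ (I.tame M b t)ᶜ + μ (I.tame M b t \ I.tame M b (t + 1)) := by
      rw [← measure_union]
      · congr 1
        ext ω
        have := @hsub ω
        simp only [Set.mem_compl_iff, Set.mem_union, Set.mem_sdiff]
        tauto
      · exact Set.disjoint_left.2 fun ω h h' => h h'.1
      · exact hs1.diff hs2
    rw [h5, mul_add]
    calc _ = (∫⁻ ω in I.tame M b (t + 1), ENNReal.ofReal (I.mix M (t + 1) ω) ∂μ
          + ENNReal.ofReal b * μ (I.tame M b t \ I.tame M b (t + 1)))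
          + ENNReal.ofReal b * μ (I.tame M b t)ᶜ := by ring
      _ ≤ _ := by
        gcongr
        refine le_trans ?_ h1
        rw [h3]
        gcongr

end HistoryMeasurability

/-! ### Fresh contexts and costs: disintegration and independence -/

section Law

open scoped ENNReal

variable {Ω C : Type*} {mΩ : MeasurableSpace Ω} {μ : Measure Ω} [Countable C] [MeasurableSpace C]
  [MeasurableSingletonClass C] {d J K T : ℕ} {M : Model C d J K} {I : Interaction Ω C J K}

omit [MeasurableSingletonClass C] in
theorem ae_abs_cost_le_one (hgen : I.GeneratedBy M T μ) (hcost : CostAssumption M) {t : ℕ}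
    (ht : t ∈ Finset.Icc 1 T) : ∀ᵐ ω ∂μ, ∀ k j, |I.W t ω k j| ≤ 1 := by
  set S : Set (Fin K → Fin J → ℝ) := {N | ∀ k j, |N k j| ≤ 1} with hSdef
  have hS : MeasurableSet S := by
    have : S = ⋂ k, ⋂ j, {N | |N k j| ≤ 1} := by ext; simp [hSdef]
    rw [this]
    refine MeasurableSet.iInter fun k => MeasurableSet.iInter fun j => ?_
    exact measurableSet_le (by fun_prop) measurable_const
  have hx : ∀ x, μ (I.W t ⁻¹' Sᶜ ∩ I.c t ⁻¹' {x}) = 0 := by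
    intro x
    have h1 := congrArg (fun ρ : Measure _ => ρ Sᶜ) (hgen.law t ht x)
    simp only [Measure.smul_apply] at h1
    rw [Measure.map_apply (hgen.measurable_W t ht) hS.compl,
      Measure.restrict_apply (hgen.measurable_W t ht hS.compl)] at h1
    rw [h1]
    have h2 : (M.ν x : Measure (Fin K → Fin J → ℝ)) Sᶜ = 0 := hcost x
    simp [h2]
  have h : I.W t ⁻¹' Sᶜ ⊆ ⋃ x, (I.W t ⁻¹' Sᶜ ∩ I.c t ⁻¹' {x}) := fun ω hω =>
    Set.mem_iUnion.2 ⟨I.c t ω, hω, rfl⟩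
  exact measure_mono_null h (measure_iUnion_null hx)

/-- The countably many level sets of c(t) partition Ω, and on each of them the law of the costs is
prescribed. -/
theorem integral_context_cost (hgen : I.GeneratedBy M T μ) {t : ℕ} (ht : t ∈ Finset.Icc 1 T)
    {g : C → (Fin K → Fin J → ℝ) → ℝ} (hg : ∀ x, Measurable (g x))
    (hint : Integrable (fun ω => g (I.c t ω) (I.W t ω)) μ) :
    ∫ ω, g (I.c t ω) (I.W t ω) ∂μ =
      ∑' x, (M.p x).toReal * ∫ N, g x N ∂(M.ν x : Measure (Fin K → Fin J → ℝ)) := by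
  have hm : ∀ x, MeasurableSet (I.c t ⁻¹' {x}) := fun x =>
    hgen.measurable_c t ht (measurableSet_singleton x)
  have hU : (⋃ x, I.c t ⁻¹' {x}) = Set.univ := by
    ext ω
    simp
  have hd : Pairwise (Function.onFun Disjoint fun x => I.c t ⁻¹' {x}) := by
    intro x y hxy
    exact Set.disjoint_left.2 fun ω hx hy => hxy (hx.symm.trans hy)
  have h := integral_iUnion (f := fun ω => g (I.c t ω) (I.W t ω)) hm hd hint.integrableOn
  rw [hU, setIntegral_univ] at h
  rw [h]
  refine tsum_congr fun x => ?_
  have h1 : ∫ ω in I.c t ⁻¹' {x}, g (I.c t ω) (I.W t ω) ∂μ =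
      ∫ ω in I.c t ⁻¹' {x}, g x (I.W t ω) ∂μ :=
    setIntegral_congr_fun (hm x) fun ω hω => by
      have : I.c t ω = x := hω
      simp [this]
  rw [h1, ← integral_map (hgen.measurable_W t ht).aemeasurable
    (hg x).aestronglyMeasurable, hgen.law t ht x, integral_smul_measure, smul_eq_mul]

variable {y : C → Fin J → ℝ}

theorem abs_sum_mul_le_one {J : ℕ} {y z : Fin J → ℝ} (h1 : ∑ j, y j = 1) (h0 : ∀ j, 0 ≤ y j)
    (hz : ∀ j, |z j| ≤ 1) : |∑ j, y j * z j| ≤ 1 := by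
  calc |∑ j, y j * z j| ≤ ∑ j, |y j * z j| := Finset.abs_sum_le_sum_abs _ _
    _ ≤ ∑ j, y j := Finset.sum_le_sum fun j _ => by
        rw [abs_mul, abs_of_nonneg (h0 j)]
        exact mul_le_of_le_one_right (h0 j) (hz j)
    _ = 1 := h1

theorem Interaction.measurable_mixed_cost (I : Interaction Ω C J K) (t : ℕ)
    (y : C → Fin J → ℝ) (k : Fin K) :
    Measurable[MeasurableSpace.comap (fun ω => (I.c t ω, I.W t ω)) inferInstance]
      fun ω => ∑ j, y (I.c t ω) j * I.W t ω k j := by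
  have h : Measurable fun p : C × (Fin K → Fin J → ℝ) => ∑ j, y p.1 j * p.2 k j :=
    measurable_from_prod_countable_right fun x => by fun_prop
  exact h.comp (comap_measurable _)

omit [Countable C] [MeasurableSingletonClass C] in
theorem comap_context_cost_le (hgen : I.GeneratedBy M T μ) {t : ℕ} (ht : t ∈ Finset.Icc 1 T) :
    MeasurableSpace.comap (fun ω => (I.c t ω, I.W t ω)) inferInstance ≤ mΩ :=
  Measurable.comap_le ((hgen.measurable_c t ht).prodMk (hgen.measurable_W t ht))

omit [MeasurableSingletonClass C] in
theorem ae_abs_mixed_cost_le (hgen : I.GeneratedBy M T μ) (hcost : CostAssumption M) {t : ℕ}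
    (ht : t ∈ Finset.Icc 1 T) (hy : M.Feasible y) (k : Fin K) :
    ∀ᵐ ω ∂μ, |∑ j, y (I.c t ω) j * I.W t ω k j| ≤ 1 := by
  filter_upwards [ae_abs_cost_le_one hgen hcost ht] with ω hω
  exact abs_sum_mul_le_one (hy.1 _) (hy.2.1 _) (hω k)

theorem integrable_mixed_cost [IsFiniteMeasure μ] (hgen : I.GeneratedBy M T μ)
    (hcost : CostAssumption M) {t : ℕ} (ht : t ∈ Finset.Icc 1 T) (hy : M.Feasible y)
    (k : Fin K) : Integrable (fun ω => ∑ j, y (I.c t ω) j * I.W t ω k j) μ :=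
  Integrable.of_bound ((I.measurable_mixed_cost t y k).mono (comap_context_cost_le hgen ht)
    le_rfl).aestronglyMeasurable 1 (ae_abs_mixed_cost_le hgen hcost ht hy k)

theorem integral_mixed_cost [IsFiniteMeasure μ] (hgen : I.GeneratedBy M T μ)
    (hcost : CostAssumption M) {t : ℕ} (ht : t ∈ Finset.Icc 1 T) (hy : M.Feasible y)
    (k : Fin K) : ∫ ω, ∑ j, y (I.c t ω) j * I.W t ω k j ∂μ = M.cost k y := by
  rw [integral_context_cost hgen ht (g := fun x N => ∑ j, y x j * N k j) (fun x => by fun_prop)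
    (integrable_mixed_cost hgen hcost ht hy k), Model.cost]
  refine tsum_congr fun x => ?_
  have hi : ∀ j, Integrable (fun N : Fin K → Fin J → ℝ => N k j) (M.ν x : Measure _) := by
    intro j
    have hm : Measurable fun N : Fin K → Fin J → ℝ => N k j := by fun_prop
    refine Integrable.of_bound hm.aestronglyMeasurable 1 ?_
    filter_upwards [hcost x] with N hN
    exact hN k j
  rw [integral_finsetSum _ fun j _ => (hi j).const_mul _, Finset.mul_sum]
  refine Finset.sum_congr rfl fun j _ => ?_
  rw [integral_const_mul, Model.w]
  ring

theorem measurable_mixed_reward (hgen : I.GeneratedBy M T μ) {t : ℕ} (ht : t ∈ Finset.Icc 1 T)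
    (y : C → Fin J → ℝ) : Measurable fun ω => ∑ j, y (I.c t ω) j * M.r (I.c t ω) j := by
  have h : Measurable fun x : C => ∑ j, y x j * M.r x j := measurable_of_countable _
  exact h.comp (hgen.measurable_c t ht)

theorem integrable_mixed_reward [IsFiniteMeasure μ] (hgen : I.GeneratedBy M T μ)
    (hr : ∀ x j, M.r x j ∈ Set.Icc (0 : ℝ) 1) {t : ℕ} (ht : t ∈ Finset.Icc 1 T)
    (hy : M.Feasible y) : Integrable (fun ω => ∑ j, y (I.c t ω) j * M.r (I.c t ω) j) μ :=
  Integrable.of_bound (measurable_mixed_reward hgen ht y).aestronglyMeasurable 1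
    (Filter.Eventually.of_forall fun ω => abs_sum_mul_le_one (hy.1 _) (hy.2.1 _) fun j => by
      rw [abs_of_nonneg (hr _ j).1]
      exact (hr _ j).2)

theorem integral_mixed_reward [IsFiniteMeasure μ] (hgen : I.GeneratedBy M T μ)
    (hr : ∀ x j, M.r x j ∈ Set.Icc (0 : ℝ) 1) {t : ℕ} (ht : t ∈ Finset.Icc 1 T)
    (hy : M.Feasible y) :
    ∫ ω, ∑ j, y (I.c t ω) j * M.r (I.c t ω) j ∂μ = M.value y := by
  rw [integral_context_cost hgen ht (g := fun x _ => ∑ j, y x j * M.r x j)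
    (fun x => measurable_const) (integrable_mixed_reward hgen hr ht hy), Model.value]
  refine tsum_congr fun x => ?_
  rw [integral_const, probReal_univ, one_smul, Finset.mul_sum]
  refine Finset.sum_congr rfl fun j _ => by ring

/-- The place where independence enters. It applies to mixed actions y that depend on the context
only; the action taken also depends on the costs of the round and does not factor like this. -/
theorem integral_mul_mixed_cost [IsFiniteMeasure μ] (hgen : I.GeneratedBy M T μ)
    (hcost : CostAssumption M) {t : ℕ} (ht : t ∈ Finset.Icc 1 T) (hy : M.Feasible y)
    (k : Fin K) {H : Ω → ℝ} (hH : Measurable[I.history M (t - 1)] H) :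
    ∫ ω, H ω * ∑ j, y (I.c t ω) j * I.W t ω k j ∂μ = (∫ ω, H ω ∂μ) * M.cost k y := by
  have ht' := Finset.mem_Icc.1 ht
  have hind : IndepFun H (fun ω => ∑ j, y (I.c t ω) j * I.W t ω k j) μ := by
    rw [IndepFun_iff_Indep]
    exact indep_of_indep_of_le_left (indep_of_indep_of_le_right (hgen.indep t ht)
      (I.measurable_mixed_cost t y k).comap_le) hH.comap_le
  rw [← integral_mixed_cost hgen hcost ht hy k]
  exact hind.integral_fun_mul_eq_mul_integral
    (hH.mono (hgen.history_le (by omega)) le_rfl).aestronglyMeasurable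
    (integrable_mixed_cost hgen hcost ht hy k).aestronglyMeasurable

theorem integrable_mul_mixed_cost [IsFiniteMeasure μ] (hgen : I.GeneratedBy M T μ)
    (hcost : CostAssumption M) {t : ℕ} (ht : t ∈ Finset.Icc 1 T) (hy : M.Feasible y)
    (k : Fin K) {H : Ω → ℝ} (hH : Integrable H μ) :
    Integrable (fun ω => H ω * ∑ j, y (I.c t ω) j * I.W t ω k j) μ :=
  hH.mul_bdd (integrable_mixed_cost hgen hcost ht hy k).aestronglyMeasurable
    (ae_abs_mixed_cost_le hgen hcost ht hy k)

theorem value_mem_Icc [IsProbabilityMeasure μ] (hgen : I.GeneratedBy M T μ)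
    (hr : ∀ x j, M.r x j ∈ Set.Icc (0 : ℝ) 1) {t : ℕ} (ht : t ∈ Finset.Icc 1 T)
    (hy : M.Feasible y) : M.value y ∈ Set.Icc (0 : ℝ) 1 := by
  rw [← integral_mixed_reward hgen hr ht hy]
  constructor
  · exact integral_nonneg fun ω => Finset.sum_nonneg fun j _ =>
      mul_nonneg (hy.2.1 _ j) (hr _ j).1
  · calc _ ≤ ∫ _, (1 : ℝ) ∂μ := by
          refine integral_mono (integrable_mixed_reward hgen hr ht hy) (integrable_const _)
            fun ω => ?_
          refine (le_abs_self _).trans (abs_sum_mul_le_one (hy.1 _) (hy.2.1 _) fun j => ?_)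
          rw [abs_of_nonneg (hr _ j).1]
          exact (hr _ j).2
      _ = 1 := by simp

theorem integral_noise_eq_zero [IsFiniteMeasure μ] (hgen : I.GeneratedBy M T μ) {t : ℕ}
    (ht : t ∈ Finset.Icc 1 T) (hnoise : CondSubGaussian (I.preReward M t) (I.η t) μ) :
    ∫ ω, I.η t ω ∂μ = 0 := by
  rw [← integral_condExp (hgen.preReward_le ht), integral_congr_ae hnoise.2.1]
  simp

end Law

/-! ### Pathwise properties of the dual variables -/

section Queue

variable {C : Type*} {d J K : ℕ} {W : ℕ → Fin K → Fin J → ℝ} {A : ℕ → Fin J}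

theorem Q_nonneg (t : ℕ) (k : Fin K) : 0 ≤ Q W A t k := by
  rcases t with _ | _ | t
  · exact le_rfl
  · exact le_rfl
  · exact le_max_right _ _

theorem Q_one (k : Fin K) : Q W A 1 k = 0 := rfl

theorem Q_succ {t : ℕ} (ht : 1 ≤ t) (k : Fin K) :
    Q W A (t + 1) k = max (Q W A t k + W t k (A t) + eps K t) 0 := by
  obtain ⟨s, rfl⟩ : ∃ s, t = s + 1 := ⟨t - 1, by omega⟩
  rw [Q]
  simp

theorem eps_nonneg (K t : ℕ) : 0 ≤ eps K t := by unfold eps; positivity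

/-- Dropping every positive part. The slack ∑ ε_s is what finally pushes the violation below zero.
-/
theorem le_Q_succ (t : ℕ) (k : Fin K) :
    ∑ s ∈ Finset.Icc 1 t, W s k (A s) + ∑ s ∈ Finset.Icc 1 t, eps K s ≤ Q W A (t + 1) k := by
  induction t with
  | zero => simp [Q_one]
  | succ t ih =>
    rw [Finset.sum_Icc_succ_top (by omega), Finset.sum_Icc_succ_top (by omega),
      Q_succ (by omega)]
    refine le_trans ?_ (le_max_left _ _)
    linarith

theorem Q_succ_le {t : ℕ} (k : Fin K) (hW : ∀ s ∈ Finset.Icc 1 t, ∀ k j, |W s k j| ≤ 1) :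
    Q W A (t + 1) k ≤ t + ∑ s ∈ Finset.Icc 1 t, eps K s := by
  induction t with
  | zero => simp [Q_one]
  | succ t ih =>
    have h1 := ih fun s hs => hW s (Finset.Icc_subset_Icc_right (by omega) hs)
    have h2 := (abs_le.1 (hW (t + 1) (Finset.mem_Icc.2 ⟨by omega, le_rfl⟩) k (A (t + 1)))).2
    have h3 := eps_nonneg K (t + 1)
    have h4 : 0 ≤ ∑ s ∈ Finset.Icc 1 t, eps K s := Finset.sum_nonneg fun s _ => eps_nonneg K s
    rw [Finset.sum_Icc_succ_top (by omega), Q_succ (by omega)]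
    have h5 : (0 : ℝ) ≤ t := t.cast_nonneg
    push_cast
    exact max_le (by linarith) (by linarith)

theorem abs_Q_succ_sub_le {t : ℕ} (ht : 1 ≤ t) (k : Fin K) (hW : |W t k (A t)| ≤ 1) :
    |Q W A (t + 1) k - Q W A t k| ≤ 1 + eps K t := by
  have h0 := Q_nonneg (W := W) (A := A) t k
  have he := eps_nonneg K t
  rw [abs_le] at hW
  rw [Q_succ ht, abs_le]
  constructor
  · linarith [le_max_left (Q W A t k + W t k (A t) + eps K t) 0]
  · rw [sub_le_iff_le_add]
    exact max_le (by linarith) (by linarith)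

/-- The quadratic Lyapunov drift: the positive part does not increase squares. -/
theorem sum_sq_Q_succ_le {t : ℕ} (ht : 1 ≤ t) (hW : ∀ k, |W t k (A t)| ≤ 1) :
    ∑ k, Q W A (t + 1) k ^ 2 ≤ ∑ k, Q W A t k ^ 2 + 2 * ∑ k, Q W A t k * W t k (A t)
      + 2 * eps K t * ∑ k, Q W A t k + K * (1 + eps K t) ^ 2 := by
  have h : ∀ k, Q W A (t + 1) k ^ 2 ≤ Q W A t k ^ 2 + 2 * (Q W A t k * W t k (A t))
      + 2 * eps K t * Q W A t k + (1 + eps K t) ^ 2 := by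
    intro k
    have he := eps_nonneg K t
    have h1 : (W t k (A t) + eps K t) ^ 2 ≤ (1 + eps K t) ^ 2 := by
      have := abs_le.1 (hW k)
      exact sq_le_sq' (by linarith) (by linarith)
    have h2 : Q W A (t + 1) k ^ 2 ≤ (Q W A t k + (W t k (A t) + eps K t)) ^ 2 := by
      rw [Q_succ ht, ← add_assoc]
      rcases le_total (Q W A t k + W t k (A t) + eps K t) 0 with h | h
      · rw [max_eq_right h]
        nlinarith [sq_nonneg (Q W A t k + W t k (A t) + eps K t)]
      · rw [max_eq_left h]
    nlinarith
  calc _ ≤ ∑ k, (Q W A t k ^ 2 + 2 * (Q W A t k * W t k (A t))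
      + 2 * eps K t * Q W A t k + (1 + eps K t) ^ 2) := Finset.sum_le_sum fun k _ => h k
    _ = _ := by
      simp [Finset.sum_add_distrib, Finset.mul_sum]

/-- Only costs of actions actually taken before round t enter Q(t), so it is independent of the
context and costs of round t. -/
theorem measurable_Q {Ω C : Type*} [MeasurableSpace C] (I : Interaction Ω C J K)
    (M : Model C d J K) (t : ℕ) (k : Fin K) : Measurable[I.history M (t - 1)]
      fun ω => Q (fun s => I.W s ω) (fun s => I.A s ω) t k := by
  rcases t with _ | t
  · exact measurable_const
  · induction t with
    | zero => exact measurable_const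
    | succ t ih =>
      have h : (fun ω => Q (fun s => I.W s ω) (fun s => I.A s ω) (t + 1 + 1) k) = fun ω =>
          max (Q (fun s => I.W s ω) (fun s => I.A s ω) (t + 1) k
            + I.W (t + 1) ω k (I.A (t + 1) ω) + eps K (t + 1)) 0 := by
        funext ω
        exact Q_succ (by omega) k
      rw [h]
      refine Measurable.max (Measurable.add (Measurable.add ?_ ?_) measurable_const)
        measurable_const
      · exact ih.mono (I.history_mono M (by omega)) le_rfl
      · exact I.measurable_cost_history M (by simp) k

end Queue

/-! ### Comparison of one round with a mixed action -/

section Round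

variable {Ω C : Type*} {d J K T : ℕ} {M : Model C d J K} {I : Interaction Ω C J K} {m δ : ℝ}

/-- Dual variables along the sample paths of the interaction. -/
def Interaction.queue (I : Interaction Ω C J K) (t : ℕ) (ω : Ω) (k : Fin K) : ℝ :=
  Q (fun s => I.W s ω) (fun s => I.A s ω) t k

/-- `selfNorm` along the sample paths of the interaction. -/
def Interaction.selfNorm (I : Interaction Ω C J K) (M : Model C d J K) (t : ℕ) (ω : Ω) : ℝ :=
  ConstrainedBandit.selfNorm M.φ (fun s => I.c s ω) (fun s => I.A s ω) (fun s => I.η s ω) t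

/-- Optimistic reward estimate of the action that is taken. -/
def Interaction.optimistic (I : Interaction Ω C J K) (M : Model C d J K) (m : ℝ) (T t : ℕ)
    (ω : Ω) : ℝ :=
  rHat M.φ m T (fun s => I.c s ω) (fun s => I.A s ω) (fun s => I.obs M s ω) t (I.A t ω)

/-- The action taken does at least as well as any mixed action in terms of the
pseudo-action-value. -/
theorem mixed_le_optimistic (hφ : ∀ x j, ‖M.φ x j‖ ≤ 1) (hθ : ‖M.θ‖ ≤ m)
    (hr : ∀ x j, M.r x j ∈ Set.Icc (0 : ℝ) 1) (halg : I.FollowsAlgorithm M m δ T) {t : ℕ}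
    (ht : t ∈ Finset.Icc 1 T) (ω : Ω) {y : Fin J → ℝ} (h1 : ∑ j, y j = 1) (h0 : ∀ j, 0 ≤ y j) :
    ∑ j, y j * M.r (I.c t ω) j
      - max (I.selfNorm M (t - 1) ω - noiseRadius d T (t - 1)) 0
      - 1 / V K δ t * ∑ k, I.queue t ω k * ∑ j, y j * I.W t ω k j
      ≤ I.optimistic M m T t ω
        - 1 / V K δ t * ∑ k, I.queue t ω k * I.W t ω k (I.A t ω) := by
  set e := max (I.selfNorm M (t - 1) ω - noiseRadius d T (t - 1)) 0 with he
  set P := I.optimistic M m T t ω - 1 / V K δ t * ∑ k, I.queue t ω k * I.W t ω k (I.A t ω)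
    with hP
  have h2 : ∀ j, M.r (I.c t ω) j - e - 1 / V K δ t * ∑ k, I.queue t ω k * I.W t ω k j ≤ P := by
    intro j
    have h3 := halg t ht ω j
    simp only [pseudoValue, mul_comm (I.W t ω _ _)] at h3
    have h4 := inner_sub_le_rHat (φ := M.φ) (θ := M.θ) (c := fun s => I.c s ω)
      (A := fun s => I.A s ω) (R := fun s => I.obs M s ω) (η := fun s => I.η s ω) (T := T)
      hφ hθ (t := t) (fun s _ => rfl) j (hr _ j).2
    change M.r (I.c t ω) j - e ≤ _ at h4
    change _ ≤ P at h3
    refine le_trans ?_ h3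
    exact sub_le_sub_right h4 _
  calc _ = ∑ j, y j * (M.r (I.c t ω) j - e
        - 1 / V K δ t * ∑ k, I.queue t ω k * I.W t ω k j) := by
        simp only [mul_sub, Finset.sum_sub_distrib, ← Finset.sum_mul, h1, one_mul]
        congr 1
        simp only [Finset.mul_sum]
        rw [Finset.sum_comm]
        refine Finset.sum_congr rfl fun k _ => Finset.sum_congr rfl fun j _ => by ring
    _ ≤ ∑ j, y j * P := Finset.sum_le_sum fun j _ => mul_le_mul_of_nonneg_left (h2 j) (h0 j)
    _ = P := by rw [← Finset.sum_mul, h1, one_mul]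

end Round

/-! ### Elementary sums over the rounds and the constants of the regret bound -/

section Sums

theorem one_div_sqrt_succ_le (t : ℕ) : 1 / √((t + 1 : ℕ) : ℝ) ≤ 2 * (√((t + 1 : ℕ) : ℝ) - √t) := by
  have h0 : (0 : ℝ) ≤ t := t.cast_nonneg
  have h1 : 0 < √((t + 1 : ℕ) : ℝ) := Real.sqrt_pos.2 (by positivity)
  have h2 := Real.sq_sqrt h0
  have h3 : √((t + 1 : ℕ) : ℝ) ^ 2 = t + 1 := by
    rw [Real.sq_sqrt (by positivity)]
    push_cast
    ring
  rw [div_le_iff₀ h1]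
  nlinarith [sq_nonneg (√((t + 1 : ℕ) : ℝ) - √t)]

theorem sum_one_div_sqrt_le (t : ℕ) : ∑ s ∈ Finset.Icc 1 t, 1 / √(s : ℝ) ≤ 2 * √t := by
  induction t with
  | zero => simp
  | succ t ih =>
    rw [Finset.sum_Icc_succ_top (by omega)]
    linarith [one_div_sqrt_succ_le t]

theorem le_sum_one_div_sqrt (t : ℕ) : 2 * √t - 2 ≤ ∑ s ∈ Finset.Icc 1 t, 1 / √(s : ℝ) := by
  suffices h : 2 * √((t + 1 : ℕ) : ℝ) - 2 ≤ ∑ s ∈ Finset.Icc 1 t, 1 / √(s : ℝ) by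
    have : √(t : ℝ) ≤ √((t + 1 : ℕ) : ℝ) := Real.sqrt_le_sqrt (by push_cast; linarith)
    linarith
  induction t with
  | zero => simp
  | succ t ih =>
    rw [Finset.sum_Icc_succ_top (by omega)]
    have h1 : 0 < √((t + 1 : ℕ) : ℝ) := Real.sqrt_pos.2 (by positivity)
    have h3 : √((t + 1 : ℕ) : ℝ) ^ 2 = t + 1 := by
      rw [Real.sq_sqrt (by positivity)]
      push_cast
      ring
    have h4 : √((t + 1 + 1 : ℕ) : ℝ) ^ 2 = t + 2 := by
      rw [Real.sq_sqrt (by positivity)]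
      push_cast
      ring
    have h5 : 2 * (√((t + 1 + 1 : ℕ) : ℝ) - √((t + 1 : ℕ) : ℝ)) ≤ 1 / √((t + 1 : ℕ) : ℝ) := by
      rw [le_div_iff₀ h1]
      nlinarith [sq_nonneg (√((t + 1 + 1 : ℕ) : ℝ) - √((t + 1 : ℕ) : ℝ))]
    linarith

theorem sum_one_div_mul_sqrt_le (t : ℕ) :
    ∑ s ∈ Finset.Icc 1 t, 1 / ((s : ℝ) * √(s : ℝ)) ≤ 3 := by
  suffices h : ∑ s ∈ Finset.Icc 1 (t + 1), 1 / ((s : ℝ) * √(s : ℝ))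
      ≤ 3 - 2 / √((t + 1 : ℕ) : ℝ) by
    rw [Finset.sum_Icc_succ_top (by omega)] at h
    have h1 : 0 ≤ 2 / √((t + 1 : ℕ) : ℝ) := by positivity
    have h2 : 0 ≤ 1 / (((t + 1 : ℕ) : ℝ) * √((t + 1 : ℕ) : ℝ)) := by positivity
    linarith
  induction t with
  | zero => norm_num
  | succ t ih =>
    rw [Finset.sum_Icc_succ_top (by omega)]
    set a := √((t + 1 : ℕ) : ℝ) with ha
    set b := √((t + 1 + 1 : ℕ) : ℝ) with hb
    have ha0 : 0 < a := Real.sqrt_pos.2 (by positivity)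
    have hb0 : 0 < b := Real.sqrt_pos.2 (by positivity)
    have ha2 : a ^ 2 = t + 1 := by
      rw [Real.sq_sqrt (by positivity)]
      push_cast
      ring
    have hb2 : b ^ 2 = t + 2 := by
      rw [Real.sq_sqrt (by positivity)]
      push_cast
      ring
    have hb3 : ((t + 1 + 1 : ℕ) : ℝ) = b ^ 2 := (Real.sq_sqrt (by positivity)).symm
    have hab : a ≤ b := Real.sqrt_le_sqrt (by push_cast; linarith)
    have h1 : 1 / (b ^ 2 * b) ≤ 2 / a - 2 / b := by
      rw [div_sub_div _ _ ha0.ne' hb0.ne', div_le_div_iff₀ (by positivity) (by positivity)]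
      have h2 : (b - a) * (b + a) = 1 := by nlinarith
      have h3 : 1 ≤ (b - a) * (2 * b) := by nlinarith
      have h4 : a * b ≤ b * b := by nlinarith
      calc 1 * (a * b) ≤ ((b - a) * (2 * b)) * (b * b) :=
            mul_le_mul h3 h4 (by positivity) (by nlinarith)
        _ = _ := by ring
    rw [hb3]
    linarith

theorem le_sum_sqrt (t : ℕ) : 2 / 3 * (t * √t) ≤ ∑ s ∈ Finset.Icc 1 t, √(s : ℝ) := by
  induction t with
  | zero => simp
  | succ t ih =>
    rw [Finset.sum_Icc_succ_top (by omega)]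
    set a := √(t : ℝ) with ha
    set b := √((t + 1 : ℕ) : ℝ) with hb
    have ha0 : 0 ≤ a := Real.sqrt_nonneg _
    have hb0 : 0 < b := Real.sqrt_pos.2 (by positivity)
    have ha2 : (t : ℝ) = a ^ 2 := (Real.sq_sqrt (by positivity)).symm
    have hb2 : ((t + 1 : ℕ) : ℝ) = b ^ 2 := (Real.sq_sqrt (by positivity)).symm
    have h1 : b ^ 2 = a ^ 2 + 1 := by
      rw [← ha2, ← hb2]
      push_cast
      ring
    rw [ha2] at ih
    rw [hb2]
    have h2 : b ≤ a + 1 := by nlinarith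
    nlinarith [mul_nonneg ha0 hb0.le, sq_nonneg (b - a), mul_nonneg hb0.le (sq_nonneg (b - a)),
      mul_nonneg ha0 (sq_nonneg (b - a))]

/-- The positive terms of a nonincreasing sequence form an initial segment. A sum of positive parts
is then bounded by maximizing the plain partial sums over their length n. -/
theorem exists_sum_max_zero_eq {f : ℕ → ℝ} (hf : ∀ s t, 1 ≤ s → s ≤ t → f t ≤ f s) (t : ℕ) :
    ∃ n, ∑ s ∈ Finset.Icc 1 t, max (f s) 0 = ∑ s ∈ Finset.Icc 1 n, f s := by
  induction t with
  | zero => exact ⟨0, by simp⟩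
  | succ t ih =>
    rcases le_total (f (t + 1)) 0 with h | h
    · obtain ⟨n, hn⟩ := ih
      exact ⟨n, by rw [Finset.sum_Icc_succ_top (by omega), hn, max_eq_right h, add_zero]⟩
    · refine ⟨t + 1, Finset.sum_congr rfl fun s hs => max_eq_left ?_⟩
      rw [Finset.mem_Icc] at hs
      exact h.trans (hf s _ hs.1 hs.2)

theorem sum_max_div_sqrt_sub_le {κ δ : ℝ} (hκ : 0 ≤ κ) (hδ : 0 < δ) (t : ℕ) :
    ∑ s ∈ Finset.Icc 1 t, max (κ / √(s : ℝ) - δ) 0 ≤ κ ^ 2 / δ := by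
  obtain ⟨n, hn⟩ := exists_sum_max_zero_eq (f := fun s => κ / √(s : ℝ) - δ) (by
    intro s t hs hst
    have h1 : 0 < √(s : ℝ) := Real.sqrt_pos.2 (by exact_mod_cast hs)
    have h2 : √(s : ℝ) ≤ √(t : ℝ) := Real.sqrt_le_sqrt (by exact_mod_cast hst)
    gcongr) t
  rw [hn, Finset.sum_sub_distrib]
  have h1 : ∑ s ∈ Finset.Icc 1 n, κ / √(s : ℝ) ≤ κ * (2 * √n) := by
    calc _ = κ * ∑ s ∈ Finset.Icc 1 n, 1 / √(s : ℝ) := by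
          rw [Finset.mul_sum]
          exact Finset.sum_congr rfl fun s _ => by ring
      _ ≤ _ := mul_le_mul_of_nonneg_left (sum_one_div_sqrt_le n) hκ
  have h2 : ∑ s ∈ Finset.Icc 1 n, δ = n * δ := by simp
  have h3 : (n : ℝ) = √(n : ℝ) ^ 2 := (Real.sq_sqrt n.cast_nonneg).symm
  rw [h2, h3, le_div_iff₀ hδ]
  -- 2κ√n - δn is largest at √n = κ/δ.
  nlinarith [sq_nonneg (κ - δ * √(n : ℝ)), mul_le_mul_of_nonneg_right h1 hδ.le]

theorem sum_max_sub_mul_sqrt_le {κ δ : ℝ} (hκ : 0 ≤ κ) (hδ : 0 < δ) (t : ℕ) :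
    ∑ s ∈ Finset.Icc 1 t, max (κ - δ * √(s : ℝ)) 0 ≤ κ ^ 3 / (3 * δ ^ 2) := by
  obtain ⟨n, hn⟩ := exists_sum_max_zero_eq (f := fun s => κ - δ * √(s : ℝ)) (by
    intro s t hs hst
    have h2 : √(s : ℝ) ≤ √(t : ℝ) := Real.sqrt_le_sqrt (by exact_mod_cast hst)
    gcongr) t
  rw [hn, Finset.sum_sub_distrib, ← Finset.mul_sum]
  have h1 := mul_le_mul_of_nonneg_left (le_sum_sqrt n) hδ.le
  have h2 : ∑ s ∈ Finset.Icc 1 n, κ = n * κ := by simp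
  have h3 : (n : ℝ) = √(n : ℝ) ^ 2 := (Real.sq_sqrt n.cast_nonneg).symm
  rw [h2, le_div_iff₀ (by positivity)]
  set u := √(n : ℝ) with hu
  rw [h3] at h1 ⊢
  have hu0 : 0 ≤ u := Real.sqrt_nonneg _
  -- This product is κ³ - 3κδ²u² + 2δ³u³, which is the claim up to the factor 3δ²; equality holds at
  -- u = κ/δ.
  have h4 : 0 ≤ (κ - δ * u) ^ 2 * (κ + 2 * (δ * u)) := by positivity
  have h5 := mul_le_mul_of_nonneg_right h1 (by positivity : 0 ≤ 3 * δ ^ 2)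
  nlinarith

/-- Summation by parts against a nonincreasing weight. -/
theorem sum_mul_sub_succ_nonpos {a v : ℕ → ℝ} (ha : ∀ t, 0 ≤ a t) (h1 : a 1 = 0)
    (hv : ∀ t, 1 ≤ t → v (t + 1) ≤ v t) (hv0 : ∀ t, 1 ≤ t → 0 ≤ v t) (t : ℕ) :
    ∑ s ∈ Finset.Icc 1 t, v s * (a s - a (s + 1)) ≤ 0 := by
  have key : ∀ n, ∑ s ∈ Finset.Icc 1 (n + 1), v s * (a s - a (s + 1))
      ≤ -(v (n + 1) * a (n + 1 + 1)) := by
    intro n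
    induction n with
    | zero => simp [h1]
    | succ n ih =>
      rw [Finset.sum_Icc_succ_top (by omega)]
      have := mul_le_mul_of_nonneg_right (hv (n + 1) (by omega)) (ha (n + 1 + 1))
      linarith
  rcases t with _ | t
  · simp
  · exact (key t).trans (neg_nonpos.2 (mul_nonneg (hv0 _ (by omega)) (ha _)))

/-- `K^{3/4} √6`, so that `ε_t = slackScale K / √t`. -/
def slackScale (K : ℕ) : ℝ := (K : ℝ) ^ (3 / 4 : ℝ) * √6

theorem slackScale_nonneg (K : ℕ) : 0 ≤ slackScale K := by unfold slackScale; positivity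

theorem eps_eq (K t : ℕ) : eps K t = slackScale K / √t := by
  rw [eps, slackScale, Real.sqrt_div (by norm_num), mul_div_assoc]

theorem slackScale_sq (K : ℕ) : slackScale K ^ 2 = 6 * (K : ℝ) ^ (3 / 2 : ℝ) := by
  rw [slackScale, mul_pow, Real.sq_sqrt (by norm_num), ← Real.rpow_natCast, ← Real.rpow_mul
    K.cast_nonneg]
  norm_num
  ring

theorem slackScale_pow_four (K : ℕ) : slackScale K ^ 4 = 36 * (K : ℝ) ^ 3 := by
  have h : slackScale K ^ 4 = (slackScale K ^ 2) ^ 2 := by ring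
  rw [h, slackScale_sq, mul_pow, ← Real.rpow_natCast (_ ^ _), ← Real.rpow_mul K.cast_nonneg]
  norm_num

theorem le_slackScale {K : ℕ} (hK : 0 < K) : 2.4 ≤ slackScale K := by
  have h1 : (1 : ℝ) ≤ (K : ℝ) ^ (3 / 4 : ℝ) :=
    Real.one_le_rpow (by exact_mod_cast hK) (by norm_num)
  have h2 : (2.4 : ℝ) ≤ √6 := Real.le_sqrt_of_sq_le (by norm_num)
  unfold slackScale
  nlinarith

theorem V_pos {K : ℕ} (hK : 0 < K) {δ : ℝ} (hδ : 0 < δ) {t : ℕ} (ht : 1 ≤ t) : 0 < V K δ t := by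
  have : (0 : ℝ) < K := by exact_mod_cast hK
  have : (0 : ℝ) < t := by exact_mod_cast ht
  unfold V
  positivity

theorem V_mono {K : ℕ} {δ : ℝ} (hδ : 0 < δ) {s t : ℕ} (h : s ≤ t) : V K δ s ≤ V K δ t := by
  have : (s : ℝ) ≤ t := by exact_mod_cast h
  unfold V
  gcongr

theorem sqrt_two_mul_div_three (t : ℕ) : √(2 * t / 3 : ℝ) = 2 / √6 * √t := by
  have h : (2 * t / 3 : ℝ) = (2 / √6) ^ 2 * t := by
    rw [div_pow, Real.sq_sqrt (by norm_num)]
    ring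
  rw [h, Real.sqrt_mul (by positivity), Real.sqrt_sq (by positivity)]

/-- With this V_t, the drift cost K/V_t is of the same order κ/(δ√t) as the pessimism cost ε_t/δ. -/
theorem K_div_V {K : ℕ} (hK : 0 < K) {δ : ℝ} (hδ : 0 < δ) {t : ℕ} (ht : 1 ≤ t) :
    K / V K δ t = slackScale K / (2 * δ * √t) := by
  have h1 : (0 : ℝ) < K := by exact_mod_cast hK
  have h2 : (0 : ℝ) < t := by exact_mod_cast ht
  have h3 : (K : ℝ) = (K : ℝ) ^ (3 / 4 : ℝ) * (K : ℝ) ^ (1 / 4 : ℝ) := by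
    rw [← Real.rpow_add h1]
    norm_num
  have h4 : (0 : ℝ) < (K : ℝ) ^ (1 / 4 : ℝ) := by positivity
  have h5 : 0 < √(t : ℝ) := Real.sqrt_pos.2 h2
  have h6 : 0 < √(6 : ℝ) := by positivity
  rw [V, slackScale, sqrt_two_mul_div_three]
  nth_rewrite 1 [h3]
  field_simp

/-- The deterministic part of the regret bound. -/
theorem regret_terms_le {K : ℕ} (hK : 0 < K) {δ : ℝ} (hδ : 0 < δ) (hδ1 : δ ≤ 1) (τ : ℕ) :
    ∑ t ∈ Finset.Icc 1 τ, (eps K t / δ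
      + max (eps K t - δ) 0 * (K / V K δ t) * (t + 2 * slackScale K * √t)
      + K / V K δ t * (2 + 2 / 3 * eps K t ^ 2))
      ≤ 60 * (K : ℝ) ^ 3 / δ ^ 3 + 4 * √6 * (K : ℝ) ^ (3 / 4 : ℝ) * √τ / δ := by
  set κ := slackScale K with hκ
  have hκ0 : 0 ≤ κ := slackScale_nonneg K
  -- The leading coefficient 2κ/δ collects ε_t/δ and 2K/V_t in equal parts; the other three terms
  -- have bounded sums.
  have hterm : ∀ t ∈ Finset.Icc 1 τ, eps K t / δ
      + max (eps K t - δ) 0 * (K / V K δ t) * (t + 2 * κ * √t)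
      + K / V K δ t * (2 + 2 / 3 * eps K t ^ 2) =
      2 * κ / δ * (1 / √(t : ℝ)) + κ / (2 * δ) * max (κ - δ * √(t : ℝ)) 0
        + κ ^ 2 / δ * max (κ / √(t : ℝ) - δ) 0 + κ ^ 3 / (3 * δ) * (1 / (t * √(t : ℝ))) := by
    intro t ht
    have ht1 : 1 ≤ t := (Finset.mem_Icc.1 ht).1
    have ht0 : (0 : ℝ) < t := by exact_mod_cast ht1
    have hs : 0 < √(t : ℝ) := Real.sqrt_pos.2 ht0
    have hsq : (t : ℝ) = √(t : ℝ) ^ 2 := (Real.sq_sqrt ht0.le).symm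
    have hmax : max (κ - δ * √(t : ℝ)) 0 = max (κ / √(t : ℝ) - δ) 0 * √(t : ℝ) := by
      rw [max_mul_of_nonneg _ _ hs.le, zero_mul, sub_mul, div_mul_cancel₀ _ hs.ne']
    rw [K_div_V hK hδ ht1, eps_eq, ← hκ, hmax]
    generalize max (κ / √(t : ℝ) - δ) 0 = x
    generalize √(t : ℝ) = s at *
    rw [hsq]
    field_simp
    ring
  rw [Finset.sum_congr rfl hterm]
  simp only [Finset.sum_add_distrib, ← Finset.mul_sum]
  have e1 := mul_le_mul_of_nonneg_left (sum_one_div_sqrt_le τ) (by positivity : 0 ≤ 2 * κ / δ)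
  have e2 := mul_le_mul_of_nonneg_left (sum_max_sub_mul_sqrt_le hκ0 hδ τ)
    (by positivity : 0 ≤ κ / (2 * δ))
  have e3 := mul_le_mul_of_nonneg_left (sum_max_div_sqrt_sub_le hκ0 hδ τ)
    (by positivity : 0 ≤ κ ^ 2 / δ)
  have e4 := mul_le_mul_of_nonneg_left (sum_one_div_mul_sqrt_le τ)
    (by positivity : 0 ≤ κ ^ 3 / (3 * δ))
  have hK4 := slackScale_pow_four K
  rw [← hκ] at hK4
  have f1 : 2 * κ / δ * (2 * √τ) = 4 * √6 * (K : ℝ) ^ (3 / 4 : ℝ) * √τ / δ := by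
    rw [hκ, slackScale]
    ring
  have f2 : κ / (2 * δ) * (κ ^ 3 / (3 * δ ^ 2)) = 6 * (K : ℝ) ^ 3 / δ ^ 3 := by
    calc _ = κ ^ 4 / (6 * δ ^ 3) := by field_simp; ring
      _ = _ := by rw [hK4]; ring
  have f3 : κ ^ 2 / δ * (κ ^ 2 / δ) ≤ 36 * (K : ℝ) ^ 3 / δ ^ 3 := by
    calc _ = 36 * (K : ℝ) ^ 3 / δ ^ 2 := by rw [← hK4]; ring
      _ ≤ _ := div_le_div_of_nonneg_left (by positivity) (by positivity)
        (pow_le_pow_of_le_one hδ.le hδ1 (by norm_num))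
  -- κ ≥ 2.4 turns κ⁴ = 36K³ into κ³ ≤ 15K³. The three bounded sums then total 6 + 36 + 15 = 57 ≤
  -- 60.
  have f4 : κ ^ 3 / (3 * δ) * 3 ≤ 15 * (K : ℝ) ^ 3 / δ ^ 3 := by
    have g1 : κ ^ 3 ≤ 15 * (K : ℝ) ^ 3 := by
      have := mul_le_mul_of_nonneg_right (le_slackScale hK) (pow_nonneg hκ0 3)
      rw [← hκ] at this
      nlinarith
    calc _ = κ ^ 3 / δ := by field_simp
      _ ≤ _ := div_le_div₀ (by positivity) g1 (by positivity)
        (by simpa using pow_le_pow_of_le_one hδ.le hδ1 (by norm_num : 1 ≤ 3))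
  have f5 : 6 * (K : ℝ) ^ 3 / δ ^ 3 + 36 * (K : ℝ) ^ 3 / δ ^ 3 + 15 * (K : ℝ) ^ 3 / δ ^ 3
      ≤ 60 * (K : ℝ) ^ 3 / δ ^ 3 := by
    rw [← add_div, ← add_div]
    gcongr
    have : (0 : ℝ) ≤ (K : ℝ) ^ 3 := by positivity
    linarith
  linarith

end Sums

/-! ### Expected regret of a single round -/

section Regret

variable {Ω C : Type*} {mΩ : MeasurableSpace Ω} {μ : Measure Ω} [Countable C] [MeasurableSpace C]
  [MeasurableSingletonClass C] {d J K T : ℕ} {M : Model C d J K} {I : Interaction Ω C J K}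
  {m δ : ℝ}

/-- The pessimistic-optimistic algorithm is run for `T` rounds on an environment satisfying the
assumptions on rewards and costs. -/
structure IsRun (I : Interaction Ω C J K) (M : Model C d J K) (m δ : ℝ) (T : ℕ)
    (μ : Measure Ω) : Prop where
  d_pos : 0 < d
  K_pos : 0 < K
  δ_pos : 0 < δ
  gen : I.GeneratedBy M T μ
  reward : RewardAssumption I M m T μ
  cost : CostAssumption M
  alg : I.FollowsAlgorithm M m δ T

/-- The reward that is expected from the action taken in round `t`. -/
def Interaction.meanReward (I : Interaction Ω C J K) (M : Model C d J K) (t : ℕ) (ω : Ω) : ℝ :=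
  M.r (I.c t ω) (I.A t ω)

/-- The norm of the feature vector of round `t` with respect to `Σ_{t-1}⁻¹`. -/
def Interaction.sqrtWidth (I : Interaction Ω C J K) (M : Model C d J K) (t : ℕ) (ω : Ω) : ℝ :=
  √(width M.φ (fun s => I.c s ω) (fun s => I.A s ω) t)

/-- The cost of type `k` that is incurred in round `t`. -/
def Interaction.paid (I : Interaction Ω C J K) (t : ℕ) (ω : Ω) (k : Fin K) : ℝ :=
  I.W t ω k (I.A t ω)

theorem IsRun.T_pos_of_mem {t : ℕ} (ht : t ∈ Finset.Icc 1 T) : 0 < T := by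
  have := Finset.mem_Icc.1 ht
  omega

omit [MeasurableSingletonClass C] in
theorem IsRun.ae_abs_W_le (S : IsRun I M m δ T μ) :
    ∀ᵐ ω ∂μ, ∀ t ∈ Finset.Icc 1 T, ∀ k j, |I.W t ω k j| ≤ 1 :=
  (Filter.eventually_all_finset _).2 fun _ ht => ae_abs_cost_le_one S.gen S.cost ht

omit [Countable C] [MeasurableSpace C] [MeasurableSingletonClass C] in
theorem Interaction.queue_nonneg (I : Interaction Ω C J K) (t : ℕ) (ω : Ω) (k : Fin K) :
    0 ≤ I.queue t ω k := Q_nonneg t k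

/-- Almost sure bound on the dual variables after `t` rounds. -/
def queueBound (K t : ℕ) : ℝ := t + 2 * slackScale K * √t

theorem queueBound_nonneg (K t : ℕ) : 0 ≤ queueBound K t := by
  have := slackScale_nonneg K
  unfold queueBound
  positivity

theorem sum_eps_eq (K t : ℕ) :
    ∑ s ∈ Finset.Icc 1 t, eps K s = slackScale K * ∑ s ∈ Finset.Icc 1 t, 1 / √(s : ℝ) := by
  rw [Finset.mul_sum]
  exact Finset.sum_congr rfl fun s _ => by rw [eps_eq, mul_one_div]

omit [Countable C] [MeasurableSpace C] [MeasurableSingletonClass C] in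
theorem Interaction.queue_succ_le (I : Interaction Ω C J K) {t : ℕ} {ω : Ω} (k : Fin K)
    (hW : ∀ s ∈ Finset.Icc 1 t, ∀ k j, |I.W s ω k j| ≤ 1) :
    I.queue (t + 1) ω k ≤ queueBound K t := by
  refine (Q_succ_le k hW).trans ?_
  rw [sum_eps_eq, queueBound]
  have := mul_le_mul_of_nonneg_left (sum_one_div_sqrt_le t) (slackScale_nonneg K)
  linarith

omit [MeasurableSingletonClass C] in
theorem IsRun.ae_queue_le (S : IsRun I M m δ T μ) {t : ℕ} (ht : t ≤ T) :
    ∀ᵐ ω ∂μ, ∀ k, I.queue (t + 1) ω k ≤ queueBound K t := by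
  filter_upwards [S.ae_abs_W_le] with ω hω k
  exact I.queue_succ_le k fun s hs => hω s (Finset.Icc_subset_Icc_right ht hs)

omit [Countable C] [MeasurableSingletonClass C] in
theorem Interaction.measurable_queue_history (I : Interaction Ω C J K) (M : Model C d J K) (t : ℕ)
    (k : Fin K) : Measurable[I.history M (t - 1)] fun ω => I.queue t ω k :=
  measurable_Q I M t k

theorem IsRun.measurable_queue (S : IsRun I M m δ T μ) {t : ℕ} (ht : t ≤ T) (k : Fin K) :
    Measurable fun ω => I.queue (t + 1) ω k :=
  (I.measurable_queue_history M (t + 1) k).mono (S.gen.history_le (by simpa using ht)) le_rfl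

theorem IsRun.integrable_queue [IsFiniteMeasure μ] (S : IsRun I M m δ T μ) {t : ℕ} (ht : t ≤ T)
    (k : Fin K) : Integrable (fun ω => I.queue (t + 1) ω k) μ := by
  refine Integrable.of_bound (S.measurable_queue ht k).aestronglyMeasurable (queueBound K t) ?_
  filter_upwards [S.ae_queue_le ht] with ω hω
  rw [Real.norm_eq_abs, abs_of_nonneg (I.queue_nonneg _ _ _)]
  exact hω k

theorem IsRun.integrable_queue_sq [IsFiniteMeasure μ] (S : IsRun I M m δ T μ) {t : ℕ}
    (ht : t ≤ T) (k : Fin K) : Integrable (fun ω => I.queue (t + 1) ω k ^ 2) μ := by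
  refine Integrable.of_bound ((S.measurable_queue ht k).pow_const 2).aestronglyMeasurable
    (queueBound K t ^ 2) ?_
  filter_upwards [S.ae_queue_le ht] with ω hω
  rw [Real.norm_eq_abs, abs_of_nonneg (by positivity)]
  exact pow_le_pow_left₀ (I.queue_nonneg _ _ _) (hω k) 2

omit [MeasurableSingletonClass C] in
theorem IsRun.integrable_paid [IsFiniteMeasure μ] (S : IsRun I M m δ T μ) {t : ℕ}
    (ht : t ∈ Finset.Icc 1 T) (k : Fin K) : Integrable (fun ω => I.paid t ω k) μ := by
  refine Integrable.of_bound (S.gen.measurable_cost ht k).aestronglyMeasurable 1 ?_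
  filter_upwards [S.ae_abs_W_le] with ω hω
  exact hω t ht k _

theorem IsRun.integrable_queue_mul_paid [IsFiniteMeasure μ] (S : IsRun I M m δ T μ) {t : ℕ}
    (ht : t + 1 ∈ Finset.Icc 1 T) (k : Fin K) :
    Integrable (fun ω => I.queue (t + 1) ω k * I.paid (t + 1) ω k) μ := by
  have ht' := Finset.mem_Icc.1 ht
  refine (S.integrable_queue (by omega) k).mul_bdd
    (S.integrable_paid ht k).aestronglyMeasurable (c := 1) ?_
  filter_upwards [S.ae_abs_W_le] with ω hω
  exact hω (t + 1) ht k _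

theorem IsRun.integrable_meanReward [IsFiniteMeasure μ] (S : IsRun I M m δ T μ) {t : ℕ}
    (ht : t ∈ Finset.Icc 1 T) : Integrable (I.meanReward M t) μ := by
  have h : Measurable fun p : C × Fin J => M.r p.1 p.2 := measurable_of_countable _
  refine Integrable.of_bound (h.comp ((S.gen.measurable_c t ht).prodMk
    (S.gen.measurable_A t ht))).aestronglyMeasurable 1 (Filter.Eventually.of_forall fun ω => ?_)
  have := S.reward.r_mem (I.c t ω) (I.A t ω)
  exact (abs_of_nonneg this.1).trans_le this.2

theorem IsRun.integrable_sqrtWidth [IsFiniteMeasure μ] (S : IsRun I M m δ T μ) {t : ℕ}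
    (ht : t ∈ Finset.Icc 1 T) : Integrable (I.sqrtWidth M t) μ := by
  refine Integrable.of_bound (((I.measurable_width M t).mono (S.gen.preReward_le ht)
    le_rfl).sqrt).aestronglyMeasurable 1 (Filter.Eventually.of_forall fun ω => ?_)
  exact (abs_of_nonneg (Real.sqrt_nonneg _)).trans_le
    (Real.sqrt_le_one.2 (invQuad_gram_le_one _ _ S.reward.norm_φ _ _ _))

omit [Countable C] [MeasurableSingletonClass C] in
/-- Comparison of round `t + 1` with a mixed action. -/
theorem IsRun.mixed_le [IsProbabilityMeasure μ] (S : IsRun I M m δ T μ) {t : ℕ}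
    (ht : t + 1 ∈ Finset.Icc 1 T) (ω : Ω) {y : Fin J → ℝ} (h1 : ∑ j, y j = 1)
    (h0 : ∀ j, 0 ≤ y j) :
    ∑ j, y j * M.r (I.c (t + 1) ω) j
      - 1 / V K δ (t + 1) * ∑ k, I.queue (t + 1) ω k * ∑ j, y j * I.W (t + 1) ω k j
      ≤ I.meanReward M (t + 1) ω + 2 * sqrtBeta m d T t * I.sqrtWidth M (t + 1) ω
        + 2 * (I.mix M t ω / T)
        - 1 / V K δ (t + 1) * ∑ k, I.queue (t + 1) ω k * I.paid (t + 1) ω k := by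
  have e1 := mixed_le_optimistic S.reward.norm_φ S.reward.norm_θ S.reward.r_mem S.alg ht ω h1 h0
  have e2 := rHat_le_inner_add (φ := M.φ) (θ := M.θ) (c := fun s => I.c s ω)
    (A := fun s => I.A s ω) (R := fun s => I.obs M s ω) (η := fun s => I.η s ω) (T := T)
    (t := t + 1) S.reward.norm_θ (fun s _ => rfl) (S.reward.r_mem _ _).1
  have e3 := noise_excess_le (c := fun s => I.c s ω) (A := fun s => I.A s ω)
    (η := fun s => I.η s ω) S.reward.norm_φ S.d_pos (IsRun.T_pos_of_mem ht) t
  simp only [Nat.add_sub_cancel] at e1 e2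
  unfold Interaction.optimistic Interaction.selfNorm at e1
  unfold Interaction.meanReward Interaction.sqrtWidth Interaction.mix Interaction.paid
  change _ ≤ M.r (I.c (t + 1) ω) (I.A (t + 1) ω) + _ + _ at e2
  linarith

/-- Expectation of the pathwise comparison. It is needed twice: for the competing feasible point and
for the Slater point. -/
theorem IsRun.value_sub_le [IsProbabilityMeasure μ] (S : IsRun I M m δ T μ) {t : ℕ}
    (ht : t + 1 ∈ Finset.Icc 1 T) {y : C → Fin J → ℝ} (hy : M.Feasible y) :
    M.value y - 1 / V K δ (t + 1) * ∑ k, (∫ ω, I.queue (t + 1) ω k ∂μ) * M.cost k y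
      ≤ ∫ ω, I.meanReward M (t + 1) ω ∂μ
        + 2 * sqrtBeta m d T t * ∫ ω, I.sqrtWidth M (t + 1) ω ∂μ + 2 / T
        - 1 / V K δ (t + 1) * ∑ k, ∫ ω, I.queue (t + 1) ω k * I.paid (t + 1) ω k ∂μ := by
  have ht' := Finset.mem_Icc.1 ht
  have hT : (0 : ℝ) < T := by exact_mod_cast IsRun.T_pos_of_mem ht
  have i1 := integrable_mixed_reward S.gen S.reward.r_mem ht hy
  have i2 : ∀ k, Integrable (fun ω => I.queue (t + 1) ω k
      * ∑ j, y (I.c (t + 1) ω) j * I.W (t + 1) ω k j) μ := fun k =>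
    integrable_mul_mixed_cost S.gen S.cost ht hy k (S.integrable_queue (by omega) k)
  have i2' := (integrable_finsetSum Finset.univ fun k _ => i2 k).const_mul (1 / V K δ (t + 1))
  have i3 := S.integrable_meanReward ht
  have i4 := (S.integrable_sqrtWidth ht).const_mul (2 * sqrtBeta m d T t)
  have i5 := ((integrable_mix S.gen S.reward.noise (by omega : t ≤ T)).div_const
    (T : ℝ)).const_mul 2
  have i6 := (integrable_finsetSum Finset.univ fun k _ =>
    S.integrable_queue_mul_paid ht k).const_mul (1 / V K δ (t + 1))
  have i34 : Integrable (fun ω => I.meanReward M (t + 1) ω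
      + 2 * sqrtBeta m d T t * I.sqrtWidth M (t + 1) ω) μ := i3.add i4
  have i345 : Integrable (fun ω => I.meanReward M (t + 1) ω
      + 2 * sqrtBeta m d T t * I.sqrtWidth M (t + 1) ω + 2 * (I.mix M t ω / T)) μ := i34.add i5
  have h := integral_mono (i1.sub i2') (i345.sub i6)
    fun ω => S.mixed_le ht ω (hy.1 (I.c (t + 1) ω)) (hy.2.1 _)
  simp only [Pi.sub_apply] at h
  rw [integral_sub i1 i2', integral_sub i345 i6, integral_add i34 i5,
    integral_add i3 i4, integral_const_mul, integral_const_mul, integral_const_mul,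
    integral_const_mul, integral_div, integral_finsetSum _ fun k _ => i2 k,
    integral_finsetSum _ fun k _ => S.integrable_queue_mul_paid ht k,
    integral_mixed_reward S.gen S.reward.r_mem ht hy,
    Finset.sum_congr rfl fun k _ => integral_mul_mixed_cost S.gen S.cost ht hy k
      (I.measurable_queue_history M (t + 1) k)] at h
  have hmix : 2 * ((∫ ω, I.mix M t ω ∂μ) / T) ≤ 2 / T := by
    rw [← mul_div_assoc]
    gcongr
    linarith [integral_mix_le_one S.gen S.reward.noise (by omega : t ≤ T)]
  linarith

/-- The total squared length of the dual variables. -/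
def Interaction.queueSq (I : Interaction Ω C J K) (t : ℕ) (ω : Ω) : ℝ := ∑ k, I.queue t ω k ^ 2

omit [Countable C] [MeasurableSpace C] [MeasurableSingletonClass C] in
theorem Interaction.queueSq_succ_le (I : Interaction Ω C J K) {t : ℕ} (ht : 1 ≤ t) {ω : Ω}
    (hW : ∀ k j, |I.W t ω k j| ≤ 1) :
    I.queueSq (t + 1) ω ≤ I.queueSq t ω + 2 * ∑ k, I.queue t ω k * I.paid t ω k
      + 2 * eps K t * ∑ k, I.queue t ω k + K * (1 + eps K t) ^ 2 :=
  sum_sq_Q_succ_le ht fun k => hW k _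

theorem IsRun.integral_queueSq_succ_le [IsProbabilityMeasure μ] (S : IsRun I M m δ T μ) {t : ℕ}
    (ht : t + 1 ∈ Finset.Icc 1 T) :
    ∫ ω, I.queueSq (t + 1 + 1) ω ∂μ ≤ ∫ ω, I.queueSq (t + 1) ω ∂μ
      + 2 * ∑ k, ∫ ω, I.queue (t + 1) ω k * I.paid (t + 1) ω k ∂μ
      + 2 * eps K (t + 1) * ∑ k, ∫ ω, I.queue (t + 1) ω k ∂μ + K * (1 + eps K (t + 1)) ^ 2 := by
  have ht' := Finset.mem_Icc.1 ht
  have i1 : ∀ {s}, s ≤ T → Integrable (I.queueSq (s + 1)) μ := fun hs =>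
    integrable_finsetSum _ fun k _ => S.integrable_queue_sq hs k
  have i2 := (integrable_finsetSum Finset.univ fun k _ =>
    S.integrable_queue_mul_paid ht k).const_mul 2
  have i3 := (integrable_finsetSum Finset.univ fun k _ =>
    S.integrable_queue (by omega : t ≤ T) k).const_mul (2 * eps K (t + 1))
  have i12 : Integrable (fun ω => I.queueSq (t + 1) ω
      + 2 * ∑ k, I.queue (t + 1) ω k * I.paid (t + 1) ω k) μ := (i1 (by omega)).add i2
  have i123 : Integrable (fun ω => I.queueSq (t + 1) ω
      + 2 * ∑ k, I.queue (t + 1) ω k * I.paid (t + 1) ω k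
      + 2 * eps K (t + 1) * ∑ k, I.queue (t + 1) ω k) μ := i12.add i3
  have h := integral_mono_ae (i1 ht'.2) (i123.add (integrable_const (K * (1 + eps K (t + 1)) ^ 2)))
    (by
      filter_upwards [S.ae_abs_W_le] with ω hω
      exact I.queueSq_succ_le (by omega) (hω _ ht))
  simp only [Pi.add_apply] at h
  rwa [integral_add i123 (integrable_const _), integral_add i12 i3, integral_add (i1 (by omega)) i2,
    integral_const_mul, integral_const_mul, integral_finsetSum _ fun k _ =>
    S.integrable_queue_mul_paid ht k, integral_finsetSum _ fun k _ =>
    S.integrable_queue (by omega : t ≤ T) k, integral_const, probReal_univ, one_smul] at h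

theorem IsRun.sum_integral_queue_le [IsProbabilityMeasure μ] (S : IsRun I M m δ T μ) {t : ℕ}
    (ht : t ≤ T) : ∑ k, ∫ ω, I.queue (t + 1) ω k ∂μ ≤ K * queueBound K t := by
  calc _ ≤ ∑ k : Fin K, queueBound K t := by
        refine Finset.sum_le_sum fun k _ => ?_
        calc _ ≤ ∫ _, queueBound K t ∂μ := by
              refine integral_mono_ae (S.integrable_queue ht k) (integrable_const _) ?_
              filter_upwards [S.ae_queue_le ht] with ω hω
              exact hω k
          _ = _ := by simp
    _ = _ := by simp

/-- The expected regret of a single round against a feasible point. -/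
theorem IsRun.value_le [IsProbabilityMeasure μ] (S : IsRun I M m δ T μ) (hslater : M.Slater δ)
    {t : ℕ} (ht : t ∈ Finset.Icc 1 T) {y : C → Fin J → ℝ} (hy : M.Feasible y) :
    M.value y ≤ ∫ ω, I.meanReward M t ω ∂μ
      + 2 * sqrtBeta m d T (t - 1) * ∫ ω, I.sqrtWidth M t ω ∂μ + 2 / T
      + 1 / (2 * V K δ t) * (∫ ω, I.queueSq t ω ∂μ - ∫ ω, I.queueSq (t + 1) ω ∂μ)
      + (eps K t / δ + max (eps K t - δ) 0 * (K / V K δ t) * (t + 2 * slackScale K * √t)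
        + K / V K δ t * (2 + 2 / 3 * eps K t ^ 2)) := by
  obtain ⟨z, hz, hzδ⟩ := hslater
  obtain ⟨s, rfl⟩ : ∃ s, t = s + 1 := ⟨t - 1, by have := Finset.mem_Icc.1 ht; omega⟩
  have ht' := Finset.mem_Icc.1 ht
  have hδ := S.δ_pos
  have hV := V_pos S.K_pos hδ ht'.1
  have hv0 : 0 < 1 / V K δ (s + 1) := by positivity
  have h1 := S.value_sub_le ht hy
  have h2 := S.value_sub_le ht hz
  have h3 := S.integral_queueSq_succ_le ht
  have h4 := S.sum_integral_queue_le (by omega : s ≤ T)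
  have h5 := (value_mem_Icc S.gen S.reward.r_mem ht hy).2
  have h6 := (value_mem_Icc S.gen S.reward.r_mem ht hz).1
  have hq0 : ∀ k, 0 ≤ ∫ ω, I.queue (s + 1) ω k ∂μ := fun k =>
    integral_nonneg fun ω => I.queue_nonneg _ _ _
  have hε := eps_nonneg K (s + 1)
  have hy' : ∑ k, (∫ ω, I.queue (s + 1) ω k ∂μ) * M.cost k y ≤ 0 :=
    Finset.sum_nonpos fun k _ => mul_nonpos_of_nonneg_of_nonpos (hq0 k) (hy.2.2 k)
  have hz' : ∑ k, (∫ ω, I.queue (s + 1) ω k ∂μ) * M.cost k z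
      ≤ -δ * ∑ k, ∫ ω, I.queue (s + 1) ω k ∂μ := by
    rw [Finset.mul_sum]
    refine Finset.sum_le_sum fun k _ => ?_
    nlinarith [mul_le_mul_of_nonneg_left (hzδ k) (hq0 k)]
  have hq1 : 0 ≤ ∑ k, ∫ ω, I.queue (s + 1) ω k ∂μ := Finset.sum_nonneg fun k _ => hq0 k
  have hqb : ∑ k, ∫ ω, I.queue (s + 1) ω k ∂μ
      ≤ K * (((s + 1 : ℕ) : ℝ) + 2 * slackScale K * √((s + 1 : ℕ) : ℝ)) := by
    refine h4.trans (mul_le_mul_of_nonneg_left ?_ K.cast_nonneg)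
    have hκ := slackScale_nonneg K
    have hss : (s : ℝ) ≤ ((s + 1 : ℕ) : ℝ) := by push_cast; linarith
    unfold queueBound
    gcongr
  simp only [Nat.add_sub_cancel]
  generalize ∑ k, (∫ ω, I.queue (s + 1) ω k ∂μ) * M.cost k y = cy at *
  generalize ∑ k, (∫ ω, I.queue (s + 1) ω k ∂μ) * M.cost k z = cz at *
  generalize ∑ k, ∫ ω, I.queue (s + 1) ω k ∂μ = q at *
  generalize ∑ k, ∫ ω, I.queue (s + 1) ω k * I.paid (s + 1) ω k ∂μ = p at *
  generalize ∫ ω, I.meanReward M (s + 1) ω ∂μ = r at *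
  generalize 2 * sqrtBeta m d T s * ∫ ω, I.sqrtWidth M (s + 1) ω ∂μ = w at *
  generalize (2 : ℝ) / T = l at *
  generalize ∫ ω, I.queueSq (s + 1) ω ∂μ = a at *
  generalize ∫ ω, I.queueSq (s + 1 + 1) ω ∂μ = b at *
  generalize ((s + 1 : ℕ) : ℝ) + 2 * slackScale K * √((s + 1 : ℕ) : ℝ) = B at *
  generalize M.value y = vy at *
  generalize M.value z = vz at *
  generalize eps K (s + 1) = ε at *
  have e1 : 1 / (2 * V K δ (s + 1)) = 1 / V K δ (s + 1) / 2 := by field_simp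
  have e2 : (K : ℝ) / V K δ (s + 1) = K * (1 / V K δ (s + 1)) := by ring
  rw [e1, e2]
  generalize 1 / V K δ (s + 1) = v at *
  -- The weight of the Slater point: its gain θδ cancels ε in the coefficient of ∑ Q as far as θ ≤ 1
  -- permits, leaving (ε - δ)⁺.
  set θ := min 1 (ε / δ) with hθ
  have hθ0 : 0 ≤ θ := le_min zero_le_one (by positivity)
  have hθ1 : θ ≤ 1 := min_le_left _ _
  have hθ2 : θ ≤ ε / δ := min_le_right _ _
  have hθ3 : ε - θ * δ = max (ε - δ) 0 := by
    rw [hθ]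
    rcases le_total (ε / δ) 1 with h | h
    · rw [min_eq_right h, div_mul_cancel₀ _ hδ.ne', sub_self, max_eq_right]
      rw [div_le_one hδ] at h
      linarith
    · rw [min_eq_left h, one_mul, max_eq_left]
      rw [one_le_div hδ] at h
      linarith
  have g1 : vy ≤ r + w + l - v * p := by nlinarith
  have g2 : vz + v * (δ * q) ≤ r + w + l - v * p := by nlinarith
  have g3 : (1 - θ) * vy + θ * (v * (δ * q)) ≤ r + w + l - v * p := by
    have f1 := mul_le_mul_of_nonneg_left g1 (sub_nonneg.2 hθ1)
    have f2 := mul_le_mul_of_nonneg_left g2 hθ0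
    nlinarith
  -- The price of mixing is at most θ ≤ ε/δ, since values are at most 1; the reward of the Slater
  -- point was dropped as nonnegative.
  have g4 : vy - θ ≤ (1 - θ) * vy := by nlinarith
  have g5 : v * b ≤ v * (a + 2 * p + 2 * ε * q + K * (1 + ε) ^ 2) :=
    mul_le_mul_of_nonneg_left h3 hv0.le
  have g6 : v * ((ε - θ * δ) * q) ≤ max (ε - δ) 0 * (K * v) * B := by
    rw [hθ3]
    calc _ = (v * max (ε - δ) 0) * q := by ring
      _ ≤ (v * max (ε - δ) 0) * (K * B) := mul_le_mul_of_nonneg_left hqb (by positivity)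
      _ = _ := by ring
  -- The difference of the two sides is Kv(ε - 3)²/6. The constant 2 fixes the leading term of the
  -- regret; the ε² part is summable after division by V_t.
  have g7 : (K * v) * ((1 + ε) ^ 2 / 2) ≤ (K * v) * (2 + 2 / 3 * ε ^ 2) := by
    refine mul_le_mul_of_nonneg_left ?_ (by positivity)
    nlinarith [sq_nonneg (ε - 3)]
  linarith

end Regret

/-! ### Summation to the regret bound -/

section RegretBound

variable {Ω C : Type*} {mΩ : MeasurableSpace Ω} {μ : Measure Ω} [Countable C] [MeasurableSpace C]
  [MeasurableSingletonClass C] {d J K T : ℕ} {M : Model C d J K} {I : Interaction Ω C J K}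
  {m δ : ℝ}

theorem IsRun.integral_reward [IsProbabilityMeasure μ] (S : IsRun I M m δ T μ) {τ : ℕ}
    (hτT : τ ≤ T) : ∫ ω, ∑ t ∈ Finset.Icc 1 τ, ∑ j, I.R M t ω j * I.X t ω j ∂μ =
      ∑ t ∈ Finset.Icc 1 τ, ∫ ω, I.meanReward M t ω ∂μ := by
  have h : ∀ t ω, ∑ j, I.R M t ω j * I.X t ω j = I.meanReward M t ω + I.η t ω := by
    intro t ω
    simp [Interaction.X, Interaction.R, Interaction.meanReward]
  have hm : ∀ t ∈ Finset.Icc 1 τ, t ∈ Finset.Icc 1 T := fun t ht =>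
    Finset.Icc_subset_Icc_right hτT ht
  simp only [h]
  have hi : ∀ t ∈ Finset.Icc 1 τ, Integrable (fun ω => I.meanReward M t ω + I.η t ω) μ :=
    fun t ht => (S.integrable_meanReward (hm t ht)).add (S.reward.noise t (hm t ht)).1
  rw [integral_finsetSum _ hi]
  refine Finset.sum_congr rfl fun t ht => ?_
  rw [integral_add (S.integrable_meanReward (hm t ht)) (S.reward.noise t (hm t ht)).1,
    integral_noise_eq_zero S.gen (hm t ht) (S.reward.noise t (hm t ht)), add_zero]

theorem IsRun.sum_integral_sqrtWidth_le [IsProbabilityMeasure μ] (S : IsRun I M m δ T μ) {τ : ℕ}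
    (hτT : τ ≤ T) : ∑ t ∈ Finset.Icc 1 τ, ∫ ω, I.sqrtWidth M t ω ∂μ
      ≤ √(τ * (2 * d * Real.log (1 + τ / d))) := by
  have hi : ∀ t ∈ Finset.Icc 1 τ, Integrable (I.sqrtWidth M t) μ := fun t ht =>
    S.integrable_sqrtWidth (Finset.Icc_subset_Icc_right hτT ht)
  rw [← integral_finsetSum _ hi]
  calc _ ≤ ∫ _, √(τ * (2 * d * Real.log (1 + τ / d)) : ℝ) ∂μ :=
        integral_mono (integrable_finsetSum _ hi) (integrable_const _) fun ω =>
          sum_sqrt_width_le _ _ S.reward.norm_φ S.d_pos τ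
    _ = _ := by simp

theorem IsRun.regret_le [IsProbabilityMeasure μ] (S : IsRun I M m δ T μ) (hδ1 : δ ≤ 1)
    (hslater : M.Slater δ) {τ : ℕ} (hτ : 1 ≤ τ) (hτT : τ ≤ T) :
    I.regret M μ τ ≤
        60 * (K : ℝ) ^ 3 / δ ^ 3 + 4 * √6 * (K : ℝ) ^ (3 / 4 : ℝ) * √τ / δ + 2
          + √(8 * d * τ * sqrtBeta m d T τ ^ 2 * Real.log ((d + τ) / d)) := by
  have hτ0 : (0 : ℝ) < τ := by exact_mod_cast hτ
  have hd0 : (0 : ℝ) < d := by exact_mod_cast S.d_pos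
  have hβ : 0 ≤ sqrtBeta m d T τ :=
    add_nonneg ((norm_nonneg _).trans S.reward.norm_θ) (Real.sqrt_nonneg _)
  set B := 60 * (K : ℝ) ^ 3 / δ ^ 3 + 4 * √6 * (K : ℝ) ^ (3 / 4 : ℝ) * √τ / δ + 2
    + √(8 * d * τ * sqrtBeta m d T τ ^ 2 * Real.log ((d + τ) / d)) with hB
  set r := ∑ t ∈ Finset.Icc 1 τ, ∫ ω, I.meanReward M t ω ∂μ with hr
  have hmem : ∀ t ∈ Finset.Icc 1 τ, t ∈ Finset.Icc 1 T := fun t ht =>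
    Finset.Icc_subset_Icc_right hτT ht
  -- The optimum need not be attained, so every feasible point is bounded and the supremum is taken
  -- at the end.
  have key : ∀ y, M.Feasible y → τ * M.value y ≤ r + B := by
    intro y hy
    have h0 : ∀ t ∈ Finset.Icc 1 τ, M.value y ≤ ∫ ω, I.meanReward M t ω ∂μ
        + 2 * sqrtBeta m d T τ * ∫ ω, I.sqrtWidth M t ω ∂μ + 2 / τ
        + 1 / (2 * V K δ t) * (∫ ω, I.queueSq t ω ∂μ - ∫ ω, I.queueSq (t + 1) ω ∂μ)
        + (eps K t / δ + max (eps K t - δ) 0 * (K / V K δ t) * (t + 2 * slackScale K * √t)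
          + K / V K δ t * (2 + 2 / 3 * eps K t ^ 2)) := by
      intro t ht
      have ht' := Finset.mem_Icc.1 ht
      refine (S.value_le hslater (hmem t ht) hy).trans ?_
      have h1 : 0 ≤ ∫ ω, I.sqrtWidth M t ω ∂μ := integral_nonneg fun ω => Real.sqrt_nonneg _
      have h2 : sqrtBeta m d T (t - 1) ≤ sqrtBeta m d T τ := sqrtBeta_mono m d T (by omega)
      have h3 : (τ : ℝ) ≤ T := by exact_mod_cast hτT
      gcongr
    have h1 := Finset.sum_le_sum h0
    simp only [Finset.sum_add_distrib (s := Finset.Icc 1 τ), Finset.sum_const, Nat.card_Icc,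
      Nat.add_sub_cancel, nsmul_eq_mul, ← Finset.mul_sum] at h1
    have h2 := regret_terms_le S.K_pos S.δ_pos hδ1 τ
    simp only [Finset.sum_add_distrib] at h2
    -- The weights 1/(2V_t) decrease and Q(1) = 0, so the ‖Q‖² terms contribute nothing positive.
    have h3 := sum_mul_sub_succ_nonpos (a := fun t => ∫ ω, I.queueSq t ω ∂μ)
      (v := fun t => 1 / (2 * V K δ t))
      (fun t => integral_nonneg fun ω => Finset.sum_nonneg fun k _ => sq_nonneg _)
      (by simp [Interaction.queueSq, Interaction.queue, Q_one])
      (fun t ht => by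
        have := V_pos S.K_pos S.δ_pos ht
        have := V_mono (K := K) S.δ_pos (Nat.le_succ t)
        gcongr)
      (fun t ht => by
        have := V_pos S.K_pos S.δ_pos ht
        positivity) τ
    have h4 := mul_le_mul_of_nonneg_left (S.sum_integral_sqrtWidth_le hτT)
      (by positivity : 0 ≤ 2 * sqrtBeta m d T τ)
    have h5 : 2 * sqrtBeta m d T τ * √(τ * (2 * d * Real.log (1 + τ / d))) =
        √(8 * d * τ * sqrtBeta m d T τ ^ 2 * Real.log ((d + τ) / d)) := by
      have e : 8 * d * τ * sqrtBeta m d T τ ^ 2 * Real.log ((d + τ) / d) =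
          (2 * sqrtBeta m d T τ) ^ 2 * (τ * (2 * d * Real.log (1 + τ / d))) := by
        rw [add_div, div_self hd0.ne']
        ring
      rw [e, Real.sqrt_mul (sq_nonneg _), Real.sqrt_sq (by positivity)]
    have h6 : (τ : ℝ) * (2 / τ) = 2 := by field_simp
    rw [h5] at h4
    linarith
  have hopt : M.optValue ≤ (r + B) / τ := by
    obtain ⟨z, hz, -⟩ := hslater
    refine csSup_le ⟨_, z, hz, rfl⟩ ?_
    rintro _ ⟨y, hy, rfl⟩
    rw [le_div_iff₀ hτ0, mul_comm]
    exact key y hy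
  rw [le_div_iff₀ hτ0] at hopt
  rw [Interaction.regret, S.integral_reward hτT]
  linarith

end RegretBound

/-! ### Exponential Lyapunov drift of the dual variables -/

section Violation

variable {Ω C : Type*} {mΩ : MeasurableSpace Ω} {μ : Measure Ω} [Countable C] [MeasurableSpace C]
  [MeasurableSingletonClass C] {d J K T : ℕ} {M : Model C d J K} {I : Interaction Ω C J K}
  {m δ : ℝ}

/-- The Euclidean norm of the dual variables. -/
def Interaction.queueNorm (I : Interaction Ω C J K) (t : ℕ) (ω : Ω) : ℝ := √(I.queueSq t ω)

omit [Countable C] [MeasurableSpace C] [MeasurableSingletonClass C] in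
theorem Interaction.queueSq_nonneg (I : Interaction Ω C J K) (t : ℕ) (ω : Ω) :
    0 ≤ I.queueSq t ω := Finset.sum_nonneg fun _ _ => sq_nonneg _

omit [Countable C] [MeasurableSpace C] [MeasurableSingletonClass C] in
theorem Interaction.queueNorm_nonneg (I : Interaction Ω C J K) (t : ℕ) (ω : Ω) :
    0 ≤ I.queueNorm t ω := Real.sqrt_nonneg _

omit [Countable C] [MeasurableSpace C] [MeasurableSingletonClass C] in
theorem Interaction.queueNorm_sq (I : Interaction Ω C J K) (t : ℕ) (ω : Ω) :
    I.queueNorm t ω ^ 2 = I.queueSq t ω := Real.sq_sqrt (I.queueSq_nonneg t ω)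

omit [Countable C] [MeasurableSpace C] [MeasurableSingletonClass C] in
theorem Interaction.queue_le_queueNorm (I : Interaction Ω C J K) (t : ℕ) (ω : Ω) (k : Fin K) :
    I.queue t ω k ≤ I.queueNorm t ω := by
  apply Real.le_sqrt_of_sq_le
  exact Finset.single_le_sum (f := fun k => I.queue t ω k ^ 2) (fun _ _ => sq_nonneg _)
    (Finset.mem_univ k)

omit [Countable C] [MeasurableSpace C] [MeasurableSingletonClass C] in
-- Converts the Slater gain, proportional to ∑ Q, into a drift proportional to ‖Q‖.
theorem Interaction.queueNorm_le_sum (I : Interaction Ω C J K) (t : ℕ) (ω : Ω) :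
    I.queueNorm t ω ≤ ∑ k, I.queue t ω k := by
  rw [Interaction.queueNorm, Real.sqrt_le_left
    (Finset.sum_nonneg fun k _ => I.queue_nonneg t ω k), Interaction.queueSq]
  exact Finset.sum_sq_le_sq_sum_of_nonneg fun k _ => I.queue_nonneg t ω k

omit [Countable C] [MeasurableSpace C] [MeasurableSingletonClass C] in
theorem Interaction.queueNorm_le (I : Interaction Ω C J K) (t : ℕ) (ω : Ω) {b : ℝ} (hb : 0 ≤ b)
    (h : ∀ k, I.queue t ω k ≤ b) : I.queueNorm t ω ≤ √K * b := by
  rw [Interaction.queueNorm, Real.sqrt_le_left (by positivity), mul_pow,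
    Real.sq_sqrt K.cast_nonneg]
  calc I.queueSq t ω ≤ ∑ k : Fin K, b ^ 2 := Finset.sum_le_sum fun k _ =>
        pow_le_pow_left₀ (I.queue_nonneg t ω k) (h k) 2
    _ = K * b ^ 2 := by simp

omit [Countable C] [MeasurableSpace C] [MeasurableSingletonClass C] in
theorem Interaction.abs_queueNorm_succ_sub_le (I : Interaction Ω C J K) {t : ℕ} (ht : 1 ≤ t)
    {ω : Ω} (hW : ∀ k j, |I.W t ω k j| ≤ 1) :
    |I.queueNorm (t + 1) ω - I.queueNorm t ω| ≤ √K * (1 + eps K t) := by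
  have hn : ∀ s, I.queueNorm s ω = ‖WithLp.toLp 2 (I.queue s ω)‖ := by
    intro s
    rw [EuclideanSpace.norm_eq, Interaction.queueNorm, Interaction.queueSq]
    simp
  have he := eps_nonneg K t
  rw [hn, hn]
  refine (abs_norm_sub_norm_le _ _).trans ?_
  rw [EuclideanSpace.norm_eq, Real.sqrt_le_left (by positivity), mul_pow,
    Real.sq_sqrt K.cast_nonneg]
  calc _ ≤ ∑ k : Fin K, (1 + eps K t) ^ 2 := Finset.sum_le_sum fun k _ =>
        pow_le_pow_left₀ (norm_nonneg _) (abs_Q_succ_sub_le ht k (hW k _)) 2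
    _ = K * (1 + eps K t) ^ 2 := by simp

omit [Countable C] [MeasurableSingletonClass C] in
theorem Interaction.measurable_queueNorm (I : Interaction Ω C J K) (M : Model C d J K) (t : ℕ) :
    Measurable[I.history M (t - 1)] (I.queueNorm t) :=
  (Finset.measurable_sum _ fun k _ => (I.measurable_queue_history M t k).pow_const 2).sqrt

/-- The exponential rate of the Lyapunov function `exp (expRate * ‖Q‖)`. -/
def expRate (K : ℕ) (δ : ℝ) : ℝ := δ / (18 * K)

/-- The contraction of the Lyapunov function in a round is by the factor `1 - contraction`. -/
def contraction (K : ℕ) (δ : ℝ) : ℝ := δ ^ 2 / (144 * K)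

/-- The size of the dual variables above which they have negative drift in round `t`. -/
def driftThreshold (K : ℕ) (δ : ℝ) (t : ℕ) : ℝ := 4 * (V K δ t + 9 / 8 * K) / δ

/-- A bound on the size of the dual variables as long as `ε_t > δ / 2`. -/
def initialBound (K : ℕ) (δ : ℝ) : ℝ := √K * (24 * (K : ℝ) ^ (3 / 2 : ℝ) * (1 / δ ^ 2 + 1 / δ))

/-- The bound on the exponent of the Lyapunov function. -/
def driftLevel (K : ℕ) (δ : ℝ) (t : ℕ) : ℝ :=
  initialBound K δ + 3 / 2 * √K + driftThreshold K δ t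

theorem expRate_pos (hK : 0 < K) (hδ : 0 < δ) : 0 < expRate K δ := by
  have : (0 : ℝ) < K := by exact_mod_cast hK
  unfold expRate
  positivity

theorem contraction_pos (hK : 0 < K) (hδ : 0 < δ) : 0 < contraction K δ := by
  have : (0 : ℝ) < K := by exact_mod_cast hK
  unfold contraction
  positivity

theorem contraction_le_one (hK : 0 < K) (hδ : 0 < δ) (hδ1 : δ ≤ 1) : contraction K δ ≤ 1 := by
  have : (1 : ℝ) ≤ K := by exact_mod_cast hK
  rw [contraction, div_le_one (by positivity)]
  nlinarith

theorem initialBound_nonneg (hδ : 0 < δ) : 0 ≤ initialBound K δ := by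
  unfold initialBound
  positivity

theorem driftThreshold_pos (hK : 0 < K) (hδ : 0 < δ) (t : ℕ) : 0 < driftThreshold K δ t := by
  have h1 : (0 : ℝ) < K := by exact_mod_cast hK
  have h2 : 0 ≤ V K δ t := by unfold V; positivity
  unfold driftThreshold
  positivity

theorem driftThreshold_mono (hδ : 0 < δ) {s t : ℕ} (h : s ≤ t) :
    driftThreshold K δ s ≤ driftThreshold K δ t := by
  have := V_mono (K := K) hδ h
  unfold driftThreshold
  gcongr

/-- ε_t > δ/2 means √t < 2κ/δ. In these rounds the slack may defeat the Slater gain, but `Q` has had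
no time to grow. -/
theorem sqrt_mul_queueBound_le (hδ : 0 < δ) {t : ℕ} (ht : 1 ≤ t) (hε : δ / 2 < eps K t) :
    √K * queueBound K t ≤ initialBound K δ := by
  have h0 : 0 < √(t : ℝ) := Real.sqrt_pos.2 (by exact_mod_cast ht)
  have hκ := slackScale_nonneg K
  rw [eps_eq, lt_div_iff₀ h0] at hε
  have h1 : √(t : ℝ) ≤ 2 * slackScale K / δ := by
    rw [le_div_iff₀ hδ]
    linarith
  have h2 : (t : ℝ) = √(t : ℝ) ^ 2 := (Real.sq_sqrt t.cast_nonneg).symm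
  refine mul_le_mul_of_nonneg_left ?_ (Real.sqrt_nonneg _)
  have h3 : 24 * (K : ℝ) ^ (3 / 2 : ℝ) * (1 / δ ^ 2 + 1 / δ) =
      (2 * slackScale K / δ) ^ 2 + 2 * slackScale K * (2 * slackScale K / δ) := by
    have := slackScale_sq K
    have e : 24 * (K : ℝ) ^ (3 / 2 : ℝ) = 4 * slackScale K ^ 2 := by linarith
    rw [e]
    ring
  rw [h3, queueBound, h2, Real.sqrt_sq h0.le]
  gcongr

omit [Countable C] [MeasurableSingletonClass C] in
/-- On the tame event the cost paid, weighted by the dual variables, exceeds that of any mixed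
action by at most `V_t`. -/
theorem IsRun.sum_queue_mul_paid_le (S : IsRun I M m δ T μ) {t : ℕ}
    (ht : t + 1 ∈ Finset.Icc 1 T) {ω : Ω} (hω : ω ∈ I.tame M T t) {y : Fin J → ℝ}
    (h1 : ∑ j, y j = 1) (h0 : ∀ j, 0 ≤ y j) :
    ∑ k, I.queue (t + 1) ω k * I.paid (t + 1) ω k ≤ V K δ (t + 1)
      + ∑ k, I.queue (t + 1) ω k * ∑ j, y j * I.W (t + 1) ω k j := by
  have e1 := mixed_le_optimistic S.reward.norm_φ S.reward.norm_θ S.reward.r_mem S.alg ht ω h1 h0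
  have e2 : I.selfNorm M t ω ≤ noiseRadius d T t :=
    selfNorm_le_of_mixture_le S.reward.norm_φ S.d_pos (IsRun.T_pos_of_mem ht) t (hω t le_rfl)
  have e3 : I.optimistic M m T (t + 1) ω ≤ 1 := rHat_le_one _ _
  have e4 : 0 ≤ ∑ j, y j * M.r (I.c (t + 1) ω) j := Finset.sum_nonneg fun j _ =>
    mul_nonneg (h0 j) (S.reward.r_mem _ j).1
  have hV := V_pos S.K_pos S.δ_pos (Finset.mem_Icc.1 ht).1
  simp only [Nat.add_sub_cancel] at e1
  rw [max_eq_right (by linarith)] at e1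
  change _ ≤ _ - 1 / V K δ (t + 1) * ∑ k, I.queue (t + 1) ω k * I.paid (t + 1) ω k at e1
  generalize ∑ k, I.queue (t + 1) ω k * I.paid (t + 1) ω k = p at *
  generalize ∑ k, I.queue (t + 1) ω k * ∑ j, y j * I.W (t + 1) ω k j = u at *
  have e5 : 1 / V K δ (t + 1) * (p - u) ≤ 1 := by linarith
  rw [one_div_mul_eq_div, div_le_one hV] at e5
  linarith

omit [Countable C] [MeasurableSingletonClass C] in
/-- One step of the Lyapunov function above the threshold, before taking expectations. -/
theorem IsRun.exp_queueNorm_succ_le (S : IsRun I M m δ T μ) (hδ1 : δ ≤ 1) {t : ℕ}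
    (ht : t + 1 ∈ Finset.Icc 1 T) (hε : eps K (t + 1) ≤ δ / 2) {ω : Ω}
    (hW : ∀ k j, |I.W (t + 1) ω k j| ≤ 1) (hω : ω ∈ I.tame M T t)
    (hq : driftThreshold K δ (t + 1) ≤ I.queueNorm (t + 1) ω) {y : Fin J → ℝ}
    (h1 : ∑ j, y j = 1) (h0 : ∀ j, 0 ≤ y j) :
    Real.exp (expRate K δ * I.queueNorm (t + 1 + 1) ω) ≤
      Real.exp (expRate K δ * I.queueNorm (t + 1) ω)
        * (1 + contraction K δ + expRate K δ * δ / 4)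
      + expRate K δ * (Real.exp (expRate K δ * I.queueNorm (t + 1) ω) / I.queueNorm (t + 1) ω)
        * (∑ k, I.queue (t + 1) ω k * ∑ j, y j * I.W (t + 1) ω k j
          + δ / 2 * ∑ k, I.queue (t + 1) ω k) := by
  have hK : (1 : ℝ) ≤ K := by exact_mod_cast S.K_pos
  have hδ := S.δ_pos
  have hr := expRate_pos S.K_pos hδ
  have hq0 : 0 < I.queueNorm (t + 1) ω := (driftThreshold_pos S.K_pos hδ _).trans_le hq
  have hεn := eps_nonneg K (t + 1)
  have hd := I.queueSq_succ_le (t := t + 1) (by omega) hW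
  have hp := S.sum_queue_mul_paid_le ht hω h1 h0
  have hΔ := I.abs_queueNorm_succ_sub_le (t := t + 1) (by omega) hW
  rw [← I.queueNorm_sq, ← I.queueNorm_sq] at hd
  have hs0 : 0 ≤ ∑ k, I.queue (t + 1) ω k := Finset.sum_nonneg fun k _ => I.queue_nonneg _ _ _
  rw [driftThreshold, div_le_iff₀ hδ] at hq
  generalize ∑ k, I.queue (t + 1) ω k * ∑ j, y j * I.W (t + 1) ω k j = u at *
  generalize ∑ k, I.queue (t + 1) ω k * I.paid (t + 1) ω k = p at *
  generalize ∑ k, I.queue (t + 1) ω k = s at *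
  generalize I.queueNorm (t + 1 + 1) ω = b at *
  generalize I.queueNorm (t + 1) ω = a at *
  generalize eps K (t + 1) = ε at *
  generalize V K δ (t + 1) = v at *
  have hν : |b - a| ≤ 3 / 2 * √K := by
    refine hΔ.trans ?_
    rw [mul_comm]
    gcongr
    linarith
  have hsq : (b - a) ^ 2 ≤ 9 / 4 * K := by
    have := pow_le_pow_left₀ (abs_nonneg _) hν 2
    rw [sq_abs, mul_pow, Real.sq_sqrt (by linarith)] at this
    linarith
  -- 2a(b - a) ≤ b² - a², and above the threshold V + 9K/8 ≤ δa/4. The bracket averages to at most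
  -- -(δ/2)s later, as u has weighted mean at most -δs.
  have hab : a * (b - a) ≤ δ * a / 4 + (u + δ / 2 * s) := by
    have g1 : (1 + ε) ^ 2 ≤ 9 / 4 := by nlinarith
    have g2 : K * (1 + ε) ^ 2 ≤ K * (9 / 4) := mul_le_mul_of_nonneg_left g1 (by linarith)
    have g3 : ε * s ≤ δ / 2 * s := mul_le_mul_of_nonneg_right hε hs0
    nlinarith [sq_nonneg (b - a)]
  -- Needed for exp x ≤ 1 + x + x².
  have hra : |expRate K δ * (b - a)| ≤ 1 := by
    rw [abs_mul, abs_of_pos hr, expRate]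
    have hsK : √(K : ℝ) ≤ K := by
      rw [Real.sqrt_le_left (by linarith)]
      nlinarith
    calc δ / (18 * K) * |b - a| ≤ 1 / (18 * K) * (3 / 2 * K) := by
          gcongr
          exact hν.trans (by linarith)
      _ ≤ 1 := by
          field_simp
          norm_num
  -- With r = `expRate`, r²·(9/4)K is exactly `contraction`; this r minimizes -rδ/4 + r²·(9/4)K.
  have hexp : Real.exp (expRate K δ * (b - a)) ≤
      1 + expRate K δ * (b - a) + contraction K δ := by
    have g1 := (abs_le.1 (Real.abs_exp_sub_one_sub_id_le hra)).2
    have g2 : (expRate K δ * (b - a)) ^ 2 ≤ contraction K δ := by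
      rw [mul_pow]
      calc _ ≤ expRate K δ ^ 2 * (9 / 4 * K) := mul_le_mul_of_nonneg_left hsq (sq_nonneg _)
        _ = _ := by
          rw [expRate, contraction]
          field_simp
          norm_num
    linarith
  have hb : expRate K δ * b = expRate K δ * a + expRate K δ * (b - a) := by ring
  have hdiv : b - a ≤ δ / 4 + (u + δ / 2 * s) / a := by
    have : b - a = a * (b - a) / a := by field_simp
    rw [this]
    calc _ ≤ (δ * a / 4 + (u + δ / 2 * s)) / a := by gcongr
      _ = _ := by field_simp
  rw [hb, Real.exp_add]
  calc _ ≤ Real.exp (expRate K δ * a) * (1 + expRate K δ * (δ / 4 + (u + δ / 2 * s) / a)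
        + contraction K δ) := by
        refine mul_le_mul_of_nonneg_left (hexp.trans ?_) (Real.exp_pos _).le
        gcongr
    _ = _ := by ring

omit [Countable C] [MeasurableSingletonClass C] in
-- Below the threshold no drift is available, but one step adds at most (3/2)√K to the norm.
theorem IsRun.exp_queueNorm_succ_le_of_lt (S : IsRun I M m δ T μ) (hδ1 : δ ≤ 1) {t : ℕ}
    (hε : eps K (t + 1) ≤ δ / 2) {ω : Ω} (hW : ∀ k j, |I.W (t + 1) ω k j| ≤ 1)
    (hq : I.queueNorm (t + 1) ω < driftThreshold K δ (t + 1)) :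
    Real.exp (expRate K δ * I.queueNorm (t + 1 + 1) ω) ≤
      Real.exp (expRate K δ * driftLevel K δ (t + 1)) := by
  have hr := expRate_pos S.K_pos S.δ_pos
  have hΔ := (abs_le.1 (I.abs_queueNorm_succ_sub_le (t := t + 1) (by omega) hW)).2
  have h1 : √(K : ℝ) * (1 + eps K (t + 1)) ≤ √K * (3 / 2) :=
    mul_le_mul_of_nonneg_left (by linarith) (Real.sqrt_nonneg _)
  have h2 := initialBound_nonneg (K := K) S.δ_pos
  rw [Real.exp_le_exp]
  refine mul_le_mul_of_nonneg_left ?_ hr.le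
  unfold driftLevel
  linarith

/-- The Lyapunov function, restricted to the tame event. -/
def Interaction.lyapunov (I : Interaction Ω C J K) (M : Model C d J K) (δ : ℝ) (T t : ℕ) :
    Ω → ℝ :=
  (I.tame M T t).indicator fun ω => Real.exp (expRate K δ * I.queueNorm (t + 1) ω)

omit [MeasurableSingletonClass C] in
theorem IsRun.ae_queueNorm_le (S : IsRun I M m δ T μ) {t : ℕ} (ht : t ≤ T) :
    ∀ᵐ ω ∂μ, I.queueNorm (t + 1) ω ≤ √K * queueBound K t := by
  filter_upwards [S.ae_queue_le ht] with ω hω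
  exact I.queueNorm_le _ _ (queueBound_nonneg K t) hω

theorem Interaction.measurable_lyapunov (I : Interaction Ω C J K) (M : Model C d J K) (δ : ℝ)
    (T t : ℕ) : Measurable[I.history M t] (I.lyapunov M δ T t) := by
  have h := I.measurable_queueNorm M (t + 1)
  exact ((h.const_mul (expRate K δ)).exp).indicator (I.measurableSet_tame M T t)

omit [Countable C] [MeasurableSpace C] [MeasurableSingletonClass C] in
theorem Interaction.lyapunov_nonneg (I : Interaction Ω C J K) (M : Model C d J K) (δ : ℝ)
    (T t : ℕ) (ω : Ω) : 0 ≤ I.lyapunov M δ T t ω :=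
  Set.indicator_nonneg (fun _ _ => (Real.exp_pos _).le) _

theorem IsRun.integrable_lyapunov [IsFiniteMeasure μ] (S : IsRun I M m δ T μ) {t : ℕ}
    (ht : t ≤ T) : Integrable (I.lyapunov M δ T t) μ := by
  have hr := expRate_pos S.K_pos S.δ_pos
  refine Integrable.of_bound ((I.measurable_lyapunov M δ T t).mono (S.gen.history_le ht)
    le_rfl).aestronglyMeasurable (Real.exp (expRate K δ * (√K * queueBound K t))) ?_
  filter_upwards [S.ae_queueNorm_le ht] with ω hω
  rw [Real.norm_eq_abs, abs_of_nonneg (I.lyapunov_nonneg M δ T t ω)]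
  refine (Set.indicator_le_self' (fun _ _ => (Real.exp_pos _).le) _).trans ?_
  gcongr

/-- Above the threshold the pathwise step is averaged using the Slater point; below it the Lyapunov
function is bounded outright. The tame event at time t is decided by the history, so restricting to
it keeps independence. -/
theorem IsRun.integral_lyapunov_succ_le [IsProbabilityMeasure μ] (S : IsRun I M m δ T μ)
    (hδ1 : δ ≤ 1) (hslater : M.Slater δ) {t : ℕ} (ht : t + 1 ∈ Finset.Icc 1 T)
    (hε : eps K (t + 1) ≤ δ / 2) :
    ∫ ω, I.lyapunov M δ T (t + 1) ω ∂μ ≤ Real.exp (expRate K δ * driftLevel K δ (t + 1))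
      + (1 - contraction K δ) * ∫ ω, I.lyapunov M δ T t ω ∂μ := by
  obtain ⟨z, hz, hzδ⟩ := hslater
  have ht' := Finset.mem_Icc.1 ht
  have hr := expRate_pos S.K_pos S.δ_pos
  have hδ := S.δ_pos
  have hc1 := contraction_le_one S.K_pos S.δ_pos hδ1
  have hθ := driftThreshold_pos S.K_pos S.δ_pos (t + 1)
  have hle := S.gen.history_le (by omega : t ≤ T)
  set A : Set Ω := I.tame M T t ∩ {ω | driftThreshold K δ (t + 1) ≤ I.queueNorm (t + 1) ω} with hA
  have hnm : Measurable[I.history M t] (I.queueNorm (t + 1)) := I.measurable_queueNorm M (t + 1)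
  have hAm : MeasurableSet[I.history M t] A :=
    (I.measurableSet_tame M T t).inter (measurableSet_le measurable_const hnm)
  set E : Ω → ℝ := A.indicator fun ω => Real.exp (expRate K δ * I.queueNorm (t + 1) ω) with hE
  -- The weight exp(r‖Q‖)/‖Q‖ is fixed by the history up to t, so F·Q_k factors from the costs of
  -- round t + 1 without any conditioning.
  set F : Ω → ℝ := A.indicator fun ω =>
    Real.exp (expRate K δ * I.queueNorm (t + 1) ω) / I.queueNorm (t + 1) ω with hF
  have hexpm : Measurable[I.history M t] fun ω =>
      Real.exp (expRate K δ * I.queueNorm (t + 1) ω) := (hnm.const_mul _).exp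
  have hEm : Measurable[I.history M t] E := hexpm.indicator hAm
  have hFm : Measurable[I.history M t] F := (hexpm.div hnm).indicator hAm
  have hF0 : ∀ ω, 0 ≤ F ω := fun ω => Set.indicator_nonneg
    (fun ω _ => div_nonneg (Real.exp_pos _).le (I.queueNorm_nonneg _ _)) _
  have hEF : ∀ ω, E ω = F ω * I.queueNorm (t + 1) ω := by
    intro ω
    by_cases h : ω ∈ A
    · have h0 : 0 < I.queueNorm (t + 1) ω := hθ.trans_le h.2
      simp only [hE, hF, Set.indicator_of_mem h]
      field_simp
    · simp [hE, hF, h]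
  have hEl : ∀ ω, E ω ≤ I.lyapunov M δ T t ω := fun ω =>
    Set.indicator_le_indicator_of_subset Set.inter_subset_left (fun ω => (Real.exp_pos _).le) ω
  have iE : Integrable E μ := by
    refine Integrable.mono' (S.integrable_lyapunov (by omega : t ≤ T))
      (hEm.mono hle le_rfl).aestronglyMeasurable (Filter.Eventually.of_forall fun ω => ?_)
    rw [Real.norm_eq_abs, abs_of_nonneg (Set.indicator_nonneg (fun _ _ => (Real.exp_pos _).le) _)]
    exact hEl ω
  have hGm : ∀ k, Measurable[I.history M t] fun ω => F ω * I.queue (t + 1) ω k := fun k =>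
    hFm.mul (I.measurable_queue_history M (t + 1) k)
  have iG : ∀ k, Integrable (fun ω => F ω * I.queue (t + 1) ω k) μ := by
    intro k
    refine Integrable.mono' iE ((hGm k).mono hle le_rfl).aestronglyMeasurable
      (Filter.Eventually.of_forall fun ω => ?_)
    rw [Real.norm_eq_abs, abs_of_nonneg (mul_nonneg (hF0 ω) (I.queue_nonneg _ _ _)), hEF]
    exact mul_le_mul_of_nonneg_left (I.queue_le_queueNorm _ _ _) (hF0 ω)
  have iGU : ∀ k, Integrable (fun ω => F ω * I.queue (t + 1) ω k
      * ∑ j, z (I.c (t + 1) ω) j * I.W (t + 1) ω k j) μ := fun k =>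
    integrable_mul_mixed_cost S.gen S.cost ht hz k (iG k)
  have hpt : ∀ᵐ ω ∂μ, I.lyapunov M δ T (t + 1) ω ≤
      Real.exp (expRate K δ * driftLevel K δ (t + 1))
      + (1 + contraction K δ + expRate K δ * δ / 4) * E ω
      + expRate K δ * (∑ k, F ω * I.queue (t + 1) ω k
        * ∑ j, z (I.c (t + 1) ω) j * I.W (t + 1) ω k j)
      + expRate K δ * δ / 2 * ∑ k, F ω * I.queue (t + 1) ω k := by
    filter_upwards [S.ae_abs_W_le] with ω hω
    have h0 := Real.exp_pos (expRate K δ * driftLevel K δ (t + 1))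
    by_cases hmem : ω ∈ I.tame M T t
    · refine (Set.indicator_le_self' (fun _ _ => (Real.exp_pos _).le) _).trans ?_
      by_cases hq : driftThreshold K δ (t + 1) ≤ I.queueNorm (t + 1) ω
      · have hωA : ω ∈ A := ⟨hmem, hq⟩
        have h1 := S.exp_queueNorm_succ_le hδ1 ht hε (hω _ ht) hmem hq (hz.1 _)
          (hz.2.1 (I.c (t + 1) ω))
        simp only [hE, hF, Set.indicator_of_mem hωA, mul_assoc (_ / _), ← Finset.mul_sum]
        linarith
      · have hωA : ω ∉ A := fun h => hq h.2
        have h1 := S.exp_queueNorm_succ_le_of_lt hδ1 hε (hω _ ht) (not_le.1 hq)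
        simpa [hE, hF, hωA] using h1
    · have hωA : ω ∉ A := fun h => hmem h.1
      -- Tame events decrease in t: once left, the Lyapunov function stays zero.
      have hmem' : ω ∉ I.tame M T (t + 1) := fun h => hmem (I.tame_succ_subset M T t h)
      simpa [hE, hF, hωA, Interaction.lyapunov, hmem'] using h0.le
  have i0 : Integrable (fun _ : Ω => Real.exp (expRate K δ * driftLevel K δ (t + 1))) μ :=
    integrable_const _
  have i1 := iE.const_mul (1 + contraction K δ + expRate K δ * δ / 4)
  have i2 := (integrable_finsetSum Finset.univ fun k _ => iGU k).const_mul (expRate K δ)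
  have i3 := (integrable_finsetSum Finset.univ fun k _ => iG k).const_mul (expRate K δ * δ / 2)
  have h := integral_mono_ae (S.integrable_lyapunov ht'.2) (((i0.add i1).add i2).add i3) hpt
  rw [integral_add' ((i0.add i1).add i2) i3, integral_add' (i0.add i1) i2, integral_add' i0 i1,
    integral_const_mul, integral_const_mul, integral_const_mul, integral_finsetSum _ fun k _ => iG k,
    integral_finsetSum _ fun k _ => iGU k, integral_const, probReal_univ, one_smul,
    Finset.sum_congr rfl fun k _ => integral_mul_mixed_cost S.gen S.cost ht hz k (hGm k)] at h
  have hcost : ∑ k, (∫ ω, F ω * I.queue (t + 1) ω k ∂μ) * M.cost k z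
      ≤ -δ * ∑ k, ∫ ω, F ω * I.queue (t + 1) ω k ∂μ := by
    rw [Finset.mul_sum]
    refine Finset.sum_le_sum fun k _ => ?_
    have h1 : 0 ≤ ∫ ω, F ω * I.queue (t + 1) ω k ∂μ :=
      integral_nonneg fun ω => mul_nonneg (hF0 ω) (I.queue_nonneg _ _ _)
    rw [mul_comm (-δ)]
    exact mul_le_mul_of_nonneg_left (hzδ k) h1
  have hsum : ∫ ω, E ω ∂μ ≤ ∑ k, ∫ ω, F ω * I.queue (t + 1) ω k ∂μ := by
    rw [← integral_finsetSum _ fun k _ => iG k]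
    refine integral_mono iE (integrable_finsetSum _ fun k _ => iG k) fun ω => ?_
    simp only [← Finset.mul_sum]
    rw [hEF]
    exact mul_le_mul_of_nonneg_left (I.queueNorm_le_sum _ _) (hF0 ω)
  have hlyap : ∫ ω, E ω ∂μ ≤ ∫ ω, I.lyapunov M δ T t ω ∂μ :=
    integral_mono iE (S.integrable_lyapunov (by omega)) hEl
  have hK : (0 : ℝ) < K := by exact_mod_cast S.K_pos
  -- In units of c = `contraction`: second-order term +c, threshold term +2c, Slater gain net of
  -- slack -4c, altogether -c.
  have hrc : expRate K δ * δ / 4 = 2 * contraction K δ := by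
    rw [expRate, contraction]
    field_simp
    norm_num
  have hc := mul_le_mul_of_nonneg_left hcost hr.le
  have hs := mul_le_mul_of_nonneg_left hsum (by positivity : 0 ≤ expRate K δ * δ / 2)
  have hl := mul_le_mul_of_nonneg_left hlyap (sub_nonneg.2 hc1)
  generalize ∑ k, (∫ ω, F ω * I.queue (t + 1) ω k ∂μ) * M.cost k z = u at *
  generalize ∑ k, ∫ ω, F ω * I.queue (t + 1) ω k ∂μ = s at *
  generalize ∫ ω, E ω ∂μ = e at *
  have hrc' : expRate K δ * δ / 2 = 4 * contraction K δ := by linarith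
  have hc' : expRate K δ * u ≤ -(8 * contraction K δ * s) := by
    refine hc.trans (le_of_eq ?_)
    linear_combination (-2 * s) * hrc'
  rw [hrc, hrc'] at h
  rw [hrc'] at hs
  linarith

/-- The recursion L ≤ e + (1 - c)L' has fixed point e/c, and e is nondecreasing in t because V_t is.
-/
theorem IsRun.integral_lyapunov_le [IsProbabilityMeasure μ] (S : IsRun I M m δ T μ)
    (hδ1 : δ ≤ 1) (hslater : M.Slater δ) {t : ℕ} (ht : t ≤ T) :
    ∫ ω, I.lyapunov M δ T t ω ∂μ ≤
      Real.exp (expRate K δ * driftLevel K δ t) / contraction K δ := by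
  have hr := expRate_pos S.K_pos S.δ_pos
  have hc := contraction_pos S.K_pos S.δ_pos
  have hc1 := contraction_le_one S.K_pos S.δ_pos hδ1
  have hi := initialBound_nonneg (K := K) S.δ_pos
  have hle : ∀ s {b : ℝ}, b ≤ Real.exp (expRate K δ * driftLevel K δ s) →
      b ≤ Real.exp (expRate K δ * driftLevel K δ s) / contraction K δ := fun s b h =>
    h.trans (le_div_self (Real.exp_pos _).le hc hc1)
  have hlevel : ∀ s, initialBound K δ ≤ driftLevel K δ s := fun s => by
    have := driftThreshold_pos S.K_pos S.δ_pos s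
    have := Real.sqrt_nonneg (K : ℝ)
    unfold driftLevel
    linarith
  induction t with
  | zero =>
    apply hle
    calc _ ≤ ∫ _, (1 : ℝ) ∂μ := by
          refine integral_mono (S.integrable_lyapunov ht) (integrable_const _) fun ω => ?_
          refine (Set.indicator_le_self' (fun _ _ => (Real.exp_pos _).le) _).trans ?_
          simp [Interaction.queueNorm, Interaction.queueSq, Interaction.queue, Q_one]
      _ = 1 := by simp
      _ ≤ _ := Real.one_le_exp (mul_nonneg hr.le (hi.trans (hlevel 0)))
  | succ t ih =>
    have hmem : t + 1 ∈ Finset.Icc 1 T := Finset.mem_Icc.2 ⟨by omega, ht⟩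
    rcases le_or_gt (eps K (t + 1)) (δ / 2) with hε | hε
    · have h1 := S.integral_lyapunov_succ_le hδ1 hslater hmem hε
      have h2 := mul_le_mul_of_nonneg_left (ih (by omega)) (sub_nonneg.2 hc1)
      have h3 : Real.exp (expRate K δ * driftLevel K δ t) / contraction K δ ≤
          Real.exp (expRate K δ * driftLevel K δ (t + 1)) / contraction K δ := by
        have := driftThreshold_mono (K := K) S.δ_pos (Nat.le_succ t)
        unfold driftLevel
        gcongr
      have h4 := mul_le_mul_of_nonneg_left h3 (sub_nonneg.2 hc1)
      have h5 : Real.exp (expRate K δ * driftLevel K δ (t + 1))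
          = contraction K δ * (Real.exp (expRate K δ * driftLevel K δ (t + 1)) / contraction K δ) := by
        field_simp
      linarith
    -- Early rounds restart the induction: `initialBound` is part of `driftLevel`, so the crude
    -- bound suffices.
    · apply hle
      calc _ ≤ ∫ _, Real.exp (expRate K δ * driftLevel K δ (t + 1)) ∂μ := by
            refine integral_mono_ae (S.integrable_lyapunov ht) (integrable_const _) ?_
            filter_upwards [S.ae_queueNorm_le ht] with ω hω
            refine (Set.indicator_le_self' (fun _ _ => (Real.exp_pos _).le) _).trans ?_
            rw [Real.exp_le_exp]
            refine mul_le_mul_of_nonneg_left ?_ hr.le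
            exact hω.trans ((sqrt_mul_queueBound_le S.δ_pos (by omega) hε).trans (hlevel _))
        _ = _ := by simp

end Violation

/-! ### From the Lyapunov bound to the constraint violation -/

section ViolationBound

variable {Ω C : Type*} {mΩ : MeasurableSpace Ω} {μ : Measure Ω} [Countable C] [MeasurableSpace C]
  [MeasurableSingletonClass C] {d J K T : ℕ} {M : Model C d J K} {I : Interaction Ω C J K}
  {m δ : ℝ}

/-- The logarithm of the bound on the Lyapunov function, divided by its rate. -/
def queueLevel (K : ℕ) (δ : ℝ) (t : ℕ) : ℝ :=
  driftLevel K δ t + 1 / expRate K δ * Real.log (1 / contraction K δ)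

/-- On the tame event, Q ≤ a + exp(r(‖Q‖ - a))/r, with a chosen so that the last term has mean at
most 1/r. Off it, a probability of at most 1/T meets a bound of at most T(1 + 2κ), κ = `slackScale`;
nothing depending on T survives. -/
theorem IsRun.integral_queue_le [IsProbabilityMeasure μ] (S : IsRun I M m δ T μ) (hδ1 : δ ≤ 1)
    (hslater : M.Slater δ) {t : ℕ} (ht1 : 1 ≤ t) (ht : t ≤ T) (k : Fin K) :
    ∫ ω, I.queue (t + 1) ω k ∂μ ≤ queueLevel K δ t + 1 / expRate K δ + 1 + 2 * slackScale K := by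
  have hr := expRate_pos S.K_pos S.δ_pos
  have hc := contraction_pos S.K_pos S.δ_pos
  have hc1 := contraction_le_one S.K_pos S.δ_pos hδ1
  have hκ := slackScale_nonneg K
  have hT : 1 ≤ T := ht1.trans ht
  have hT0 : (0 : ℝ) < T := by exact_mod_cast hT
  have htT : (t : ℝ) ≤ T := by exact_mod_cast ht
  set a := queueLevel K δ t with ha
  have ha0 : 0 ≤ a := by
    have h1 := initialBound_nonneg (K := K) S.δ_pos
    have h2 := driftThreshold_pos S.K_pos S.δ_pos t
    have h3 : 0 ≤ Real.log (1 / contraction K δ) := Real.log_nonneg ((one_le_div hc).2 hc1)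
    rw [ha, queueLevel, driftLevel]
    positivity
  have hexp : Real.exp (expRate K δ * a) =
      Real.exp (expRate K δ * driftLevel K δ t) / contraction K δ := by
    rw [ha, queueLevel, mul_add, Real.exp_add, ← mul_assoc, mul_one_div_cancel hr.ne', one_mul,
      Real.exp_log (by positivity), mul_one_div]
  have hle := S.gen.history_le ht
  set B := I.tame M T t with hB
  have hBm : MeasurableSet B := hle _ (I.measurableSet_tame M T t)
  have hpt : ∀ᵐ ω ∂μ, I.queue (t + 1) ω k ≤ a
      + 1 / (expRate K δ * Real.exp (expRate K δ * a)) * I.lyapunov M δ T t ω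
      + Bᶜ.indicator (fun _ => queueBound K t) ω := by
    filter_upwards [S.ae_queue_le ht] with ω hω
    by_cases h : ω ∈ B
    · have h1 := I.queue_le_queueNorm (t + 1) ω k
      have h2 := Real.add_one_le_exp (expRate K δ * I.queueNorm (t + 1) ω - expRate K δ * a)
      rw [Real.exp_sub] at h2
      have h3 : I.queueNorm (t + 1) ω - a ≤
          1 / (expRate K δ * Real.exp (expRate K δ * a))
            * Real.exp (expRate K δ * I.queueNorm (t + 1) ω) := by
        rw [one_div_mul_eq_div, mul_comm (expRate K δ) (Real.exp _), ← div_div, le_div_iff₀ hr]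
        linarith
      have hcompl : ω ∉ Bᶜ := fun h' => h' h
      simp only [Interaction.lyapunov, ← hB, Set.indicator_of_mem h,
        Set.indicator_of_notMem hcompl]
      linarith
    · have hcompl : ω ∈ Bᶜ := h
      simp only [Interaction.lyapunov, ← hB, Set.indicator_of_notMem h,
        Set.indicator_of_mem hcompl]
      linarith [hω k]
  have i0 : Integrable (fun _ : Ω => a) μ := integrable_const _
  have i1 := (S.integrable_lyapunov ht).const_mul
    (1 / (expRate K δ * Real.exp (expRate K δ * a)))
  have i2 : Integrable (Bᶜ.indicator fun _ : Ω => queueBound K t) μ :=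
    (integrable_const _).indicator hBm.compl
  have h := integral_mono_ae (S.integrable_queue ht k) ((i0.add i1).add i2) hpt
  rw [integral_add' (i0.add i1) i2, integral_add' i0 i1, integral_const, probReal_univ, one_smul,
    integral_const_mul, integral_indicator hBm.compl, setIntegral_const, smul_eq_mul] at h
  have h1 : 1 / (expRate K δ * Real.exp (expRate K δ * a)) * ∫ ω, I.lyapunov M δ T t ω ∂μ
      ≤ 1 / expRate K δ := by
    have h2 := S.integral_lyapunov_le hδ1 hslater ht
    rw [← hexp] at h2
    calc _ ≤ 1 / (expRate K δ * Real.exp (expRate K δ * a)) * Real.exp (expRate K δ * a) :=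
          mul_le_mul_of_nonneg_left h2 (by positivity)
      _ = _ := by
        have := Real.exp_pos (expRate K δ * a)
        field_simp
  have h2 : μ.real Bᶜ ≤ 1 / T := by
    -- Ville's inequality at level T, the level at which the confidence radius becomes valid.
    have h3 := measure_compl_tame_le S.gen S.reward.noise
      (by exact_mod_cast hT : (1 : ℝ) ≤ T) ht
    have h4 := ENNReal.toReal_mono ENNReal.one_ne_top h3
    rw [ENNReal.toReal_mul, ENNReal.toReal_ofReal hT0.le, ENNReal.toReal_one] at h4
    rw [le_div_iff₀ hT0, mul_comm]
    exact h4
  have h3 : queueBound K t ≤ T * (1 + 2 * slackScale K) := by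
    have h4 : √(t : ℝ) ≤ t := by
      rw [Real.sqrt_le_left (by positivity)]
      have : (1 : ℝ) ≤ t := by exact_mod_cast ht1
      nlinarith
    rw [queueBound]
    calc _ ≤ (t : ℝ) + 2 * slackScale K * t := by gcongr
      _ = t * (1 + 2 * slackScale K) := by ring
      _ ≤ _ := by gcongr
  have h4 : μ.real Bᶜ * queueBound K t ≤ 1 + 2 * slackScale K := by
    calc _ ≤ 1 / T * (T * (1 + 2 * slackScale K)) :=
          mul_le_mul h2 h3 (queueBound_nonneg K t) (by positivity)
      _ = _ := by field_simp
  linarith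

/-- 1/`contraction` = (12/δ)²K, and log K ≤ K - 1. -/
theorem log_one_div_contraction_le {K : ℕ} (hK : 0 < K) {δ : ℝ} (hδ : 0 < δ) :
    Real.log (1 / contraction K δ) ≤ 2 * Real.log (16 / δ) + (K - 1) := by
  have h1 : (0 : ℝ) < K := by exact_mod_cast hK
  have e : 1 / contraction K δ = (12 / δ) ^ 2 * K := by
    rw [contraction]
    field_simp
    norm_num
  rw [e, Real.log_mul (by positivity) h1.ne', Real.log_pow]
  have h2 : Real.log (12 / δ) ≤ Real.log (16 / δ) := by
    apply Real.log_le_log (by positivity)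
    gcongr
    norm_num
  have h3 := Real.log_le_sub_one_of_pos h1
  push_cast
  linarith

theorem le_log_sixteen_div {δ : ℝ} (hδ : 0 < δ) (hδ1 : δ ≤ 1) : 2.7 ≤ Real.log (16 / δ) := by
  have h1 : Real.log 16 ≤ Real.log (16 / δ) :=
    Real.log_le_log (by norm_num) (le_div_self (by norm_num) hδ hδ1)
  have h2 : Real.log 16 = 4 * Real.log 2 := by
    rw [show (16 : ℝ) = 2 ^ 4 by norm_num, Real.log_pow]
    norm_num
  have := Real.log_two_gt_d9
  linarith

/-- The deterministic part of the bound on the constraint violation. -/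
theorem violation_terms_le {K : ℕ} (hK : 0 < K) {δ : ℝ} (hδ : 0 < δ) (hδ1 : δ ≤ 1) (t : ℕ) :
    queueLevel K δ t + 1 / expRate K δ + 1 + 2 * slackScale K
      - slackScale K * (2 * √t - 2) ≤ √K * (violationConst K δ - √t) := by
  -- All powers of K in the claim are powers of x, which makes it polynomial in x ≥ 1, w ≥ 1 and ℓ.
  set x := (K : ℝ) ^ (1 / 4 : ℝ) with hx
  set u := √(t : ℝ) with hu
  set w := 1 / δ with hw
  set ℓ := Real.log (16 / δ) with hℓ
  have hK1 : (1 : ℝ) ≤ K := by exact_mod_cast hK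
  have hK0 : (0 : ℝ) ≤ K := by linarith
  have hx1 : 1 ≤ x := Real.one_le_rpow hK1 (by norm_num)
  have hu0 : 0 ≤ u := Real.sqrt_nonneg _
  have hw1 : 1 ≤ w := (one_le_div hδ).2 hδ1
  have hℓ1 : 2.7 ≤ ℓ := le_log_sixteen_div hδ hδ1
  have k4 : (K : ℝ) = x ^ 4 := by
    rw [hx, ← Real.rpow_natCast, ← Real.rpow_mul hK0]
    norm_num
  have k2 : √(K : ℝ) = x ^ 2 := by
    rw [k4, show x ^ 4 = (x ^ 2) ^ 2 by ring, Real.sqrt_sq (by positivity)]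
  have k3 : (K : ℝ) ^ (3 / 4 : ℝ) = x ^ 3 := by
    rw [hx, ← Real.rpow_natCast, ← Real.rpow_mul hK0]
    norm_num
  have k6 : (K : ℝ) ^ (3 / 2 : ℝ) = x ^ 6 := by
    rw [hx, ← Real.rpow_natCast, ← Real.rpow_mul hK0]
    norm_num
  have s6 : √(6 : ℝ) ^ 2 = 6 := Real.sq_sqrt (by norm_num)
  have s6l : (2.4 : ℝ) ≤ √6 := Real.le_sqrt_of_sq_le (by norm_num)
  have s6u : √6 ≤ (2.45 : ℝ) := by
    rw [Real.sqrt_le_left (by norm_num)]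
    norm_num
  have hV : 4 * V K δ t / δ = 4 / 3 * √6 * x * u := by
    rw [V, sqrt_two_mul_div_three, ← hx, ← hu, show (2 : ℝ) / √6 = √6 / 3 by
      rw [div_eq_div_iff (by positivity) (by norm_num)]
      linarith]
    field_simp
  have hlevel : driftLevel K δ t = x ^ 2 * (24 * x ^ 6 * (w ^ 2 + w)) + 3 / 2 * x ^ 2
      + (4 / 3 * √6 * x * u + 9 / 2 * x ^ 4 * w) := by
    rw [← hV, driftLevel, initialBound, driftThreshold, k2, k6, k4, hw]
    ring
  have hrate : 1 / expRate K δ = 18 * x ^ 4 * w := by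
    rw [expRate, one_div_div, k4, hw]
    ring
  have hlog := log_one_div_contraction_le hK hδ
  rw [← hℓ, k4] at hlog
  have hconst : violationConst K δ = 48 * x ^ 8 * w * ℓ + 24 * x ^ 6 * w ^ 2 + 30 * x ^ 6 * w
      + 8 * x ^ 4 := by
    rw [violationConst, k6, k4, hw, ← hℓ]
    ring
  have hlog' := mul_le_mul_of_nonneg_left hlog (by positivity : 0 ≤ 18 * x ^ 4 * w)
  rw [queueLevel, hlevel, hrate, hconst, slackScale, k3, k2]
  -- The √t terms: 2√6·x³ from the slack beats (4/3)√6·x from the threshold, with x² = √K to spare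
  -- because (2/3)√6 ≥ 1.
  have hroot : u * (x ^ 2 + 4 / 3 * √6 * x) ≤ u * (2 * √6 * x ^ 3) := by
    refine mul_le_mul_of_nonneg_left ?_ hu0
    have h1 : x ^ 2 ≤ x ^ 3 := pow_le_pow_right₀ hx1 (by norm_num)
    have h2 : x ≤ x ^ 3 := by simpa using pow_le_pow_right₀ hx1 (by norm_num : 1 ≤ 3)
    have h3 := mul_le_mul_of_nonneg_left h2 (by positivity : 0 ≤ 4 / 3 * √6)
    have h4 : 0 ≤ (2 / 3 * √6 - 1) * x ^ 3 := mul_nonneg (by linarith) (by positivity)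
    linarith
  -- The constants, with the initial-phase terms 24x⁸(w² + w) already cancelled; these use up all of
  -- 24x⁶w² and 24 of the 30 in 30x⁶w.
  have hmain : 3 / 2 * x ^ 2 + 9 / 2 * x ^ 4 * w + 18 * x ^ 4 * w * (2 * ℓ + (x ^ 4 - 1))
      + 18 * x ^ 4 * w + 1 + 4 * (x ^ 3 * √6)
      ≤ x ^ 2 * (48 * x ^ 8 * w * ℓ + 6 * x ^ 6 * w + 8 * x ^ 4) := by
    have p1 : 1 ≤ x ^ 4 := one_le_pow₀ hx1
    have p2 : x ^ 2 ≤ x ^ 4 := pow_le_pow_right₀ hx1 (by norm_num)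
    have p3 : x ^ 3 ≤ x ^ 4 := pow_le_pow_right₀ hx1 (by norm_num)
    have p6 : x ^ 4 ≤ x ^ 6 := pow_le_pow_right₀ hx1 (by norm_num)
    have p10 : x ^ 8 ≤ x ^ 10 := pow_le_pow_right₀ hx1 (by norm_num)
    have q1 : x ^ 3 * √6 ≤ x ^ 4 * 2.45 := mul_le_mul p3 s6u (by positivity) (by positivity)
    have wl : 0 ≤ w * ℓ := by positivity
    have q2 : x ^ 8 * (w * ℓ) ≤ x ^ 10 * (w * ℓ) := mul_le_mul_of_nonneg_right p10 wl
    have q3 : 0 ≤ (x ^ 4 * (x ^ 4 - 1)) * (48 * (w * ℓ) - 12 * w) := by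
      refine mul_nonneg (mul_nonneg (by positivity) (by linarith)) ?_
      nlinarith
    have q4 : 0 ≤ x ^ 4 * (12 * (w * ℓ) + 8 - 16.5 * w - 12.3) := by
      refine mul_nonneg (by positivity) ?_
      nlinarith
    linarith
  linarith

theorem IsRun.violation_le [IsProbabilityMeasure μ] (S : IsRun I M m δ T μ) (hδ1 : δ ≤ 1)
    (hslater : M.Slater δ) {τ : ℕ} (hτ : 1 ≤ τ) (hτT : τ ≤ T) :
    I.violation μ τ ≤ (K : ℝ) ^ (3 / 2 : ℝ) * max (violationConst K δ - √τ) 0 := by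
  have hK : (0 : ℝ) < K := by exact_mod_cast S.K_pos
  have hm : ∀ t ∈ Finset.Icc 1 τ, t ∈ Finset.Icc 1 T := fun t ht =>
    Finset.Icc_subset_Icc_right hτT ht
  have hk : ∀ k, ∫ ω, ∑ t ∈ Finset.Icc 1 τ, ∑ j, I.W t ω k j * I.X t ω j ∂μ
      ≤ √K * (violationConst K δ - √τ) := by
    intro k
    have e : ∀ t ω, ∑ j, I.W t ω k j * I.X t ω j = I.paid t ω k := by
      intro t ω
      simp [Interaction.X, Interaction.paid]
    simp only [e]
    refine le_trans ?_ (violation_terms_le S.K_pos S.δ_pos hδ1 τ)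
    -- The costs paid are at most the final dual variable minus the accumulated slack.
    have h1 : ∫ ω, ∑ t ∈ Finset.Icc 1 τ, I.paid t ω k ∂μ ≤
        ∫ ω, (I.queue (τ + 1) ω k - ∑ s ∈ Finset.Icc 1 τ, eps K s) ∂μ := by
      refine integral_mono (integrable_finsetSum _ fun t ht => S.integrable_paid (hm t ht) k)
        ((S.integrable_queue hτT k).sub (integrable_const _)) fun ω => ?_
      have := le_Q_succ (W := fun s => I.W s ω) (A := fun s => I.A s ω) τ k
      exact le_sub_iff_add_le.2 this
    rw [integral_sub (S.integrable_queue hτT k) (integrable_const _), integral_const,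
      probReal_univ, one_smul, sum_eps_eq] at h1
    have h2 := S.integral_queue_le hδ1 hslater hτ hτT k
    have h3 := mul_le_mul_of_nonneg_left (le_sum_one_div_sqrt τ) (slackScale_nonneg K)
    linarith
  -- Each of the K constraints contributes √K times the same bracket, hence K^{3/2}.
  calc I.violation μ τ ≤ ∑ k : Fin K, √K * max (violationConst K δ - √τ) 0 := by
        refine Finset.sum_le_sum fun k _ => max_le ?_ (by positivity)
        exact (hk k).trans (mul_le_mul_of_nonneg_left (le_max_left _ _) (Real.sqrt_nonneg _))
    _ = _ := by
      rw [Finset.sum_const, Finset.card_univ, Fintype.card_fin, nsmul_eq_mul, ← mul_assoc]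
      congr 1
      rw [Real.sqrt_eq_rpow]
      nth_rewrite 1 [← Real.rpow_one (K : ℝ)]
      rw [← Real.rpow_add hK]
      norm_num

theorem IsRun.violation_eq_zero [IsProbabilityMeasure μ] (S : IsRun I M m δ T μ) (hδ1 : δ ≤ 1)
    (hslater : M.Slater δ) {τ : ℕ} (hτ : 1 ≤ τ) (hτT : τ ≤ T)
    (h : violationConst K δ ^ 2 ≤ τ) : I.violation μ τ = 0 := by
  refine le_antisymm ((S.violation_le hδ1 hslater hτ hτT).trans (le_of_eq ?_))
    (Finset.sum_nonneg fun k _ => le_max_right _ _)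
  rw [max_eq_right (sub_nonpos.2 (Real.le_sqrt_of_sq_le h)), mul_zero]

end ViolationBound

end

end ConstrainedBandit

theorem theorem1 {Ω : Type*} [MeasurableSpace Ω] (μ : Measure Ω) [IsProbabilityMeasure μ]
    {C : Type*} [Countable C] [MeasurableSpace C] [MeasurableSingletonClass C]
    (d J K T : ℕ) (hd : 0 < d) (hK : 0 < K)
    (M : ConstrainedBandit.Model C d J K) (I : ConstrainedBandit.Interaction Ω C J K)
    (m δ : ℝ) (hδ : 0 < δ) (hδ1 : δ ≤ 1)
    (hgen : I.GeneratedBy M T μ)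
    (hreward : ConstrainedBandit.RewardAssumption I M m T μ)
    (hcost : ConstrainedBandit.CostAssumption M)
    (hslater : M.Slater δ)
    (halg : I.FollowsAlgorithm M m δ T)
    (τ : ℕ) (hτ : 1 ≤ τ) (hτT : τ ≤ T) :
    I.regret M μ τ ≤
        60 * (K : ℝ) ^ 3 / δ ^ 3 + 4 * √6 * (K : ℝ) ^ (3 / 4 : ℝ) * √τ / δ + 2
          + √(8 * d * τ * ConstrainedBandit.sqrtBeta m d T τ ^ 2 * Real.log ((d + τ) / d)) ∧
      I.violation μ τ ≤
        (K : ℝ) ^ (3 / 2 : ℝ) * max (ConstrainedBandit.violationConst K δ - √τ) 0 ∧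
      (ConstrainedBandit.violationConst K δ ^ 2 ≤ τ → I.violation μ τ = 0) := by
  have S : ConstrainedBandit.IsRun I M m δ T μ := ⟨hd, hK, hδ, hgen, hreward, hcost, halg⟩
  exact ⟨S.regret_le hδ1 hslater hτ hτT, S.violation_le hδ1 hslater hτ hτT,
    S.violation_eq_zero hδ1 hslater hτ hτT⟩
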